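/- Let $N\ge 1$ and let $p=2n$ with $n\ge 1$ an integer. Let $\tau$ be the normalized real part of the trace of $M_N(\mathbb C)$, so $\tau(1)=1$, and let $\|x\|_p=\tau((x^*x)^n)^{1/p}$. For a piecewise $C^1$ path $\alpha:[0,1]\to GL(N)$ let $\mathcal L_p(\alpha)=\int_0^1\|\alpha^{-1}\dot\alpha\|_p\,dt$, and let $d_p(h,k)$ be the infimum of $\mathcal L_p(\alpha)$ over the piecewise $C^1$ paths $\alpha$ in $GL(N)$ from $h$ to $k$. For a path $\alpha:[0,1]\to GL(N)$ let $\ell_p(\alpha)=\sup\sum_i d_p(\alpha(t_i),\alpha(t_{i+1}))$, the supremum over all partitions of $[0,1]$; for $[s,t]\subseteq[0,1]$ define $\ell_p(\alpha|_{[s,t]})$ likewise with partitions of $[s,t]$. The path $\alpha$ is rectifiable if it is continuous and $\ell_p(\alpha)<\infty$, and a rectifiable path is minimizing if its length $\ell_p$ equals the infimum of the lengths $\ell_p$ of all rectifiable paths in $GL(N)$ with the same endpoints. A path $\beta:[0,1]\to GL(N)$ has constant speed if $\ell_p(\beta|_{[s,t]})=(t-s)\,\ell_p(\beta)$ for all $0\le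 s\le t\le 1$, and it is a constant speed parametrization of $\gamma$ if moreover $\gamma=\beta\circ\varphi$ for some continuous nondecreasing map $\varphi$ of $[0,1]$ onto itself (so a path $\gamma$ of constant speed is one of itself). Let $\gamma:[0,1]\to GL(N)$ be a rectifiable minimizing path. Then $\gamma$ has a constant speed parametrization, and every constant speed parametrization $\beta$ of $\gamma$ has the following properties. 1. $\beta$ is $C^\infty$ on $[0,1]$ as a map into $M_N(\mathbb C)$. 2. $g=\beta$ solves the Euler–Lagrange equation of the $p$-energy $\int_0^1\|g^{-1}\dot g\|_p^p\,dt$ on $[0,1]$, that is, with $v=g^{-1}\dot g$, $$\frac{d}{dt}\,v(v^*v)^{n-1}=(v^*v)^n-(vv^*)^n .$$ 3. $\beta$ is the only solution with its initial conditions: if $g:[0,1]\to GL(N)$ is differentiable, $v(v^*v)^{n-1}$ is differentiable and satisfies this equation on $[0,1]$, where $v=g^{-1}\dot g$, and $g(0)=\beta(0)$, $\dot g(0)=\dot\beta(0)$, then $g=\beta$ on $[0,1]$. (Derivatives at $0$ and $1$ are one-sided.) -/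

import Mathlib

open scoped Matrix.Norms.L2Operator ContDiff ENNReal
open Set

namespace GLp

noncomputable section

/-- The algebra of complex `N × N` matrices, with the uniform (spectral) norm. -/
abbrev Mat (N : ℕ) : Type := Matrix (Fin N) (Fin N) ℂ

/-- The group `GL(N)` of invertible complex `N × N` matrices. -/
abbrev GLN (N : ℕ) : Type := Matrix.GeneralLinearGroup (Fin N) ℂ

variable {N : ℕ}

/-- The normalized real part of the trace. -/
def tau (x : Mat N) : ℝ := (Matrix.trace x).re / N

/-- The `p`-norm for the even exponent `p = 2 * n`: `‖x‖_p = τ((x^* x)^n)^(1/p)`. -/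
def pNorm (n : ℕ) (x : Mat N) : ℝ :=
  tau ((x.conjTranspose * x) ^ n) ^ (1 / (2 * n : ℝ))

/-- A curve in `GL(N)`, regarded as a curve of matrices. Curves are parametrized by `[0,1]`; their
values outside `[0,1]` play no role in what follows. -/
def toMat (α : ℝ → GLN N) (t : ℝ) : Mat N := (α t : Mat N)

/-- The derivative of a curve on `[0,1]` (one-sided at the two endpoints). -/
def velocity (α : ℝ → GLN N) (t : ℝ) : Mat N := derivWithin (toMat α) (Icc 0 1) t

/-- The left translation `α⁻¹ α'` of the velocity to the identity. -/
def leftVelocity (α : ℝ → GLN N) (t : ℝ) : Mat N := ((α t)⁻¹ : GLN N) * velocity α t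

/-- Piecewise `C^1` paths on `[0,1]` with values in `GL(N)`. Consecutive pieces share an endpoint,
so that such a path is continuous. -/
def IsPiecewiseC1 (α : ℝ → GLN N) : Prop :=
  ∃ (k : ℕ) (t : ℕ → ℝ), t 0 = 0 ∧ t k = 1 ∧
    ∀ i < k, t i < t (i + 1) ∧ ContDiffOn ℝ 1 (toMat α) (Icc (t i) (t (i + 1)))

/-- The `p`-length `∫₀¹ ‖α⁻¹ α'‖_p` of a piecewise `C^1` path. -/
def smoothLength (n : ℕ) (α : ℝ → GLN N) : ℝ :=
  ∫ t in (0 : ℝ)..1, pNorm n (leftVelocity α t)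

/-- The distance `d_p`: the infimum of the `p`-lengths of the piecewise `C^1` paths from `h`
to `k`. -/
def pDist (n : ℕ) (h k : GLN N) : ℝ≥0∞ :=
  ⨅ (α : ℝ → GLN N) (_ : IsPiecewiseC1 α ∧ α 0 = h ∧ α 1 = k), ENNReal.ofReal (smoothLength n α)

/-- The rectifiable length `ℓ_p` of the restriction of `α` to `[a,b]`: the supremum, over all
partitions, of the sums of the `d_p`-distances between consecutive points. -/
def rectLength (n : ℕ) (α : ℝ → GLN N) (a b : ℝ) : ℝ≥0∞ :=
  ⨆ π : ℕ × {t : ℕ → ℝ // Monotone t ∧ ∀ i, t i ∈ Icc a b},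
    ∑ i ∈ Finset.range π.1, pDist n (α (π.2.1 i)) (α (π.2.1 (i + 1)))

/-- Rectifiable paths: continuous on `[0,1]`, of finite rectifiable length. -/
def IsRectifiable (n : ℕ) (α : ℝ → GLN N) : Prop :=
  ContinuousOn α (Icc 0 1) ∧ rectLength n α 0 1 < ⊤

/-- The infimum of the rectifiable lengths of the rectifiable paths from `h` to `k`. -/
def rectDist (n : ℕ) (h k : GLN N) : ℝ≥0∞ :=
  ⨅ (α : ℝ → GLN N) (_ : IsRectifiable n α ∧ α 0 = h ∧ α 1 = k), rectLength n α 0 1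

/-- The rectifiable length of `γ` is minimal among rectifiable paths with the same endpoints. -/
def IsMinimizing (n : ℕ) (γ : ℝ → GLN N) : Prop :=
  rectLength n γ 0 1 = rectDist n (γ 0) (γ 1)

/-- `γ` is parametrized on `[0,1]` with constant speed. -/
def HasConstantSpeed (n : ℕ) (γ : ℝ → GLN N) : Prop :=
  ∀ s t : ℝ, 0 ≤ s → s ≤ t → t ≤ 1 →
    rectLength n γ s t = ENNReal.ofReal (t - s) * rectLength n γ 0 1

/-- `β` is a parametrization of `γ` with constant speed: `γ = β ∘ φ` on `[0,1]`, for a continuous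
nondecreasing map `φ` of `[0,1]` onto itself. For `γ` itself of constant speed, `β = γ` is one. -/
def IsConstantSpeedParam (n : ℕ) (γ β : ℝ → GLN N) : Prop :=
  HasConstantSpeed n β ∧
    ∃ φ : ℝ → ℝ, ContinuousOn φ (Icc 0 1) ∧ MonotoneOn φ (Icc 0 1) ∧ φ 0 = 0 ∧ φ 1 = 1 ∧
      ∀ t ∈ Icc (0 : ℝ) 1, γ t = β (φ t)

/-- `g` solves on `[0,1]` the Euler-Lagrange equation of the `p`-energy `∫₀¹ ‖g⁻¹ g'‖_p^p`,
`p = 2 * n`: with `v = g⁻¹ g'`,  `(v (v^* v)^(n-1))' = (v^* v)^n - (v v^*)^n`. -/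
def IsEulerLagrange (n : ℕ) (g : ℝ → GLN N) : Prop :=
  DifferentiableOn ℝ (toMat g) (Icc 0 1) ∧
    ∀ t ∈ Icc (0 : ℝ) 1,
      HasDerivWithinAt
        (fun s => leftVelocity g s *
          ((leftVelocity g s).conjTranspose * leftVelocity g s) ^ (n - 1))
        (((leftVelocity g t).conjTranspose * leftVelocity g t) ^ n -
          (leftVelocity g t * (leftVelocity g t).conjTranspose) ^ n)
        (Icc 0 1) t

end

end GLp

/-! The proof rests on a conserved quantity. Let F(v) = v(v*v)^(n-1) (`gradMap`), which up to a
constant is the gradient of the convex function τ((v*v)^n) (`pEnergy`). With v = g⁻¹ġ, the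
Euler–Lagrange equation says exactly that the momentum c = (g⁻¹)* F(v) g* is constant. Since F is a
homeomorphism of the matrix algebra (`isHomeomorph_gradMap`), the equation becomes the first order
autonomous equation ġ = g F⁻¹(g* c (g⁻¹)*), with right side `odeField`.

The inverse function theorem makes F⁻¹ smooth only at invertible matrices, while c may be singular.
This is repaired by an orthogonal complement. Choose z with zc* = c*z = 0, filling the degenerate
directions of c, and put m = g* c (g⁻¹)*, Z = g⁻¹zg. Then Z is orthogonal to m on both sides for
every g, so F⁻¹(m + F(Z)) = F⁻¹(m) + Z, and m + F(Z) is invertible. Subtracting Z shows that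
`odeField` is smooth on all of GL(N) (`contDiffAt_odeField`). Smoothness of solutions and uniqueness
follow.

It remains to see that β solves the equation. Near the diagonal d_p(h,k) is the p-norm of h⁻¹k - 1
up to a factor close to 1. Hence a constant speed curve of finite length L is Lipschitz with speed
at most L almost everywhere, and a Lipschitz curve has rectifiable length at most the integral of
its speed. By minimality and Jensen's inequality, β minimizes the p-energy among Lipschitz curves
with its endpoints (`IsSpeedMinimizer.pEnergy_le`). Variations (1 + εu)β and a du Bois-Reymond
argument make the momentum constant almost everywhere (`IsSpeedMinimizer.exists_momentum`). Then β̇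
agrees almost everywhere with a continuous function of β, and integration gives the equation at
every point. -/

namespace GLp

open scoped Matrix Topology ComplexOrder

noncomputable section

variable {N : ℕ}

/-! ### The normalized trace -/

/-- The normalized real trace as a continuous real linear form. -/
def tauL (N : ℕ) : Mat N →L[ℝ] ℝ :=
  LinearMap.toContinuousLinearMap
    { toFun := tau
      map_add' := fun x y => by simp [tau, Matrix.trace_add, add_div]
      map_smul' := fun c x => by simp [tau, Matrix.trace_smul, mul_div_assoc] }

theorem tauL_apply (x : Mat N) : tauL N x = tau x := rfl

theorem tau_add (x y : Mat N) : tau (x + y) = tau x + tau y := map_add (tauL N) x y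

theorem tau_sub (x y : Mat N) : tau (x - y) = tau x - tau y := map_sub (tauL N) x y

theorem tau_smul (c : ℝ) (x : Mat N) : tau (c • x) = c * tau x := map_smul (tauL N) c x

theorem tau_sum {ι : Type*} (s : Finset ι) (x : ι → Mat N) :
    tau (∑ i ∈ s, x i) = ∑ i ∈ s, tau (x i) := map_sum (tauL N) x s

theorem continuous_tau : Continuous (tau : Mat N → ℝ) := (tauL N).continuous

theorem tau_mul_comm (x y : Mat N) : tau (x * y) = tau (y * x) := by
  simp [tau, Matrix.trace_mul_comm x y]

theorem tau_conjTranspose (x : Mat N) : tau xᴴ = tau x := by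
  simp [tau, Matrix.trace_conjTranspose]

theorem tau_nonneg_of_posSemidef {x : Mat N} (hx : x.PosSemidef) : 0 ≤ tau x :=
  div_nonneg (Complex.le_def.1 hx.trace_nonneg).1 (Nat.cast_nonneg N)

theorem tau_conjTranspose_mul_self_nonneg (x : Mat N) : 0 ≤ tau (xᴴ * x) :=
  tau_nonneg_of_posSemidef (Matrix.posSemidef_conjTranspose_mul_self x)

theorem posSemidef_eq_zero_of_tau (hN : 1 ≤ N) {x : Mat N} (hx : x.PosSemidef)
    (h : tau x = 0) : x = 0 := by
  have hN' : (N : ℝ) ≠ 0 := by positivity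
  rw [← hx.trace_eq_zero_iff]
  have h1 : x.trace.re = 0 := by simpa [tau, hN'] using h
  exact Complex.ext h1 ((Complex.le_def.1 hx.trace_nonneg).2).symm

theorem eq_zero_of_tau_conjTranspose_mul_self (hN : 1 ≤ N) {x : Mat N}
    (h : tau (xᴴ * x) = 0) : x = 0 :=
  Matrix.conjTranspose_mul_self_eq_zero.1
    (posSemidef_eq_zero_of_tau hN (Matrix.posSemidef_conjTranspose_mul_self x) h)

open scoped MatrixOrder in
theorem exists_eq_conjTranspose_mul_self {a : Mat N} (ha : a.PosSemidef) :
    ∃ y : Mat N, a = yᴴ * y :=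
  CStarAlgebra.nonneg_iff_eq_star_mul_self.1 ha.nonneg

/-- Writing b = y*y, cyclicity turns the trace into that of the positive matrix yay*. -/
theorem tau_mul_nonneg {a b : Mat N} (ha : a.PosSemidef) (hb : b.PosSemidef) :
    0 ≤ tau (a * b) := by
  obtain ⟨y, rfl⟩ := exists_eq_conjTranspose_mul_self hb
  rw [← Matrix.mul_assoc, tau_mul_comm, ← Matrix.mul_assoc]
  exact tau_nonneg_of_posSemidef (ha.mul_mul_conjTranspose_same y)

theorem posSemidef_pow_gram (x : Mat N) (k : ℕ) : ((xᴴ * x) ^ k).PosSemidef :=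
  (Matrix.posSemidef_conjTranspose_mul_self x).pow k

theorem conjTranspose_gram_pow (x : Mat N) (k : ℕ) : ((xᴴ * x) ^ k)ᴴ = (xᴴ * x) ^ k :=
  (posSemidef_pow_gram x k).isHermitian

/-! ### The energy density and its gradient -/

/-- The map `v ↦ v (v^* v)^(n-1)`, a multiple of the gradient of `v ↦ τ((v^* v)^n)`. -/
def gradMap (n : ℕ) (x : Mat N) : Mat N := x * (xᴴ * x) ^ (n - 1)

/-- The energy density `τ((x^* x)^n)`, that is the `2n`-th power of the `p`-norm. -/
def pEnergy (n : ℕ) (x : Mat N) : ℝ := tau ((xᴴ * x) ^ n)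

/-- The derivative of `gradMap n` at `x` in the direction `w`. -/
def gradDeriv (n : ℕ) (x w : Mat N) : Mat N :=
  w * (xᴴ * x) ^ (n - 1) + x * ∑ i ∈ Finset.range (n - 1),
    (xᴴ * x) ^ ((n - 1).pred - i) * (wᴴ * x + xᴴ * w) * (xᴴ * x) ^ i

theorem contDiff_conjTranspose : ContDiff ℝ ∞ (fun x : Mat N => xᴴ) :=
  (LinearMap.toContinuousLinearMap
    (Matrix.conjTransposeLinearEquiv (Fin N) (Fin N) ℝ ℂ).toLinearMap).contDiff

theorem contDiff_gradMap (n : ℕ) : ContDiff ℝ ∞ (gradMap n : Mat N → Mat N) := by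
  unfold gradMap
  exact contDiff_id.mul ((contDiff_conjTranspose.mul contDiff_id).pow _)

theorem continuous_gradMap (n : ℕ) : Continuous (gradMap n : Mat N → Mat N) :=
  (contDiff_gradMap n).continuous

theorem continuous_pEnergy (n : ℕ) : Continuous (pEnergy n : Mat N → ℝ) := by
  unfold pEnergy
  exact continuous_tau.comp (((contDiff_conjTranspose.mul contDiff_id).pow n).continuous)

theorem hasDerivWithinAt_conjTranspose {x : ℝ → Mat N} {x' : Mat N} {t : ℝ} {s : Set ℝ}
    (h : HasDerivWithinAt x x' s t) : HasDerivWithinAt (fun r => (x r)ᴴ) x'ᴴ s t :=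
  (LinearMap.toContinuousLinearMap
    (Matrix.conjTransposeLinearEquiv (Fin N) (Fin N) ℝ ℂ).toLinearMap).hasFDerivAt.comp_hasDerivWithinAt
      t h

theorem hasDerivAt_conjTranspose {x : ℝ → Mat N} {x' : Mat N} {t : ℝ}
    (h : HasDerivAt x x' t) : HasDerivAt (fun r => (x r)ᴴ) x'ᴴ t := by
  rw [← hasDerivWithinAt_univ] at *
  exact hasDerivWithinAt_conjTranspose h

theorem hasDerivAt_gradMap (n : ℕ) {x : ℝ → Mat N} {x' : Mat N} {t : ℝ}
    (h : HasDerivAt x x' t) :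
    HasDerivAt (fun r => gradMap n (x r)) (gradDeriv n (x t) x') t :=
  h.mul (((hasDerivAt_conjTranspose h).mul h).fun_pow' (n - 1))

theorem tau_conjTranspose_mul_gradMap {n : ℕ} (hn : 1 ≤ n) (x : Mat N) :
    tau (xᴴ * gradMap n x) = pEnergy n x := by
  obtain ⟨k, rfl⟩ : ∃ k, n = k + 1 := ⟨n - 1, by omega⟩
  simp [gradMap, pEnergy, pow_succ', mul_assoc]

/-- The noncommutative product rule gives n terms. Under the trace they all coincide by cyclicity,
and the two halves of each are adjoint to one another. -/
theorem hasDerivAt_pEnergy {n : ℕ} (hn : 1 ≤ n) {x : ℝ → Mat N} {x' : Mat N} {t : ℝ}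
    (h : HasDerivAt x x' t) :
    HasDerivAt (fun r => pEnergy n (x r)) (2 * n * tau ((gradMap n (x t))ᴴ * x')) t := by
  have h1 := (tauL N).hasFDerivAt.comp_hasDerivAt t
    (((hasDerivAt_conjTranspose h).mul h).fun_pow' n)
  refine h1.congr_deriv ?_
  simp only [tauL_apply, tau_sum]
  have h2 : ∀ i ∈ Finset.range n, tau (((x t)ᴴ * x t) ^ (n.pred - i) *
      (x'ᴴ * x t + (x t)ᴴ * x') * ((x t)ᴴ * x t) ^ i) = 2 * tau ((gradMap n (x t))ᴴ * x') := by
    intro i hi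
    have hi' := Finset.mem_range.1 hi
    rw [mul_assoc, tau_mul_comm, mul_assoc, ← pow_add,
      show i + (n.pred - i) = n - 1 by simp only [Nat.pred_eq_sub_one]; omega, add_mul, tau_add]
    have e1 : tau (x'ᴴ * x t * ((x t)ᴴ * x t) ^ (n - 1)) = tau ((gradMap n (x t))ᴴ * x') := by
      rw [← tau_conjTranspose]
      simp only [Matrix.conjTranspose_mul, conjTranspose_gram_pow, gradMap,
        Matrix.conjTranspose_conjTranspose]
      rw [mul_assoc]
    have e2 : tau ((x t)ᴴ * x' * ((x t)ᴴ * x t) ^ (n - 1)) = tau ((gradMap n (x t))ᴴ * x') := by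
      rw [tau_mul_comm]
      simp only [Matrix.conjTranspose_mul, conjTranspose_gram_pow, gradMap, mul_assoc]
    rw [e1, e2]; ring
  refine (Finset.sum_congr rfl h2).trans ?_
  simp; ring

/-- This is the Hessian estimate behind both convexity and the invertibility of the derivative of F:
the terms coming from the power of x*x contribute a nonnegative amount. -/
theorem tau_gradDeriv_ge (n : ℕ) (x w : Mat N) :
    tau (wᴴ * w * (xᴴ * x) ^ (n - 1)) ≤ tau (wᴴ * gradDeriv n x w) := by
  set h := xᴴ * x with hh
  set s := wᴴ * x + xᴴ * w with hs
  have hsH : sᴴ = s := by simp [hs, add_comm]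
  have hH : ∀ k, (h ^ k)ᴴ = h ^ k := fun k => conjTranspose_gram_pow x k
  set M := n - 1 with hM
  set A : ℝ := ∑ i ∈ Finset.range M, tau (wᴴ * x * (h ^ (M.pred - i) * s * h ^ i)) with hA
  have e0 : tau (wᴴ * gradDeriv n x w) = tau (wᴴ * w * h ^ M) + A := by
    rw [gradDeriv, mul_add, tau_add, ← mul_assoc, ← mul_assoc, Finset.mul_sum, tau_sum]
  have e1 : A = ∑ i ∈ Finset.range M, tau (xᴴ * w * (h ^ (M.pred - i) * s * h ^ i)) := by
    -- Taking adjoints exchanges w*x with x*w and the two powers of h; reversing the summation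
    -- restores the order of the powers.
    rw [hA, ← Finset.sum_range_reflect]
    refine Finset.sum_congr rfl fun i hi => ?_
    have hi' := Finset.mem_range.1 hi
    rw [← tau_conjTranspose]
    simp only [Matrix.conjTranspose_mul, hH, hsH, Matrix.conjTranspose_conjTranspose]
    rw [tau_mul_comm, show M.pred - (M - 1 - i) = i by simp only [Nat.pred_eq_sub_one]; omega,
      show M - 1 - i = M.pred - i from rfl]
    simp only [mul_assoc]
  -- Averaging the two expressions of A produces terms τ(s h^a s h^b) with s selfadjoint, each the
  -- trace of a product of two positive matrices.
  have e2 : 0 ≤ A + A := by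
    nth_rewrite 2 [e1]
    rw [hA, ← Finset.sum_add_distrib]
    refine Finset.sum_nonneg fun i _ => ?_
    rw [← tau_add, ← add_mul, ← hs, ← mul_assoc, ← mul_assoc]
    refine tau_mul_nonneg ?_ (posSemidef_pow_gram x i)
    have := (posSemidef_pow_gram x (M.pred - i)).mul_mul_conjTranspose_same s
    rwa [hsH] at this
  rw [e0]; linarith

theorem tau_gradDeriv_nonneg (n : ℕ) (x w : Mat N) : 0 ≤ tau (wᴴ * gradDeriv n x w) :=
  (tau_mul_nonneg (Matrix.posSemidef_conjTranspose_mul_self w)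
    (posSemidef_pow_gram x (n - 1))).trans (tau_gradDeriv_ge n x w)

/-- The lower bound of `tau_gradDeriv_ge` is a squared norm of w with weight (x*x)^(n-1), and this
weight is invertible together with x. -/
theorem gradDeriv_injective (hN : 1 ≤ N) (n : ℕ) {x w : Mat N} (hx : IsUnit x)
    (h : gradDeriv n x w = 0) : w = 0 := by
  have h1 := tau_gradDeriv_ge n x w
  rw [h, mul_zero, show tau (0 : Mat N) = 0 from map_zero (tauL N)] at h1
  have hu : IsUnit ((xᴴ * x) ^ (n - 1)) :=
    (((Matrix.isUnit_conjTranspose x).2 hx).mul hx).pow _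
  obtain ⟨y, hy⟩ := exists_eq_conjTranspose_mul_self (posSemidef_pow_gram x (n - 1))
  rw [hy] at h1 hu
  have e : tau ((w * yᴴ)ᴴ * (w * yᴴ)) = tau (wᴴ * w * (yᴴ * y)) := by
    rw [← mul_assoc (wᴴ * w), tau_mul_comm _ y]
    simp [mul_assoc]
  have h2 : w * yᴴ = 0 := eq_zero_of_tau_conjTranspose_mul_self hN
    (le_antisymm (e.trans_le h1) (tau_conjTranspose_mul_self_nonneg _))
  have h3 : w * (yᴴ * y) = 0 := by rw [← mul_assoc, h2, zero_mul]
  exact (hu.mul_left_eq_zero).1 h3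

/-! ### Convexity -/

theorem hasDerivAt_line (x w : Mat N) (s : ℝ) : HasDerivAt (fun r : ℝ => x + r • w) w s := by
  simpa using ((hasDerivAt_id s).smul_const w).const_add x

theorem convexOn_pEnergy_line {n : ℕ} (hn : 1 ≤ n) (x w : Mat N) :
    ConvexOn ℝ univ (fun r : ℝ => pEnergy n (x + r • w)) := by
  have hd : ∀ r : ℝ, HasDerivAt (fun r : ℝ => pEnergy n (x + r • w))
      (2 * n * tau (wᴴ * gradMap n (x + r • w))) r := fun r => by
    have := hasDerivAt_pEnergy hn (hasDerivAt_line x w r)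
    rw [← tau_conjTranspose] at this
    simpa using this
  have hd' : deriv (fun r : ℝ => pEnergy n (x + r • w)) =
      fun r => 2 * n * tau (wᴴ * gradMap n (x + r • w)) := funext fun r => (hd r).deriv
  have hd2 : ∀ r : ℝ, HasDerivAt (fun r => 2 * n * tau (wᴴ * gradMap n (x + r • w)))
      (2 * n * tau (wᴴ * gradDeriv n (x + r • w) w)) r := fun r =>
    ((tauL N).hasFDerivAt.comp_hasDerivAt r
      ((hasDerivAt_gradMap n (hasDerivAt_line x w r)).const_mul wᴴ)).const_mul _
  refine convexOn_univ_of_deriv2_nonneg (fun r => (hd r).differentiableAt) ?_ fun r => ?_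
  · rw [hd']; exact fun r => (hd2 r).differentiableAt
  · simp only [Function.iterate_succ, Function.iterate_zero, Function.comp_apply, id]
    rw [hd', (hd2 r).deriv]
    have := tau_gradDeriv_nonneg n (x + r • w) w
    positivity

theorem convexOn_pEnergy {n : ℕ} (hn : 1 ≤ n) : ConvexOn ℝ univ (pEnergy n : Mat N → ℝ) := by
  refine ⟨convex_univ, fun x _ y _ a b ha hb hab => ?_⟩
  have h := (convexOn_pEnergy_line hn x (y - x)).2 (mem_univ 0) (mem_univ 1) ha hb hab
  have e : a • x + b • y = x + b • (y - x) := by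
    obtain rfl : a = 1 - b := by linarith
    rw [smul_sub, sub_smul, one_smul]; abel
  rw [e]
  simpa using h

theorem pEnergy_gradient_le {n : ℕ} (hn : 1 ≤ n) (x y : Mat N) :
    pEnergy n x + 2 * n * tau ((gradMap n x)ᴴ * (y - x)) ≤ pEnergy n y := by
  have hc := convexOn_pEnergy_line hn x (y - x)
  have hd := hasDerivAt_pEnergy hn (hasDerivAt_line x (y - x) 0)
  have h := hc.le_slope_of_hasDerivAt (mem_univ 0) (mem_univ 1) one_pos hd
  simp [slope_def_field] at h
  linarith

end

end GLp

namespace GLp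

open scoped Matrix Topology ComplexOrder

noncomputable section

variable {N : ℕ}

/-! ### The `p`-norm is a norm -/

/-- One power is removed at a time: for z = h^(k+1) y one has z*z = y* h^k h^(k+2) y, which
vanishes. -/
theorem hermitian_mul_eq_zero_of_pow {h y : Mat N} (hh : h.IsHermitian) (k : ℕ)
    (H : h ^ (k + 1) * y = 0) : h * y = 0 := by
  induction k with
  | zero => simpa using H
  | succ k ih =>
    refine ih ?_
    rw [← Matrix.conjTranspose_mul_self_eq_zero, Matrix.conjTranspose_mul, (hh.pow _).eq,
      mul_assoc, ← mul_assoc (h ^ (k + 1)), ← pow_add,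
      show k + 1 + (k + 1) = k + (k + 1 + 1) by ring, pow_add, mul_assoc, H, mul_zero, mul_zero]

theorem mul_eq_zero_of_gram_pow {x y : Mat N} (k : ℕ) (H : (xᴴ * x) ^ (k + 1) * y = 0) :
    x * y = 0 := by
  have h := hermitian_mul_eq_zero_of_pow (Matrix.isHermitian_conjTranspose_mul_self x) k H
  rw [← Matrix.conjTranspose_mul_self_eq_zero, Matrix.conjTranspose_mul, mul_assoc,
    ← mul_assoc xᴴ, h, mul_zero]

theorem pEnergy_nonneg (n : ℕ) (x : Mat N) : 0 ≤ pEnergy n x :=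
  tau_nonneg_of_posSemidef (posSemidef_pow_gram x n)

theorem eq_zero_of_pEnergy (hN : 1 ≤ N) {n : ℕ} (hn : 1 ≤ n) {x : Mat N}
    (h : pEnergy n x = 0) : x = 0 := by
  obtain ⟨k, rfl⟩ : ∃ k, n = k + 1 := ⟨n - 1, by omega⟩
  have h1 := posSemidef_eq_zero_of_tau hN (posSemidef_pow_gram x (k + 1)) h
  simpa using mul_eq_zero_of_gram_pow (x := x) (y := 1) k (by rw [h1, zero_mul])

theorem pEnergy_smul (n : ℕ) (c : ℝ) (x : Mat N) :
    pEnergy n (c • x) = c ^ (2 * n) * pEnergy n x := by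
  have : (c • x)ᴴ * (c • x) = (c ^ 2) • (xᴴ * x) := by
    rw [Matrix.conjTranspose_smul, smul_mul_smul_comm]
    simp [sq]
  rw [pEnergy, this, smul_pow, tau_smul, pEnergy, pow_mul]

theorem pNorm_eq (n : ℕ) (x : Mat N) : pNorm n x = pEnergy n x ^ (1 / (2 * n : ℝ)) := rfl

theorem pNorm_nonneg (n : ℕ) (x : Mat N) : 0 ≤ pNorm n x :=
  Real.rpow_nonneg (pEnergy_nonneg n x) _

theorem pNorm_pow {n : ℕ} (hn : 1 ≤ n) (x : Mat N) : pNorm n x ^ (2 * n) = pEnergy n x := by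
  rw [pNorm_eq, ← Real.rpow_natCast, ← Real.rpow_mul (pEnergy_nonneg n x)]
  have : (n : ℝ) ≠ 0 := by positivity
  push_cast
  rw [one_div_mul_cancel (by positivity), Real.rpow_one]

theorem pNorm_zero {n : ℕ} (hn : 1 ≤ n) : pNorm n (0 : Mat N) = 0 := by
  have h := pNorm_pow hn (0 : Mat N)
  have h2 : pEnergy n (0 : Mat N) = 0 := by simpa [show n ≠ 0 by omega] using pEnergy_smul n 0 (0 : Mat N)
  rw [h2] at h
  exact pow_eq_zero_iff (by omega) |>.1 h

theorem pNorm_smul {n : ℕ} (hn : 1 ≤ n) (c : ℝ) (x : Mat N) :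
    pNorm n (c • x) = |c| * pNorm n x := by
  refine (pow_left_inj₀ (pNorm_nonneg n _) (by have := pNorm_nonneg n x; positivity)
    (show 2 * n ≠ 0 by omega)).1 ?_
  rw [pNorm_pow hn, mul_pow, pNorm_pow hn, pEnergy_smul, (even_two_mul n).pow_abs]

theorem eq_zero_of_pNorm (hN : 1 ≤ N) {n : ℕ} (hn : 1 ≤ n) {x : Mat N}
    (h : pNorm n x = 0) : x = 0 :=
  eq_zero_of_pEnergy hN hn (by rw [← pNorm_pow hn, h, zero_pow (by omega)])

theorem continuous_pNorm (n : ℕ) : Continuous (pNorm n : Mat N → ℝ) :=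
  (continuous_pEnergy n).rpow_const fun _ => Or.inr (by positivity)

/-- Minkowski's inequality from convexity and homogeneity of the energy: (x + y)/(a + b) is a convex
combination of the normalized vectors x/a and y/b, which have energy 1. -/
theorem pNorm_add_le (hN : 1 ≤ N) {n : ℕ} (hn : 1 ≤ n) (x y : Mat N) :
    pNorm n (x + y) ≤ pNorm n x + pNorm n y := by
  rcases (pNorm_nonneg n x).eq_or_lt with hx | hx
  · rw [eq_zero_of_pNorm hN hn hx.symm, zero_add, pNorm_zero hn, zero_add]
  rcases (pNorm_nonneg n y).eq_or_lt with hy | hy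
  · rw [eq_zero_of_pNorm hN hn hy.symm, add_zero, pNorm_zero hn, add_zero]
  set a := pNorm n x
  set b := pNorm n y
  have hu : ∀ z : Mat N, 0 < pNorm n z → pEnergy n ((pNorm n z)⁻¹ • z) = 1 := fun z hz => by
    rw [pEnergy_smul, ← pNorm_pow hn, ← mul_pow, inv_mul_cancel₀ hz.ne', one_pow]
  have h := (convexOn_pEnergy hn).2 (mem_univ (a⁻¹ • x)) (mem_univ (b⁻¹ • y))
    (show 0 ≤ a / (a + b) by positivity) (show 0 ≤ b / (a + b) by positivity) (by field_simp)
  rw [hu x hx, hu y hy] at h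
  have e : (a / (a + b)) • a⁻¹ • x + (b / (a + b)) • b⁻¹ • y = (a + b)⁻¹ • (x + y) := by
    rw [smul_smul, smul_smul, smul_add]
    congr 2 <;> field_simp
  rw [e, pEnergy_smul, ← pNorm_pow hn, ← mul_pow] at h
  have h1 : (a / (a + b)) • (1 : ℝ) + (b / (a + b)) • (1 : ℝ) = 1 := by
    simp only [smul_eq_mul]; field_simp
  rw [h1] at h
  have h2 : (a + b)⁻¹ * pNorm n (x + y) ≤ 1 := by
    by_contra hc
    exact absurd h (not_le.2 (one_lt_pow₀ (not_le.1 hc) (by omega)))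
  rwa [inv_mul_le_iff₀ (by positivity), mul_one] at h2

theorem convexOn_pNorm (hN : 1 ≤ N) {n : ℕ} (hn : 1 ≤ n) :
    ConvexOn ℝ univ (pNorm n : Mat N → ℝ) := by
  refine ⟨convex_univ, fun x _ y _ a b ha hb _ => (pNorm_add_le hN hn _ _).trans ?_⟩
  rw [pNorm_smul hn, pNorm_smul hn, abs_of_nonneg ha, abs_of_nonneg hb]
  rfl

theorem exists_pNorm_equiv (hN : 1 ≤ N) {n : ℕ} (hn : 1 ≤ n) :
    ∃ C : ℝ, 1 ≤ C ∧ (∀ x : Mat N, pNorm n x ≤ C * ‖x‖) ∧ ∀ x : Mat N, ‖x‖ ≤ C * pNorm n x := by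
  have hK : IsCompact (Metric.sphere (0 : Mat N) 1) := isCompact_sphere 0 1
  obtain ⟨A, hA⟩ := hK.exists_bound_of_continuousOn (continuous_pNorm n).continuousOn
  have hpos : ∀ x ∈ Metric.sphere (0 : Mat N) 1, pNorm n x ≠ 0 := fun x hx h => by
    rw [eq_zero_of_pNorm hN hn h] at hx
    simp at hx
  obtain ⟨B, hB⟩ := hK.exists_bound_of_continuousOn ((continuous_pNorm n).continuousOn.inv₀ hpos)
  have hs : ∀ x : Mat N, x ≠ 0 → ‖x‖⁻¹ • x ∈ Metric.sphere (0 : Mat N) 1 := fun x hx => by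
    simp [norm_smul, hx]
  refine ⟨max 1 (max A B), le_max_left _ _, fun x => ?_, fun x => ?_⟩
  · rcases eq_or_ne x 0 with rfl | hx
    · simp [pNorm_zero hn]
    have hx' := norm_pos_iff.2 hx
    have h := (le_abs_self _).trans (hA _ (hs x hx))
    rw [pNorm_smul hn, abs_of_pos (by positivity), inv_mul_le_iff₀ hx'] at h
    rw [mul_comm]
    exact h.trans (by gcongr; exact (le_max_left _ _).trans (le_max_right _ _))
  · rcases eq_or_ne x 0 with rfl | hx
    · simp [pNorm_zero hn]
    have hx' := norm_pos_iff.2 hx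
    have h := (le_abs_self _).trans (hB _ (hs x hx))
    have hp : 0 < pNorm n x := (pNorm_nonneg n x).lt_of_ne' fun h => hx (eq_zero_of_pNorm hN hn h)
    simp only [Pi.inv_apply] at h
    rw [pNorm_smul hn, abs_of_pos (by positivity), mul_inv, inv_inv, ← div_eq_mul_inv,
      div_le_iff₀ hp] at h
    exact h.trans (by gcongr; exact (le_max_right _ _).trans (le_max_right _ _))

/-! ### The gradient map is a homeomorphism -/

/-- Quadratic growth is all that the later arguments use; the -1 absorbs the unit ball, where the
power 2n is smaller than the square. -/
theorem exists_coercive_pEnergy (hN : 1 ≤ N) {n : ℕ} (hn : 1 ≤ n) :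
    ∃ c : ℝ, 0 < c ∧ ∀ x : Mat N, c * (‖x‖ ^ 2 - 1) ≤ pEnergy n x := by
  obtain ⟨C, hC, -, h⟩ := exists_pNorm_equiv (N := N) hN hn
  refine ⟨(C ^ (2 * n))⁻¹, by positivity, fun x => ?_⟩
  rw [inv_mul_le_iff₀ (by positivity), ← pNorm_pow hn, ← mul_pow]
  rcases le_total ‖x‖ 1 with h1 | h1
  · have := mul_nonneg (zero_le_one.trans hC) (pNorm_nonneg n x)
    have h2 : ‖x‖ ^ 2 ≤ 1 := pow_le_one₀ (norm_nonneg x) h1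
    have h3 : 0 ≤ (C * pNorm n x) ^ (2 * n) := by positivity
    linarith
  · have h2 : ‖x‖ ^ 2 ≤ ‖x‖ ^ (2 * n) := pow_le_pow_right₀ h1 (by omega)
    have h3 : ‖x‖ ^ (2 * n) ≤ (C * pNorm n x) ^ (2 * n) := by gcongr; exact h x
    linarith

theorem tau_mul_le (x y : Mat N) : tau (x * y) ≤ ‖tauL N‖ * (‖x‖ * ‖y‖) :=
  (le_abs_self _).trans (((tauL N).le_opNorm (x * y)).trans (by gcongr; exact norm_mul_le x y))

theorem norm_conjTranspose_mat (x : Mat N) : ‖xᴴ‖ = ‖x‖ := Matrix.l2_opNorm_conjTranspose x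

open Filter in
-- A preimage of m is a minimizer of x ↦ τ((x*x)^n) - 2n τ(m*x), which exists because the energy
-- outgrows the linear term.
theorem gradMap_surjective (hN : 1 ≤ N) {n : ℕ} (hn : 1 ≤ n) :
    Function.Surjective (gradMap n : Mat N → Mat N) := by
  intro m
  obtain ⟨c, hc, hcoer⟩ := exists_coercive_pEnergy (N := N) hN hn
  have hcont : Continuous fun x : Mat N => pEnergy n x - 2 * n * tau (mᴴ * x) :=
    (continuous_pEnergy n).sub (continuous_const.mul
      (continuous_tau.comp (continuous_const.mul continuous_id)))
  have hlim : Tendsto (fun x : Mat N => pEnergy n x - 2 * n * tau (mᴴ * x)) (cocompact _) atTop := by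
    set K := 2 * n * ‖tauL N‖ * ‖m‖
    have h1 : Tendsto (fun r : ℝ => r * (c * r - K) - c) atTop atTop :=
      tendsto_atTop_add_const_right _ _ (tendsto_id.atTop_mul_atTop₀
        (tendsto_atTop_add_const_right _ _ (tendsto_id.const_mul_atTop hc)))
    refine tendsto_atTop_mono (fun x => ?_) (h1.comp (tendsto_norm_cocompact_atTop (E := Mat N)))
    have h2 := tau_mul_le mᴴ x
    rw [norm_conjTranspose_mat] at h2
    have h3 : 2 * n * tau (mᴴ * x) ≤ 2 * n * (‖tauL N‖ * (‖m‖ * ‖x‖)) := by gcongr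
    have h4 := hcoer x
    simp only [Function.comp_apply]
    have : K * ‖x‖ = 2 * n * (‖tauL N‖ * (‖m‖ * ‖x‖)) := by ring
    nlinarith
  obtain ⟨x, hx⟩ := hcont.exists_forall_le hlim
  refine ⟨x, ?_⟩
  -- The defect itself is the test direction: stationarity along w reads τ(w*w) = 0.
  set w := gradMap n x - m with hw
  have hd : HasDerivAt (fun r : ℝ => pEnergy n (x + r • w) - 2 * n * tau (mᴴ * (x + r • w)))
      (2 * n * tau ((gradMap n (x + (0 : ℝ) • w))ᴴ * w) - 2 * n * tau (mᴴ * w)) 0 :=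
    (hasDerivAt_pEnergy hn (hasDerivAt_line x w 0)).sub
      (((tauL N).hasFDerivAt.comp_hasDerivAt (0 : ℝ)
        ((hasDerivAt_line x w 0).const_mul mᴴ)).const_mul _)
  have hmin : IsLocalMin (fun r : ℝ => pEnergy n (x + r • w) - 2 * n * tau (mᴴ * (x + r • w))) 0 :=
    Eventually.of_forall fun r => by simpa using hx (x + r • w)
  have h0 := hmin.hasDerivAt_eq_zero hd
  rw [zero_smul, add_zero, ← mul_sub, ← tau_sub, ← sub_mul, ← Matrix.conjTranspose_sub, ← hw] at h0
  have h1 : tau (wᴴ * w) = 0 := by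
    have : (n : ℝ) ≠ 0 := by positivity
    simpa [this] using h0
  exact sub_eq_zero.1 (eq_zero_of_tau_conjTranspose_mul_self hN h1)

open scoped MatrixOrder in
theorem posSemidef_pow_injective {a b : Mat N} (ha : a.PosSemidef) (hb : b.PosSemidef) {k : ℕ}
    (hk : k ≠ 0) (h : a ^ k = b ^ k) : a = b := by
  have key : ∀ c : Mat N, c.PosSemidef → (c ^ k) ^ (1 / (k : ℝ)) = c := fun c hc => by
    have hk' : (k : ℝ) ≠ 0 := by positivity
    rw [← CFC.rpow_natCast c k hc.nonneg, CFC.rpow_rpow_of_exponent_nonneg c _ _ (by positivity)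
      (by positivity) hc.nonneg, mul_one_div_cancel hk', CFC.rpow_one c hc.nonneg]
  rw [← key a ha, h, key b hb]

theorem gram_gradMap {n : ℕ} (hn : 1 ≤ n) (x : Mat N) :
    (gradMap n x)ᴴ * gradMap n x = (xᴴ * x) ^ (2 * n - 1) := by
  rw [gradMap, Matrix.conjTranspose_mul, conjTranspose_gram_pow, mul_assoc, ← mul_assoc xᴴ,
    ← pow_succ', ← pow_add]
  congr 1; omega

theorem mul_gram_pow_eq_zero {x y : Mat N} (k : ℕ) (H : y * (xᴴ * x) ^ (k + 1) = 0) :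
    y * xᴴ = 0 := by
  have := mul_eq_zero_of_gram_pow (x := x) (y := yᴴ) k (by
    rw [← conjTranspose_gram_pow, ← Matrix.conjTranspose_mul, H, Matrix.conjTranspose_zero])
  rw [← Matrix.conjTranspose_eq_zero]
  simpa using this

/-- F(x) determines (x*x)^(2n-1), hence x*x by uniqueness of positive roots. Then x - y kills a
power of x*x = y*y, hence both x* and y*, hence (x - y)*. -/
theorem gradMap_injective {n : ℕ} (hn : 1 ≤ n) :
    Function.Injective (gradMap n : Mat N → Mat N) := by
  intro x y h
  have h1 : xᴴ * x = yᴴ * y := by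
    refine posSemidef_pow_injective (Matrix.posSemidef_conjTranspose_mul_self x)
      (Matrix.posSemidef_conjTranspose_mul_self y) (show 2 * n - 1 ≠ 0 by omega) ?_
    rw [← gram_gradMap hn, ← gram_gradMap hn, h]
  have h2 : (x - y) * (xᴴ * x) ^ (n - 1) = 0 := by
    rw [sub_mul, sub_eq_zero]
    nth_rewrite 2 [h1]
    exact h
  -- The extra factor makes the exponent positive, since n - 1 may be 0.
  have h3 : (x - y) * (xᴴ * x) ^ (n - 1 + 1) = 0 := by rw [pow_succ, ← mul_assoc, h2, zero_mul]
  have h4 := mul_gram_pow_eq_zero _ h3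
  rw [h1] at h3
  have h5 := mul_gram_pow_eq_zero _ h3
  have h6 : (x - y) * (x - y)ᴴ = 0 := by
    rw [Matrix.conjTranspose_sub, mul_sub, h4, h5, sub_zero]
  exact sub_eq_zero.1 (Matrix.self_mul_conjTranspose_eq_zero.1 h6)

/-- Coercivity against τ(x*F(x)) = τ((x*x)^n) bounds the norm of x by that of F(x). This makes F
proper, hence closed. -/
theorem exists_norm_le_gradMap (hN : 1 ≤ N) {n : ℕ} (hn : 1 ≤ n) :
    ∃ K : ℝ, 0 < K ∧ ∀ x : Mat N, ‖x‖ ≤ K * (‖gradMap n x‖ + 1) := by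
  obtain ⟨c, hc, hcoer⟩ := exists_coercive_pEnergy (N := N) hN hn
  refine ⟨1 + ‖tauL N‖ / c, by positivity, fun x => ?_⟩
  have h1 := tau_mul_le xᴴ (gradMap n x)
  rw [tau_conjTranspose_mul_gradMap hn, norm_conjTranspose_mat] at h1
  have h2 := (hcoer x).trans h1
  have hF := norm_nonneg (gradMap n x)
  have hq : 0 ≤ ‖tauL N‖ / c := by positivity
  have h3 : ‖x‖ ^ 2 - 1 ≤ (‖tauL N‖ / c) * ‖gradMap n x‖ * ‖x‖ := by
    rw [← mul_le_mul_iff_right₀ hc]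
    refine h2.trans (le_of_eq ?_)
    field_simp
  by_contra! hcon
  have h4 : 1 < ‖x‖ := by nlinarith [mul_nonneg hq hF]
  nlinarith [mul_nonneg hq hF]

open Filter in
theorem isHomeomorph_gradMap (hN : 1 ≤ N) {n : ℕ} (hn : 1 ≤ n) :
    IsHomeomorph (gradMap n : Mat N → Mat N) := by
  refine isHomeomorph_iff_continuous_isClosedMap_bijective.2
    ⟨continuous_gradMap n, ?_, gradMap_injective hn, gradMap_surjective hN hn⟩
  refine IsProperMap.isClosedMap (isProperMap_iff_tendsto_cocompact.2 ⟨continuous_gradMap n, ?_⟩)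
  obtain ⟨K, hK, h⟩ := exists_norm_le_gradMap (N := N) hN hn
  rw [← Metric.cobounded_eq_cocompact, ← comap_norm_atTop, tendsto_comap_iff]
  refine tendsto_atTop_mono (fun x => (?_ : ‖x‖ / K - 1 ≤ _))
    (tendsto_atTop_add_const_right _ _ (tendsto_comap.atTop_div_const hK))
  have := h x
  simp only [Function.comp_apply]
  rw [sub_le_iff_le_add, div_le_iff₀ hK]
  linarith

/-- The inverse of `gradMap`. -/
def gradHomeo (hN : 1 ≤ N) {n : ℕ} (hn : 1 ≤ n) : Mat N ≃ₜ Mat N :=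
  (isHomeomorph_gradMap (N := N) hN hn).homeomorph

theorem gradMap_symm (hN : 1 ≤ N) {n : ℕ} (hn : 1 ≤ n) (m : Mat N) :
    gradMap n ((gradHomeo hN hn).symm m) = m := (gradHomeo hN hn).apply_symm_apply m

theorem symm_gradMap (hN : 1 ≤ N) {n : ℕ} (hn : 1 ≤ n) (x : Mat N) :
    (gradHomeo hN hn).symm (gradMap n x) = x := (gradHomeo hN hn).symm_apply_apply x

/-- An invertible m has an invertible preimage, where the derivative of F is injective; the inverse
function theorem applies. -/
theorem contDiffAt_gradHomeo_symm (hN : 1 ≤ N) {n : ℕ} (hn : 1 ≤ n) {m : Mat N}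
    (hm : IsUnit m) : ContDiffAt ℝ ∞ (gradHomeo hN hn).symm m := by
  set x := (gradHomeo hN hn).symm m with hx
  have hxm : gradMap n x = m := gradMap_symm hN hn m
  have hux : IsUnit x := by
    rw [← hxm, gradMap] at hm
    rw [Matrix.isUnit_iff_isUnit_det, Matrix.det_mul] at hm
    exact (Matrix.isUnit_iff_isUnit_det x).2 (isUnit_of_mul_isUnit_left hm)
  have hdiff : DifferentiableAt ℝ (gradMap n) x :=
    (contDiff_gradMap n).contDiffAt.differentiableAt (by simp)
  have hD : ∀ w, fderiv ℝ (gradMap n) x w = gradDeriv n x w := fun w => by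
    have h1 := hdiff.hasFDerivAt.comp_hasDerivAt_of_eq (0 : ℝ) (hasDerivAt_line x w 0) (by simp)
    have h2 := hasDerivAt_gradMap n (hasDerivAt_line x w 0)
    simp only [zero_smul, add_zero] at h2
    exact h1.unique h2
  have hinj : Function.Injective (fderiv ℝ (gradMap n) x) := by
    refine (injective_iff_map_eq_zero _).2 fun w hw => ?_
    rw [hD] at hw
    exact gradDeriv_injective hN n hux hw
  let e : Mat N ≃L[ℝ] Mat N :=
    (LinearEquiv.ofInjectiveEndo (fderiv ℝ (gradMap n) x).toLinearMap hinj).toContinuousLinearEquiv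
  have he : (e : Mat N →L[ℝ] Mat N) = fderiv ℝ (gradMap n) x := by
    ext1 w; rfl
  exact (gradHomeo hN hn).toOpenPartialHomeomorph.contDiffAt_symm (a := m) (mem_univ _)
    (f₀' := e) (by rw [he]; exact hdiff.hasFDerivAt) (contDiff_gradMap n).contDiffAt

end

end GLp

namespace GLp

open scoped Matrix Topology ComplexOrder

noncomputable section

variable {N : ℕ}

/-! ### Orthogonal splitting of the gradient map -/

theorem add_mul_add_pow {v z a b : Mat N} (hab : a * b = 0) (hba : b * a = 0) (hvb : v * b = 0)
    (hza : z * a = 0) (k : ℕ) : (v + z) * (a + b) ^ k = v * a ^ k + z * b ^ k := by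
  induction k generalizing v z with
  | zero => simp
  | succ k ih =>
    have h : (v + z) * (a + b) = v * a + z * b := by
      rw [add_mul, mul_add, mul_add, hvb, hza, add_zero, zero_add]
    rw [pow_succ', ← mul_assoc, h, ih (by rw [mul_assoc, hab, mul_zero])
      (by rw [mul_assoc, hba, mul_zero]), mul_assoc, mul_assoc, ← pow_succ', ← pow_succ']

theorem gradMap_add {v z : Mat N} (n : ℕ) (h1 : vᴴ * z = 0) (h2 : v * zᴴ = 0) :
    gradMap n (v + z) = gradMap n v + gradMap n z := by
  have h1' : zᴴ * v = 0 := by simpa using congrArg Matrix.conjTranspose h1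
  have h2' : z * vᴴ = 0 := by simpa using congrArg Matrix.conjTranspose h2
  have e : (v + z)ᴴ * (v + z) = vᴴ * v + zᴴ * z := by
    rw [Matrix.conjTranspose_add, add_mul, mul_add, mul_add, h1, h1', add_zero, zero_add]
  rw [gradMap, e]
  refine add_mul_add_pow ?_ ?_ ?_ ?_ _
  · rw [mul_assoc, ← mul_assoc v, h2, zero_mul, mul_zero]
  · rw [mul_assoc, ← mul_assoc z, h2', zero_mul, mul_zero]
  · rw [← mul_assoc, h2, zero_mul]
  · rw [← mul_assoc, h2', zero_mul]

/-- Orthogonality of z to m passes to v = F⁻¹(m), because v and v* kill what the corresponding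
powers of the Gram matrix kill. F is additive on pairs orthogonal on both sides. -/
theorem gradHomeo_symm_add (hN : 1 ≤ N) {n : ℕ} (hn : 1 ≤ n) {m z : Mat N}
    (h1 : z * mᴴ = 0) (h2 : mᴴ * z = 0) :
    (gradHomeo hN hn).symm (m + gradMap n z) = (gradHomeo hN hn).symm m + z := by
  set v := (gradHomeo hN hn).symm m with hv
  have hm : gradMap n v = m := gradMap_symm hN hn m
  have h1' : m * zᴴ = 0 := by simpa using congrArg Matrix.conjTranspose h1
  have e1 : v * zᴴ = 0 := by
    refine mul_eq_zero_of_gram_pow (n - 1) ?_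
    rw [pow_succ', mul_assoc, mul_assoc, ← mul_assoc v, ← gradMap, hm, h1', mul_zero]
  have e2 : vᴴ * z = 0 := by
    have h3 : (vᴴ * v) ^ (n - 1 + 1) * (vᴴ * z) = 0 := by
      rw [← hm, gradMap, Matrix.conjTranspose_mul, conjTranspose_gram_pow, mul_assoc] at h2
      rw [pow_succ', mul_assoc, h2, mul_zero]
    have h4 := mul_eq_zero_of_gram_pow _ h3
    rw [← Matrix.conjTranspose_mul_self_eq_zero, Matrix.conjTranspose_mul,
      Matrix.conjTranspose_conjTranspose, mul_assoc, h4, mul_zero]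
  rw [← hm, ← gradMap_add n e2 e1, symm_gradMap]

theorem isUnit_of_left_cancel {a : Mat N} (h : ∀ x : Mat N, a * x = 0 → x = 0) : IsUnit a := by
  have hinj : Function.Injective (LinearMap.mulLeft ℂ a) :=
    (injective_iff_map_eq_zero _).2 fun x hx => h x hx
  obtain ⟨b, hb⟩ := LinearMap.injective_iff_surjective.1 hinj 1
  exact IsUnit.of_mul_eq_one b hb

theorem isUnit_add_gradMap (n : ℕ) {m z : Mat N} (h2 : mᴴ * z = 0)
    (hker : ∀ x : Mat N, m * x = 0 → z * x = 0 → x = 0) : IsUnit (m + gradMap n z) := by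
  refine isUnit_of_left_cancel fun x hx => ?_
  have h3 : mᴴ * m * x = 0 := by
    have := congrArg (mᴴ * ·) hx
    simp only [mul_zero] at this
    rwa [← mul_assoc, mul_add, gradMap, ← mul_assoc mᴴ z, h2, zero_mul, add_zero] at this
  have h4 : m * x = 0 := mul_eq_zero_of_gram_pow 0 (by simpa using h3)
  rw [add_mul, h4, zero_add] at hx
  refine hker x h4 (mul_eq_zero_of_gram_pow (n - 1) ?_)
  rw [pow_succ', mul_assoc, mul_assoc, ← mul_assoc z, ← gradMap, hx, mul_zero]

/-- For every matrix `c` there is a matrix which is orthogonal to `c` on both sides and which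
completes all the conjugates of `c` to an injective matrix. -/
theorem exists_orthogonal_complement (c : Mat N) :
    ∃ z : Mat N, z * cᴴ = 0 ∧ cᴴ * z = 0 ∧
      ∀ g x : Mat N, IsUnit g → c * x = 0 → z * (g * gᴴ * x) = 0 → x = 0 := by
  obtain ⟨l, r, D, hc⟩ := Matrix.Pivot.exists_list_transvec_mul_diagonal_mul_list_transvec c
  set L := (l.map Matrix.TransvectionStruct.toMatrix).prod with hL
  set R := (r.map Matrix.TransvectionStruct.toMatrix).prod with hR
  have huL : IsUnit L.det := by simp [hL]
  have huR : IsUnit R.det := by simp [hR]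
  set E : Mat N := Matrix.diagonal fun i => if D i = 0 then 1 else 0 with hE
  have hLL : (L⁻¹)ᴴ * Lᴴ = 1 ∧ Lᴴ * (L⁻¹)ᴴ = 1 := by
    rw [← Matrix.conjTranspose_mul, ← Matrix.conjTranspose_mul, Matrix.mul_nonsing_inv _ huL,
      Matrix.nonsing_inv_mul _ huL]
    simp
  have hRR : (R⁻¹)ᴴ * Rᴴ = 1 ∧ Rᴴ * (R⁻¹)ᴴ = 1 := by
    rw [← Matrix.conjTranspose_mul, ← Matrix.conjTranspose_mul, Matrix.mul_nonsing_inv _ huR,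
      Matrix.nonsing_inv_mul _ huR]
    simp
  have hED : E * (Matrix.diagonal D)ᴴ = 0 := by
    rw [hE, Matrix.diagonal_conjTranspose, Matrix.diagonal_mul_diagonal, ← Matrix.diagonal_zero]
    congr 1; ext i; by_cases h : D i = 0 <;> simp [h]
  have hDE : (Matrix.diagonal D)ᴴ * E = 0 := by
    rw [hE, Matrix.diagonal_conjTranspose, Matrix.diagonal_mul_diagonal, ← Matrix.diagonal_zero]
    congr 1; ext i; by_cases h : D i = 0 <;> simp [h]
  have hEH : Eᴴ = E := by
    rw [hE, Matrix.diagonal_conjTranspose]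
    congr 1; ext i; by_cases h : D i = 0 <;> simp [h]
  have hEone : E = 1 - Matrix.diagonal (fun i => (D i)⁻¹) * Matrix.diagonal D := by
    rw [hE, Matrix.diagonal_mul_diagonal, ← Matrix.diagonal_one, Matrix.diagonal_sub]
    congr 1; ext i; by_cases h : D i = 0 <;> simp [h]
  have hcH : cᴴ = Rᴴ * (Matrix.diagonal D)ᴴ * Lᴴ := by
    rw [hc]; simp only [Matrix.conjTranspose_mul, mul_assoc]
  -- With c = LDR, where L and R are invertible, D is diagonal and E projects on the zero entries of
  -- D, the factors cancel in zc* and c*z and leave ED* = 0 and D*E = 0.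
  refine ⟨(L⁻¹)ᴴ * E * (R⁻¹)ᴴ, ?_, ?_, fun g x hg hcx hzx => ?_⟩
  · rw [hcH]
    calc _ = (L⁻¹)ᴴ * (E * (((R⁻¹)ᴴ * Rᴴ) * (Matrix.diagonal D)ᴴ)) * Lᴴ := by
          simp only [mul_assoc]
      _ = 0 := by rw [hRR.1, one_mul, hED]; simp
  · rw [hcH]
    calc _ = Rᴴ * ((Matrix.diagonal D)ᴴ * ((Lᴴ * (L⁻¹)ᴴ) * E)) * (R⁻¹)ᴴ := by
          simp only [mul_assoc]
      _ = 0 := by rw [hLL.2, one_mul, hDE]; simp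
  · have h1 : Matrix.diagonal D * (R * x) = 0 := by
      have : L⁻¹ * (c * x) = 0 := by rw [hcx, mul_zero]
      rwa [hc, mul_assoc, mul_assoc, ← mul_assoc L⁻¹, Matrix.nonsing_inv_mul _ huL,
        one_mul] at this
    have h2 : E * (R * x) = R * x := by rw [hEone, sub_mul, one_mul, mul_assoc, h1, mul_zero, sub_zero]
    have h3 : E * ((R⁻¹)ᴴ * (g * gᴴ * x)) = 0 := by
      have : Lᴴ * ((L⁻¹)ᴴ * E * (R⁻¹)ᴴ * (g * gᴴ * x)) = 0 := by rw [hzx, mul_zero]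
      rwa [mul_assoc, mul_assoc, ← mul_assoc Lᴴ, hLL.2, one_mul] at this
    -- Since cx = 0 gives ERx = Rx, this pairing equals x*gg*x, so g*x = 0.
    have h4 : (E * (R * x))ᴴ * ((R⁻¹)ᴴ * (g * gᴴ * x)) = 0 := by
      rw [Matrix.conjTranspose_mul, hEH, mul_assoc, h3, mul_zero]
    rw [h2, Matrix.conjTranspose_mul, mul_assoc, ← mul_assoc Rᴴ, hRR.2, one_mul] at h4
    have h5 : (gᴴ * x)ᴴ * (gᴴ * x) = 0 := by
      rw [← h4]; simp only [Matrix.conjTranspose_mul, Matrix.conjTranspose_conjTranspose, mul_assoc]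
    exact (((Matrix.isUnit_conjTranspose g).2 hg).mul_right_eq_zero).1
      (Matrix.conjTranspose_mul_self_eq_zero.1 h5)

/-! ### The vector field of the Euler-Lagrange equation -/

/-- The vector field on `GL(N)` whose integral curves are the extremals of momentum `c`. -/
def odeField (hN : 1 ≤ N) {n : ℕ} (hn : 1 ≤ n) (c g : Mat N) : Mat N :=
  g * (gradHomeo hN hn).symm (gᴴ * c * (g⁻¹)ᴴ)

theorem contDiffAt_inv {g : Mat N} (hg : IsUnit g) :
    ContDiffAt ℝ ∞ (fun x : Mat N => x⁻¹) g := by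
  obtain ⟨u, rfl⟩ := hg
  have : (fun x : Mat N => x⁻¹) = Ring.inverse := funext Matrix.nonsing_inv_eq_ringInverse
  rw [this]
  exact contDiffAt_ringInverse ℝ u

/-- A single z, chosen from c alone, serves for all x: conjugation gives Z(x) = x⁻¹zx, orthogonal to
m(x) on both sides. Near g the field is therefore x(F⁻¹(m + F(Z)) - Z), where F⁻¹ is evaluated near
an invertible matrix. -/
theorem contDiffAt_odeField (hN : 1 ≤ N) {n : ℕ} (hn : 1 ≤ n) (c : Mat N) {g : Mat N}
    (hg : IsUnit g) : ContDiffAt ℝ ∞ (odeField hN hn c) g := by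
  obtain ⟨z, hz1, hz2, hz3⟩ := exists_orthogonal_complement c
  let Z : Mat N → Mat N := fun x => x⁻¹ * z * x
  let m : Mat N → Mat N := fun x => xᴴ * c * (x⁻¹)ᴴ
  have hinv : ∀ x : Mat N, IsUnit x → x⁻¹ * x = 1 ∧ x * x⁻¹ = 1 := fun x hx => by
    have := (Matrix.isUnit_iff_isUnit_det x).1 hx
    exact ⟨Matrix.nonsing_inv_mul _ this, Matrix.mul_nonsing_inv _ this⟩
  have hmH : ∀ x, (m x)ᴴ = x⁻¹ * cᴴ * x := fun x => by
    simp only [m, Matrix.conjTranspose_mul, Matrix.conjTranspose_conjTranspose, mul_assoc]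
  have h1 : ∀ x, IsUnit x → Z x * (m x)ᴴ = 0 := fun x hx => by
    rw [hmH]
    calc x⁻¹ * z * x * (x⁻¹ * cᴴ * x) = x⁻¹ * (z * ((x * x⁻¹) * cᴴ)) * x := by
          simp only [mul_assoc]
      _ = 0 := by rw [(hinv x hx).2, one_mul, hz1]; simp
  have h2 : ∀ x, IsUnit x → (m x)ᴴ * Z x = 0 := fun x hx => by
    rw [hmH]
    calc x⁻¹ * cᴴ * x * (x⁻¹ * z * x) = x⁻¹ * (cᴴ * ((x * x⁻¹) * z)) * x := by
          simp only [mul_assoc]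
      _ = 0 := by rw [(hinv x hx).2, one_mul, hz2]; simp
  -- In the variable (g⁻¹)*y the two conditions become those of `exists_orthogonal_complement`; this
  -- is where its factor gg* comes from.
  have hker : ∀ y : Mat N, m g * y = 0 → Z g * y = 0 → y = 0 := fun y hy1 hy2 => by
    have hH : gᴴ * (g⁻¹)ᴴ = 1 ∧ (g⁻¹)ᴴ * gᴴ = 1 := by
      rw [← Matrix.conjTranspose_mul, ← Matrix.conjTranspose_mul, (hinv g hg).1, (hinv g hg).2]
      simp
    have e1 : c * ((g⁻¹)ᴴ * y) = 0 := by
      have : (g⁻¹)ᴴ * (gᴴ * c * (g⁻¹)ᴴ * y) = 0 := by rw [show _ * y = 0 from hy1, mul_zero]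
      rwa [mul_assoc, mul_assoc, ← mul_assoc _ gᴴ, hH.2, one_mul] at this
    have e2 : z * (g * gᴴ * ((g⁻¹)ᴴ * y)) = 0 := by
      have : g * (g⁻¹ * z * g * y) = 0 := by rw [show _ * y = 0 from hy2, mul_zero]
      rw [mul_assoc, mul_assoc, ← mul_assoc g, (hinv g hg).2, one_mul] at this
      rw [mul_assoc, ← mul_assoc gᴴ, hH.1, one_mul, this]
    have e3 := hz3 g _ hg e1 e2
    calc y = gᴴ * ((g⁻¹)ᴴ * y) := by rw [← mul_assoc, hH.1, one_mul]
      _ = 0 := by rw [e3, mul_zero]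
  have hunit : IsUnit (m g + gradMap n (Z g)) := isUnit_add_gradMap n (h2 g hg) hker
  have hI := contDiffAt_inv hg
  have hZ : ContDiffAt ℝ ∞ Z g := (hI.mul contDiffAt_const).mul contDiffAt_id
  have hm : ContDiffAt ℝ ∞ m g :=
    (contDiff_conjTranspose.contDiffAt.mul contDiffAt_const).mul
      (contDiff_conjTranspose.contDiffAt.comp g hI)
  have hS : ContDiffAt ℝ ∞
      (fun x => x * ((gradHomeo hN hn).symm (m x + gradMap n (Z x)) - Z x)) g :=
    contDiffAt_id.mul (((contDiffAt_gradHomeo_symm hN hn hunit).comp g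
      (hm.add ((contDiff_gradMap n).contDiffAt.comp g hZ))).sub hZ)
  refine hS.congr_of_eventuallyEq ?_
  have hopen : ∀ᶠ x in 𝓝 g, IsUnit x := Units.isOpen.mem_nhds hg
  filter_upwards [hopen] with x hx
  rw [gradHomeo_symm_add hN hn (h1 x hx) (h2 x hx), add_sub_cancel_right]
  rfl

/-! ### Regularity and uniqueness for autonomous equations -/

theorem contDiffOn_of_autonomous {E : Type*} [NormedAddCommGroup E] [NormedSpace ℝ E]
    {G : E → E} {β : ℝ → E} (hβ : ∀ t ∈ Icc (0 : ℝ) 1, HasDerivWithinAt β (G (β t)) (Icc 0 1) t)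
    (hG : ∀ t ∈ Icc (0 : ℝ) 1, ContDiffAt ℝ ∞ G (β t)) : ContDiffOn ℝ ∞ β (Icc 0 1) := by
  refine contDiffOn_infty.2 fun k => ?_
  induction k with
  | zero =>
    exact contDiffOn_zero.2 fun t ht => (hβ t ht).continuousWithinAt
  | succ k ih =>
    have hu := uniqueDiffOn_Icc (zero_lt_one (α := ℝ))
    push_cast
    rw [contDiffOn_succ_iff_derivWithin hu]
    refine ⟨fun t ht => (hβ t ht).differentiableWithinAt, by simp, ?_⟩
    refine ContDiffOn.congr (f := fun t => G (β t)) (fun t ht => ?_)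
      fun t ht => (hβ t ht).derivWithin (hu t ht)
    exact ((hG t ht).of_le (by exact_mod_cast le_top)).comp_contDiffWithinAt t (ih t ht)

/-- The coincidence set is closed, and it extends to the right because G is Lipschitz near the
common value. Regularity of G is needed only along β. -/
theorem eqOn_of_autonomous {E : Type*} [NormedAddCommGroup E] [NormedSpace ℝ E]
    {G : E → E} {β g : ℝ → E} (hβ : ∀ t ∈ Icc (0 : ℝ) 1, HasDerivWithinAt β (G (β t)) (Icc 0 1) t)
    (hg : ∀ t ∈ Icc (0 : ℝ) 1, HasDerivWithinAt g (G (g t)) (Icc 0 1) t)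
    (hG : ∀ t ∈ Icc (0 : ℝ) 1, ContDiffAt ℝ 1 G (β t)) (h0 : g 0 = β 0) :
    EqOn g β (Icc 0 1) := by
  have hcβ : ContinuousOn β (Icc 0 1) := fun t ht => (hβ t ht).continuousWithinAt
  have hcg : ContinuousOn g (Icc 0 1) := fun t ht => (hg t ht).continuousWithinAt
  have hclosed : IsClosed ({t | g t = β t} ∩ Icc (0 : ℝ) 1) := by
    have := (hcg.sub hcβ).preimage_isClosed_of_isClosed isClosed_Icc (isClosed_singleton (x := 0))
    convert this using 1
    ext t; simp [sub_eq_zero, and_comm]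
  refine fun t ht => hclosed.Icc_subset_of_forall_exists_gt h0 (fun a ⟨ha, ha1⟩ b hb => ?_) ht
  have haI : a ∈ Icc (0 : ℝ) 1 := Ico_subset_Icc_self ha1
  obtain ⟨K, s, hs, hK⟩ := (hG a haI).exists_lipschitzOnWith
  have e1 : ∀ᶠ t in 𝓝[Icc 0 1] a, β t ∈ s := hcβ a haI hs
  have e2 : ∀ᶠ t in 𝓝[Icc 0 1] a, g t ∈ s := hcg a haI (by rw [show g a = β a from ha]; exact hs)
  obtain ⟨ε, hε, hball⟩ := Metric.mem_nhdsWithin_iff.1 (e1.and e2)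
  obtain ⟨b', hab', hb'⟩ := exists_between
    (lt_min (lt_min (lt_add_of_pos_right a hε) ha1.2) (mem_Ioi.1 hb))
  have hb1 : b' < a + ε := hb'.trans_le ((min_le_left _ _).trans (min_le_left _ _))
  have hb2 : b' < 1 := hb'.trans_le ((min_le_left _ _).trans (min_le_right _ _))
  have hb3 : b' < b := hb'.trans_le (min_le_right _ _)
  have hsub : Icc a b' ⊆ Icc 0 1 := Icc_subset_Icc ha1.1 hb2.le
  have hin : ∀ t ∈ Ico a b', β t ∈ s ∧ g t ∈ s := fun t ht => by
    refine hball ⟨?_, hsub (Ico_subset_Icc_self ht)⟩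
    rw [Metric.mem_ball, Real.dist_eq, abs_of_nonneg (by linarith [ht.1])]
    linarith [ht.2]
  have hder : ∀ f : ℝ → E, (∀ t ∈ Icc (0 : ℝ) 1, HasDerivWithinAt f (G (f t)) (Icc 0 1) t) →
      ∀ t ∈ Ico a b', HasDerivWithinAt f (G (f t)) (Ici t) t := fun f hf t ht => by
    refine (hf t (hsub (Ico_subset_Icc_self ht))).mono_of_mem_nhdsWithin ?_
    exact Filter.mem_of_superset (Icc_mem_nhdsGE (show t < 1 by linarith [ht.2]))
      (Icc_subset_Icc (by linarith [ht.1, ha1.1]) le_rfl)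
  have := ODE_solution_unique_of_mem_Icc_right (v := fun _ => G) (s := fun _ => s) (K := K)
    (fun _ _ => hK) (hcg.mono hsub) (hder g hg) (fun t ht => (hin t ht).2) (hcβ.mono hsub)
    (hder β hβ) (fun t ht => (hin t ht).1) ha
  exact ⟨b', this ⟨hab'.le, le_rfl⟩, hab', hb3.le⟩

end

end GLp

namespace GLp

open scoped Matrix Topology ComplexOrder

noncomputable section

variable {N : ℕ}

/-! ### The Euler-Lagrange equation as an autonomous equation -/

theorem isUnit_toMat (g : ℝ → GLN N) (t : ℝ) : IsUnit (toMat g t) := (g t).isUnit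

theorem coe_inv_eq (g : ℝ → GLN N) (t : ℝ) : (((g t)⁻¹ : GLN N) : Mat N) = (toMat g t)⁻¹ :=
  Matrix.coe_units_inv (g t)

theorem toMat_inv_mul (g : ℝ → GLN N) (t : ℝ) : (toMat g t)⁻¹ * toMat g t = 1 := by
  rw [← coe_inv_eq]; exact (g t).inv_mul

theorem toMat_mul_inv (g : ℝ → GLN N) (t : ℝ) : toMat g t * (toMat g t)⁻¹ = 1 := by
  rw [← coe_inv_eq]; exact (g t).mul_inv

theorem leftVelocity_eq (g : ℝ → GLN N) (t : ℝ) :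
    leftVelocity g t = (toMat g t)⁻¹ * velocity g t := by
  rw [leftVelocity, coe_inv_eq]

theorem toMat_mul_leftVelocity (g : ℝ → GLN N) (t : ℝ) :
    toMat g t * leftVelocity g t = velocity g t := by
  rw [leftVelocity_eq, ← mul_assoc, toMat_mul_inv, one_mul]

theorem hasDerivWithinAt_inv {x : ℝ → Mat N} {x' : Mat N} {t : ℝ} {s : Set ℝ}
    (hx : IsUnit (x t)) (h : HasDerivWithinAt x x' s t) :
    HasDerivWithinAt (fun r => (x r)⁻¹) (-((x t)⁻¹ * x' * (x t)⁻¹)) s t := by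
  obtain ⟨u, hu⟩ := hx
  have h1 := (hasFDerivAt_ringInverse (𝕜 := ℝ) u)
  rw [hu] at h1
  have h2 := h1.comp_hasDerivWithinAt t h
  have e : (Ring.inverse ∘ x) = fun r => (x r)⁻¹ :=
    funext fun r => (Matrix.nonsing_inv_eq_ringInverse (x r)).symm
  rw [e] at h2
  refine h2.congr_deriv ?_
  simp [← hu]

theorem conjTranspose_mul_gradMap {n : ℕ} (hn : 1 ≤ n) (v : Mat N) :
    vᴴ * gradMap n v = (vᴴ * v) ^ n := by
  obtain ⟨k, rfl⟩ : ∃ k, n = k + 1 := ⟨n - 1, by omega⟩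
  rw [gradMap, ← mul_assoc, Nat.add_sub_cancel, pow_succ']

theorem gradMap_mul_conjTranspose {n : ℕ} (hn : 1 ≤ n) (v : Mat N) :
    gradMap n v * vᴴ = (v * vᴴ) ^ n := by
  obtain ⟨k, rfl⟩ : ∃ k, n = k + 1 := ⟨n - 1, by omega⟩
  rw [gradMap, Nat.add_sub_cancel]
  induction k with
  | zero => simp
  | succ k ih => rw [pow_succ, ← mul_assoc, mul_assoc _ _ vᴴ, mul_assoc vᴴ, ← mul_assoc _ vᴴ,
      ih (by omega), ← pow_succ]

/-- Along a solution F(v) = g* c (g⁻¹)*. Differentiating with ġ = gv gives v*F(v) - F(v)v*, the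
right side of the equation. -/
theorem isEulerLagrange_of_ode (hN : 1 ≤ N) {n : ℕ} (hn : 1 ≤ n) {g : ℝ → GLN N} (c : Mat N)
    (h : ∀ t ∈ Icc (0 : ℝ) 1,
      HasDerivWithinAt (toMat g) (odeField hN hn c (toMat g t)) (Icc 0 1) t) :
    IsEulerLagrange n g := by
  have hu := uniqueDiffOn_Icc (zero_lt_one (α := ℝ))
  refine ⟨fun t ht => (h t ht).differentiableWithinAt, fun t ht => ?_⟩
  have hv : ∀ t ∈ Icc (0 : ℝ) 1, gradMap n (leftVelocity g t) =
      (toMat g t)ᴴ * c * ((toMat g t)⁻¹)ᴴ := fun t ht => by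
    rw [leftVelocity_eq, velocity, (h t ht).derivWithin (hu t ht), odeField, ← mul_assoc,
      toMat_inv_mul, one_mul, gradMap_symm]
  set v := leftVelocity g t
  have h1 : HasDerivWithinAt (toMat g) (toMat g t * v) (Icc 0 1) t := by
    rw [toMat_mul_leftVelocity]; exact (h t ht).differentiableWithinAt.hasDerivWithinAt
  have h2 := hasDerivWithinAt_conjTranspose (hasDerivWithinAt_inv (isUnit_toMat g t) h1)
  have h3 := ((hasDerivWithinAt_conjTranspose h1).mul_const c).mul h2
  refine (h3.congr (fun s hs => hv s hs) (hv t ht)).congr_deriv ?_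
  rw [← conjTranspose_mul_gradMap hn, ← gradMap_mul_conjTranspose hn, hv t ht,
    ← mul_assoc (toMat g t)⁻¹, toMat_inv_mul, one_mul]
  simp only [Matrix.conjTranspose_mul, Matrix.conjTranspose_neg, mul_neg, mul_assoc, sub_eq_add_neg]

/-- The derivative of (g⁻¹)* F(v) g* vanishes by the equation, so the momentum keeps its initial
value; inverting F recovers v. -/
theorem ode_of_isEulerLagrange (hN : 1 ≤ N) {n : ℕ} (hn : 1 ≤ n) {g : ℝ → GLN N}
    (hg : IsEulerLagrange n g) :
    ∀ t ∈ Icc (0 : ℝ) 1, HasDerivWithinAt (toMat g)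
      (odeField hN hn (((toMat g 0)⁻¹)ᴴ * gradMap n (leftVelocity g 0) * (toMat g 0)ᴴ) (toMat g t))
      (Icc 0 1) t := by
  obtain ⟨hd, hEL⟩ := hg
  let w : ℝ → Mat N := fun t => ((toMat g t)⁻¹)ᴴ * gradMap n (leftVelocity g t) * (toMat g t)ᴴ
  have hw : ∀ t ∈ Icc (0 : ℝ) 1, HasDerivWithinAt w 0 (Icc 0 1) t := fun t ht => by
    set v := leftVelocity g t
    have h1 : HasDerivWithinAt (toMat g) (toMat g t * v) (Icc 0 1) t := by
      rw [toMat_mul_leftVelocity]; exact (hd t ht).hasDerivWithinAt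
    have h2 := hasDerivWithinAt_conjTranspose (hasDerivWithinAt_inv (isUnit_toMat g t) h1)
    have h3 := (h2.mul (hEL t ht)).mul (hasDerivWithinAt_conjTranspose h1)
    refine h3.congr_deriv ?_
    rw [← conjTranspose_mul_gradMap hn, ← gradMap_mul_conjTranspose hn,
      ← mul_assoc (toMat g t)⁻¹, toMat_inv_mul, one_mul]
    change (_ * gradMap n v + _) * _ + _ * gradMap n v * _ = _
    simp only [Matrix.conjTranspose_mul, Matrix.conjTranspose_neg]
    noncomm_ring
  have hconst : ∀ t ∈ Icc (0 : ℝ) 1, w t = w 0 :=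
    constant_of_derivWithin_zero (fun t ht => (hw t ht).differentiableWithinAt)
      fun t ht => (hw t (Ico_subset_Icc_self ht)).derivWithin
        (uniqueDiffOn_Icc (zero_lt_one (α := ℝ)) t (Ico_subset_Icc_self ht))
  intro t ht
  have e : (toMat g t)ᴴ * w 0 * ((toMat g t)⁻¹)ᴴ = gradMap n (leftVelocity g t) := by
    have e1 : (toMat g t)ᴴ * ((toMat g t)⁻¹)ᴴ = 1 := by
      rw [← Matrix.conjTranspose_mul, toMat_inv_mul, Matrix.conjTranspose_one]
    rw [← hconst t ht]
    simp only [w]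
    rw [mul_assoc, mul_assoc, mul_assoc, e1, ← mul_assoc, e1, one_mul, mul_one]
  change HasDerivWithinAt _ (odeField hN hn (w 0) _) _ _
  rw [odeField, e, symm_gradMap, toMat_mul_leftVelocity]
  exact (hd t ht).hasDerivWithinAt

theorem contDiffOn_of_isEulerLagrange (hN : 1 ≤ N) {n : ℕ} (hn : 1 ≤ n) {g : ℝ → GLN N}
    (hg : IsEulerLagrange n g) : ContDiffOn ℝ ∞ (toMat g) (Icc 0 1) :=
  contDiffOn_of_autonomous (ode_of_isEulerLagrange hN hn hg)
    fun t _ => contDiffAt_odeField hN hn _ (isUnit_toMat g t)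

/-- Initial position and velocity determine the momentum, so both curves solve the same autonomous
equation. -/
theorem eqOn_of_isEulerLagrange (hN : 1 ≤ N) {n : ℕ} (hn : 1 ≤ n) {β g : ℝ → GLN N}
    (hβ : IsEulerLagrange n β) (hg : IsEulerLagrange n g) (h0 : g 0 = β 0)
    (h1 : velocity g 0 = velocity β 0) : EqOn g β (Icc 0 1) := by
  have e0 : toMat g 0 = toMat β 0 := congrArg Units.val h0
  have e1 : leftVelocity g 0 = leftVelocity β 0 := by rw [leftVelocity, leftVelocity, h0, h1]
  have h2 := ode_of_isEulerLagrange hN hn hg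
  rw [e0, e1] at h2
  have h3 := eqOn_of_autonomous (ode_of_isEulerLagrange hN hn hβ) h2
    (fun t _ => (contDiffAt_odeField hN hn _ (isUnit_toMat β t)).of_le (by simp)) e0
  exact fun t ht => Units.ext (h3 ht)

end

end GLp

namespace GLp

open scoped Matrix Topology NNReal
open MeasureTheory

noncomputable section

variable {N : ℕ}

/-! ### Lipschitz curves on the unit interval -/

theorem ae_mem_Ioo : ∀ᵐ t ∂(volume.restrict (Icc (0 : ℝ) 1)), t ∈ Ioo (0 : ℝ) 1 := by
  rw [← restrict_Ioo_eq_restrict_Icc]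
  exact ae_restrict_mem measurableSet_Ioo

theorem lipschitzOnWith_Icc_union {X : Type*} [PseudoMetricSpace X] {f : ℝ → X} {a b c : ℝ} {K L : ℝ≥0} (hab : a ≤ b) (hbc : b ≤ c)
    (h1 : LipschitzOnWith K f (Icc a b)) (h2 : LipschitzOnWith L f (Icc b c)) :
    LipschitzOnWith (max K L) f (Icc a c) := by
  have hb1 : b ∈ Icc a b := ⟨hab, le_rfl⟩
  have hb2 : b ∈ Icc b c := ⟨le_rfl, hbc⟩
  refine LipschitzOnWith.of_dist_le_mul fun x hx y hy => ?_
  wlog hxy : x ≤ y generalizing x y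
  · rw [dist_comm, dist_comm x]; exact this y hy x hx (le_of_not_ge hxy)
  have hK : (K : ℝ) ≤ (max K L : ℝ≥0) := NNReal.coe_le_coe.2 (le_max_left _ _)
  have hL : (L : ℝ) ≤ (max K L : ℝ≥0) := NNReal.coe_le_coe.2 (le_max_right _ _)
  rcases le_total y b with hyb | hyb
  · exact (h1.dist_le_mul x ⟨hx.1, hxy.trans hyb⟩ y ⟨hy.1, hyb⟩).trans (by gcongr)
  rcases le_total b x with hbx | hbx
  · exact (h2.dist_le_mul x ⟨hbx, hx.2⟩ y ⟨hyb, hy.2⟩).trans (by gcongr)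
  have e1 := h1.dist_le_mul x ⟨hx.1, hbx⟩ b hb1
  have e2 := h2.dist_le_mul b hb2 y ⟨hyb, hy.2⟩
  rw [Real.dist_eq, abs_sub_comm, abs_of_nonneg (by linarith)] at e1 e2
  rw [Real.dist_eq, abs_sub_comm, abs_of_nonneg (by linarith)]
  have e3 := mul_le_mul_of_nonneg_right hK (sub_nonneg.2 hbx)
  have e4 := mul_le_mul_of_nonneg_right hL (sub_nonneg.2 hyb)
  have := dist_triangle (f x) (f b) (f y)
  linarith

section Lipschitz

variable {E : Type*} [NormedAddCommGroup E] [NormedSpace ℝ E]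

theorem derivWithin_eq_deriv_of_eqOn {f F : ℝ → E} (h : EqOn f F (Icc 0 1)) {t : ℝ}
    (ht : t ∈ Ioo (0 : ℝ) 1) : derivWithin f (Icc 0 1) t = deriv F t := by
  rw [derivWithin_congr h (h (Ioo_subset_Icc_self ht)),
    derivWithin_of_mem_nhds (Icc_mem_nhds ht.1 ht.2)]

theorem norm_derivWithin_le_of_mem_Ioo {f : ℝ → E} {K : ℝ≥0} (hf : LipschitzOnWith K f (Icc 0 1)) :
    ∀ t ∈ Ioo (0 : ℝ) 1, ‖derivWithin f (Icc 0 1) t‖ ≤ K := fun t ht => by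
  rw [derivWithin_of_mem_nhds (Icc_mem_nhds ht.1 ht.2)]
  exact norm_deriv_le_of_lipschitzOn (Icc_mem_nhds ht.1 ht.2) hf

variable [FiniteDimensional ℝ E]

/-- F minus the primitive of its derivative is absolutely continuous with derivative zero almost
everywhere, hence constant. -/
theorem integral_deriv_of_lipschitzWith {F : ℝ → E} {K : ℝ≥0} (hF : LipschitzWith K F) (s t : ℝ) :
    IntervalIntegrable (deriv F) volume s t ∧ ∫ r in s..t, deriv F r = F t - F s := by
  have : CompleteSpace E := FiniteDimensional.complete ℝ E
  have hmeas : ∀ μ : Measure ℝ, AEStronglyMeasurable (deriv F) μ := aestronglyMeasurable_deriv F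
  have hbd : ∀ r, ‖deriv F r‖ ≤ K := fun r => norm_deriv_le_of_lipschitz hF
  have hderiv_int : ∀ a b : ℝ, IntervalIntegrable (deriv F) volume a b := fun a b =>
    (intervalIntegrable_const (c := (K : ℝ))).mono_fun (hmeas _)
      (Filter.Eventually.of_forall fun r => (hbd r).trans (le_abs_self _))
  refine ⟨hderiv_int s t, ?_⟩
  have hlip : LipschitzWith K fun x => ∫ r in s..x, deriv F r :=
    LipschitzWith.of_dist_le_mul fun x y => by
      rw [dist_eq_norm, intervalIntegral.integral_interval_sub_left (hderiv_int _ _) (hderiv_int _ _),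
        Real.dist_eq]
      exact intervalIntegral.norm_integral_le_of_norm_le_const fun r _ => hbd r
  have hac : AbsolutelyContinuousOnInterval (fun x => F x - ∫ r in s..x, deriv F r) s t :=
    (hF.sub hlip).lipschitzOnWith.absolutelyContinuousOnInterval
  obtain ⟨C, hC⟩ := hac.const_of_ae_hasDerivAt_zero (by
    filter_upwards [hF.ae_differentiableAt_real, (hderiv_int s t).ae_hasDerivAt_integral] with x h1 h2 hx
    exact (h1.hasDerivAt.sub (h2 hx s left_mem_uIcc)).congr_deriv (sub_self _))
  have h1 := hC s left_mem_uIcc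
  have h2 := hC t right_mem_uIcc
  simp only [intervalIntegral.integral_same, sub_zero] at h1
  rw [eq_sub_iff_add_eq, h1, ← h2]
  abel

theorem aestronglyMeasurable_derivWithin {f : ℝ → E} {K : ℝ≥0}
    (hf : LipschitzOnWith K f (Icc 0 1)) :
    AEStronglyMeasurable (derivWithin f (Icc 0 1)) (volume.restrict (Icc 0 1)) := by
  have : CompleteSpace E := FiniteDimensional.complete ℝ E
  obtain ⟨F, hF, hEq⟩ := hf.extend_finite_dimension
  refine (aestronglyMeasurable_deriv F _).congr ?_
  filter_upwards [ae_mem_Ioo] with t ht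
  exact (derivWithin_eq_deriv_of_eqOn hEq ht).symm

theorem ae_hasDerivAt_of_lipschitzOnWith {f : ℝ → E} {K : ℝ≥0}
    (hf : LipschitzOnWith K f (Icc 0 1)) :
    ∀ᵐ t ∂(volume.restrict (Icc (0 : ℝ) 1)), HasDerivAt f (derivWithin f (Icc 0 1) t) t := by
  obtain ⟨F, hF, hEq⟩ := hf.extend_finite_dimension
  filter_upwards [ae_mem_Ioo, ae_restrict_of_ae hF.ae_differentiableAt_real] with t ht h
  have hnhds := Icc_mem_nhds ht.1 ht.2
  rw [derivWithin_eq_deriv_of_eqOn hEq ht]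
  exact h.hasDerivAt.congr_of_eventuallyEq (Filter.eventuallyEq_of_mem hnhds hEq)

theorem integral_derivWithin_of_lipschitzOnWith {f : ℝ → E} {K : ℝ≥0}
    (hf : LipschitzOnWith K f (Icc 0 1)) {s t : ℝ} (hs : s ∈ Icc (0 : ℝ) 1)
    (ht : t ∈ Icc (0 : ℝ) 1) : ∫ r in s..t, derivWithin f (Icc 0 1) r = f t - f s := by
  obtain ⟨F, hF, hEq⟩ := hf.extend_finite_dimension
  rw [hEq hs, hEq ht, ← (integral_deriv_of_lipschitzWith hF s t).2]
  refine intervalIntegral.integral_congr_ae ?_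
  have h := (ae_restrict_iff' measurableSet_Icc).1 ae_mem_Ioo
  filter_upwards [h] with r hr hrst
  exact derivWithin_eq_deriv_of_eqOn hEq (hr ((uIcc_subset_Icc hs ht) (uIoc_subset_uIcc hrst)))

end Lipschitz

/-! ### Lipschitz curves in GL(N) and bounded measurable functions -/

/-- Curves in `GL(N)` which are Lipschitz on `[0,1]` as curves of matrices. -/
def IsLip (α : ℝ → GLN N) : Prop := ∃ K : ℝ≥0, LipschitzOnWith K (toMat α) (Icc 0 1)

theorem IsPiecewiseC1.isLip {α : ℝ → GLN N} (h : IsPiecewiseC1 α) : IsLip α := by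
  obtain ⟨k, t, h0, h1, ht⟩ := h
  have key : ∀ i ≤ k, 0 ≤ t i ∧ ∃ K : ℝ≥0, LipschitzOnWith K (toMat α) (Icc 0 (t i)) := by
    intro i
    induction i with
    | zero => exact fun _ => ⟨h0.ge, 0, by
        rw [h0, Icc_self]; exact LipschitzOnWith.of_dist_le_mul (by simp)⟩
    | succ i ih =>
      intro hi
      obtain ⟨hpos, K, hK⟩ := ih (by omega)
      obtain ⟨hlt, hC⟩ := ht i (by omega)
      obtain ⟨L, hL⟩ := hC.exists_lipschitzOnWith (by simp) (convex_Icc _ _) isCompact_Icc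
      exact ⟨hpos.trans hlt.le, _, lipschitzOnWith_Icc_union hpos hlt.le hK hL⟩
  have := (key k le_rfl).2
  rwa [h1] at this

theorem IsLip.continuousOn {α : ℝ → GLN N} (h : IsLip α) : ContinuousOn (toMat α) (Icc 0 1) :=
  h.choose_spec.continuousOn

theorem continuousOn_toMat_inv {α : ℝ → GLN N} {s : Set ℝ} (h : ContinuousOn (toMat α) s) :
    ContinuousOn (fun t => (toMat α t)⁻¹) s := fun t ht =>
  (contDiffAt_inv (isUnit_toMat α t)).continuousAt.comp_continuousWithinAt (h t ht)

theorem continuousOn_of_toMat {α : ℝ → GLN N} {s : Set ℝ} (h : ContinuousOn (toMat α) s) :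
    ContinuousOn α s := by
  rw [continuousOn_iff_continuous_domRestrict] at *
  refine Units.continuous_iff.2 ⟨h, ?_⟩
  have := continuousOn_iff_continuous_domRestrict.1
    (continuousOn_toMat_inv (continuousOn_iff_continuous_domRestrict.2 h))
  refine this.congr fun x => (coe_inv_eq α x).symm

theorem continuousOn_toMat {α : ℝ → GLN N} {s : Set ℝ} (h : ContinuousOn α s) :
    ContinuousOn (toMat α) s := Units.continuous_val.comp_continuousOn h

theorem IsLip.exists_bound {α : ℝ → GLN N} (h : IsLip α) :
    ∃ B : ℝ, ∀ t ∈ Ioo (0 : ℝ) 1, ‖leftVelocity α t‖ ≤ B := by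
  obtain ⟨K, hK⟩ := h
  obtain ⟨A, hA⟩ := isCompact_Icc.exists_bound_of_continuousOn
    (continuousOn_toMat_inv hK.continuousOn)
  refine ⟨A * K, fun t ht => ?_⟩
  rw [leftVelocity_eq]
  exact (norm_mul_le _ _).trans (mul_le_mul (hA t (Ioo_subset_Icc_self ht))
    (norm_derivWithin_le_of_mem_Ioo hK t ht) (norm_nonneg _)
    ((norm_nonneg _).trans (hA t (Ioo_subset_Icc_self ht))))

theorem IsLip.aestronglyMeasurable {α : ℝ → GLN N} (h : IsLip α) :
    AEStronglyMeasurable (leftVelocity α) (volume.restrict (Icc 0 1)) := by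
  have e : leftVelocity α = fun t => (toMat α t)⁻¹ * velocity α t := funext (leftVelocity_eq α)
  rw [e]
  exact ((continuousOn_toMat_inv h.continuousOn).aestronglyMeasurable measurableSet_Icc).mul
    (aestronglyMeasurable_derivWithin h.choose_spec)

/-- A bounded, almost everywhere strongly measurable function on the unit interval. -/
def BddMeas {E : Type*} [NormedAddCommGroup E] (f : ℝ → E) : Prop :=
  AEStronglyMeasurable f (volume.restrict (Icc (0 : ℝ) 1)) ∧
    ∃ B : ℝ, ∀ᵐ t ∂(volume.restrict (Icc (0 : ℝ) 1)), ‖f t‖ ≤ B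

section BddMeas

variable {E : Type*} [NormedAddCommGroup E]

theorem BddMeas.integrableOn {f : ℝ → E} (h : BddMeas f) : IntegrableOn f (Icc 0 1) := by
  obtain ⟨hm, B, hB⟩ := h
  exact (integrable_const B).mono' hm hB

theorem BddMeas.intervalIntegrable {f : ℝ → E} (h : BddMeas f) {s t : ℝ}
    (hs : s ∈ Icc (0 : ℝ) 1) (ht : t ∈ Icc (0 : ℝ) 1) : IntervalIntegrable f volume s t :=
  (h.integrableOn.mono_set (uIcc_subset_Icc hs ht)).intervalIntegrable

theorem BddMeas.of_continuousOn {f : ℝ → E} [SecondCountableTopologyEither ℝ E]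
    (h : ContinuousOn f (Icc 0 1)) : BddMeas f := by
  obtain ⟨B, hB⟩ := isCompact_Icc.exists_bound_of_continuousOn h
  exact ⟨h.aestronglyMeasurable measurableSet_Icc, B,
    (ae_restrict_mem measurableSet_Icc).mono fun t ht => hB t ht⟩

theorem BddMeas.comp {F : Type*} [NormedAddCommGroup F] [ProperSpace E] {f : ℝ → E} (h : BddMeas f)
    {φ : E → F} (hφ : Continuous φ) : BddMeas fun t => φ (f t) := by
  obtain ⟨hm, B, hB⟩ := h
  obtain ⟨A, hA⟩ := (isCompact_closedBall (0 : E) B).exists_bound_of_continuousOn hφ.continuousOn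
  exact ⟨hφ.comp_aestronglyMeasurable hm, A, hB.mono fun t ht => hA _ (by simpa using ht)⟩

theorem BddMeas.add {f g : ℝ → E} (hf : BddMeas f) (hg : BddMeas g) :
    BddMeas fun t => f t + g t := by
  obtain ⟨hm, B, hB⟩ := hf
  obtain ⟨hm', B', hB'⟩ := hg
  refine ⟨hm.add hm', B + B', ?_⟩
  filter_upwards [hB, hB'] with t h1 h2
  exact (norm_add_le _ _).trans (add_le_add h1 h2)

theorem BddMeas.mul {f g : ℝ → Mat N} (hf : BddMeas f) (hg : BddMeas g) :
    BddMeas fun t => f t * g t := by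
  obtain ⟨hm, B, hB⟩ := hf
  obtain ⟨hm', B', hB'⟩ := hg
  refine ⟨hm.mul hm', B * B', ?_⟩
  filter_upwards [hB, hB'] with t h1 h2
  exact (norm_mul_le _ _).trans (mul_le_mul h1 h2 (norm_nonneg _) ((norm_nonneg _).trans h1))

end BddMeas

theorem IsLip.bddMeas {α : ℝ → GLN N} (h : IsLip α) : BddMeas (leftVelocity α) := by
  obtain ⟨B, hB⟩ := h.exists_bound
  exact ⟨h.aestronglyMeasurable, B, ae_mem_Ioo.mono hB⟩

theorem IsLip.integral_eq {α : ℝ → GLN N} (h : IsLip α) {s t : ℝ} (hs : s ∈ Icc (0 : ℝ) 1)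
    (ht : t ∈ Icc (0 : ℝ) 1) :
    ∫ r in s..t, toMat α r * leftVelocity α r = toMat α t - toMat α s := by
  simp only [toMat_mul_leftVelocity]
  exact integral_derivWithin_of_lipschitzOnWith h.choose_spec hs ht

/-- Jensen's inequality for the `p`-norm. -/
theorem pNorm_integral_le (hN : 1 ≤ N) {n : ℕ} (hn : 1 ≤ n) {f : ℝ → Mat N} (hf : BddMeas f)
    {s t : ℝ} (hs : s ∈ Icc (0 : ℝ) 1) (ht : t ∈ Icc (0 : ℝ) 1) (hst : s ≤ t) :
    pNorm n (∫ r in s..t, f r) ≤ ∫ r in s..t, pNorm n (f r) := by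
  rcases hst.eq_or_lt with rfl | hlt
  · simp [pNorm_zero hn]
  have hsub : Ioc s t ⊆ Icc 0 1 := fun x hx => ⟨hs.1.trans hx.1.le, hx.2.trans ht.2⟩
  have hpos : 0 < t - s := sub_pos.2 hlt
  have h := (convexOn_pNorm (N := N) hN hn).map_set_average_le (μ := volume) (t := Ioc s t) (f := f)
    (continuous_pNorm n).continuousOn isClosed_univ (by simp [hlt]) (by simp) (by simp)
    (hf.integrableOn.mono_set hsub)
    ((hf.comp (continuous_pNorm n)).integrableOn.mono_set hsub)
  rw [setAverage_eq, setAverage_eq] at h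
  simp only [Real.volume_real_Ioc_of_le hst] at h
  rw [pNorm_smul hn, abs_of_pos (by positivity), smul_eq_mul,
    mul_le_mul_iff_right₀ (by positivity)] at h
  rwa [intervalIntegral.integral_of_le hst, intervalIntegral.integral_of_le hst]

end

end GLp

namespace GLp

open scoped Matrix Topology NNReal
open MeasureTheory

noncomputable section

variable {N : ℕ}

/-! ### Lengths of paths: reversal and concatenation -/

theorem bddMeas_pNorm {α : ℝ → GLN N} (n : ℕ) (h : IsLip α) :
    BddMeas fun t => pNorm n (leftVelocity α t) := h.bddMeas.comp (continuous_pNorm n)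

theorem smoothLength_nonneg (n : ℕ) (α : ℝ → GLN N) : 0 ≤ smoothLength n α :=
  intervalIntegral.integral_nonneg zero_le_one fun _ _ => pNorm_nonneg n _

theorem smoothLength_const {n : ℕ} (hn : 1 ≤ n) (h : GLN N) :
    smoothLength n (fun _ => h) = 0 := by
  have : ∀ t, leftVelocity (fun _ : ℝ => h) t = 0 := fun t => by
    have e : toMat (fun _ : ℝ => h) = fun _ => (h : Mat N) := rfl
    rw [leftVelocity, velocity, e, derivWithin_fun_const, Pi.zero_apply, mul_zero]
  simp [smoothLength, this, pNorm_zero hn]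

theorem isPiecewiseC1_of_contDiffOn {α : ℝ → GLN N} (h : ContDiffOn ℝ 1 (toMat α) (Icc 0 1)) :
    IsPiecewiseC1 α :=
  ⟨1, fun i => i, by simp, by simp, fun i hi => by
    obtain rfl : i = 0 := by omega
    simpa using h⟩

theorem pDist_self {n : ℕ} (hn : 1 ≤ n) (h : GLN N) : pDist n h h = 0 := by
  refine le_antisymm (iInf₂_le_of_le (fun _ => h)
    ⟨isPiecewiseC1_of_contDiffOn contDiffOn_const, rfl, rfl⟩ ?_) zero_le
  rw [smoothLength_const hn, ENNReal.ofReal_zero]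

theorem velocity_eq_deriv (α : ℝ → GLN N) {t : ℝ} (ht : t ∈ Ioo (0 : ℝ) 1) :
    velocity α t = deriv (toMat α) t := derivWithin_of_mem_nhds (Icc_mem_nhds ht.1 ht.2)

theorem IsPiecewiseC1.reverse {α : ℝ → GLN N} (h : IsPiecewiseC1 α) :
    IsPiecewiseC1 fun t => α (1 - t) := by
  obtain ⟨k, t, h0, h1, ht⟩ := h
  refine ⟨k, fun i => 1 - t (k - i), by simp [h1], by simp [h0], fun i hi => ?_⟩
  obtain ⟨h2, h3⟩ := ht (k - (i + 1)) (by omega)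
  rw [show k - (i + 1) + 1 = k - i by omega] at h2 h3
  refine ⟨by simpa using h2, ?_⟩
  exact ContDiffOn.comp (g := toMat α) h3 (contDiff_const.sub contDiff_id).contDiffOn
    fun r hr => ⟨by linarith [hr.2], by linarith [hr.1]⟩

theorem smoothLength_reverse {n : ℕ} (hn : 1 ≤ n) (α : ℝ → GLN N) :
    smoothLength n (fun t => α (1 - t)) = smoothLength n α := by
  have h := intervalIntegral.integral_comp_sub_left
    (fun t => pNorm n (leftVelocity α t)) (a := 0) (b := 1) 1
  rw [sub_self, sub_zero] at h
  rw [smoothLength, smoothLength, ← h]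
  refine intervalIntegral.integral_congr_ae ?_
  filter_upwards [(ae_restrict_iff' measurableSet_Icc).1 ae_mem_Ioo] with t ht' ht
  rw [uIoc_of_le zero_le_one] at ht
  have ht1 := ht' ⟨ht.1.le, ht.2⟩
  have e : velocity (fun t => α (1 - t)) t = (-1 : ℝ) • velocity α (1 - t) := by
    rw [velocity_eq_deriv _ ht1, velocity_eq_deriv _ ⟨by linarith [ht1.2], by linarith [ht1.1]⟩,
      neg_one_smul]
    exact deriv_comp_const_sub (toMat α) 1 t
  rw [leftVelocity, e, mul_smul_comm, pNorm_smul hn]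
  simp [leftVelocity]

theorem pDist_comm {n : ℕ} (hn : 1 ≤ n) (h k : GLN N) : pDist n h k = pDist n k h := by
  have key : ∀ h k : GLN N, pDist n h k ≤ pDist n k h := fun h k =>
    le_iInf₂ fun α hα => iInf₂_le_of_le (fun t => α (1 - t))
      ⟨hα.1.reverse, by simpa using hα.2.2, by simpa using hα.2.1⟩
      (by rw [smoothLength_reverse hn])
  exact le_antisymm (key h k) (key k h)

/-- The concatenation of two paths. -/
def concat (α β : ℝ → GLN N) (t : ℝ) : GLN N := if t ≤ 1 / 2 then α (2 * t) else β (2 * t - 1)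

theorem IsPiecewiseC1.concat {α β : ℝ → GLN N} (hα : IsPiecewiseC1 α) (hβ : IsPiecewiseC1 β)
    (hαβ : α 1 = β 0) : IsPiecewiseC1 (concat α β) := by
  obtain ⟨k, t, h0, h1, ht⟩ := hα
  obtain ⟨l, s, g0, g1, hs⟩ := hβ
  have htl : ∀ j ≤ k, t j ≤ 1 := fun j hj => by
    induction hj using Nat.decreasingInduction with
    | self => exact h1.le
    | of_succ j hj ih => exact (ht j hj).1.le.trans ih
  have hsl : ∀ j ≤ l, 0 ≤ s j := fun j hj => by
    induction j with
    | zero => exact g0.ge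
    | succ j ih => exact (ih (by omega)).trans (hs j (by omega)).1.le
  refine ⟨k + l, fun i => if i ≤ k then t i / 2 else (1 + s (i - k)) / 2, by simp [h0], ?_,
    fun i hi => ?_⟩
  · rcases Nat.eq_zero_or_pos l with rfl | hl
    · rw [g0] at g1; norm_num at g1
    · simp [show ¬ (k + l ≤ k) by omega, g1]
  rcases Nat.lt_or_ge i k with hik | hik
  · obtain ⟨h2, h3⟩ := ht i hik
    simp only [show i ≤ k by omega, show i + 1 ≤ k by omega, if_true]
    refine ⟨by linarith, ContDiffOn.congr (f := fun r => toMat α (2 * r)) ?_ fun r hr => ?_⟩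
    · exact ContDiffOn.comp (g := toMat α) h3 (contDiff_const.mul contDiff_id).contDiffOn
        fun r hr => ⟨by linarith [hr.1], by linarith [hr.2]⟩
    · have : r ≤ 1 / 2 := by linarith [hr.2, htl (i + 1) hik]
      rw [toMat, GLp.concat, if_pos this]; rfl
  · obtain ⟨h2, h3⟩ := hs (i - k) (by omega)
    -- At the junction i = k both formulas give 1/2.
    have e1 : (if i ≤ k then t i / 2 else (1 + s (i - k)) / 2) = (1 + s (i - k)) / 2 := by
      rcases hik.eq_or_lt with rfl | hlt
      · simp [h1, g0]
      · simp [hlt]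
    simp only [e1, show ¬ (i + 1 ≤ k) by omega, if_false, show i + 1 - k = i - k + 1 by omega]
    refine ⟨by linarith, ContDiffOn.congr (f := fun r => toMat β (2 * r - 1)) ?_ fun r hr => ?_⟩
    · exact ContDiffOn.comp (g := toMat β) h3
        ((contDiff_const.mul contDiff_id).sub contDiff_const).contDiffOn
        fun r hr => ⟨by linarith [hr.1], by linarith [hr.2]⟩
    · have hr2 : 1 / 2 ≤ r := by linarith [hr.1, hsl (i - k) (by omega)]
      rcases hr2.eq_or_lt with rfl | hlt
      · simp only [toMat, GLp.concat, le_refl, if_true]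
        norm_num [hαβ]
      · rw [toMat, GLp.concat, if_neg (by linarith)]; rfl

/-- On each open half the velocity is doubled and the time halved; the integral ignores the
junction. The Lipschitz hypothesis supplies the integrability needed to split. -/
theorem smoothLength_concat {n : ℕ} (hn : 1 ≤ n) {α β : ℝ → GLN N} (h : IsLip (concat α β)) :
    smoothLength n (concat α β) = smoothLength n α + smoothLength n β := by
  have hb := bddMeas_pNorm n h
  have hmid : (1 / 2 : ℝ) ∈ Icc (0 : ℝ) 1 := by constructor <;> norm_num
  rw [smoothLength, ← intervalIntegral.integral_add_adjacent_intervals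
    (hb.intervalIntegrable (left_mem_Icc.2 zero_le_one) hmid)
    (hb.intervalIntegrable hmid (right_mem_Icc.2 zero_le_one))]
  congr 1
  · have e := intervalIntegral.mul_integral_comp_mul_left (a := 0) (b := 1 / 2)
      (f := fun t => pNorm n (leftVelocity α t)) (2 : ℝ)
    norm_num at e
    rw [smoothLength, ← e, ← intervalIntegral.integral_const_mul]
    refine intervalIntegral.integral_congr_Ioo_of_le (by norm_num) fun t ht => ?_
    have ht1 : t ∈ Ioo (0 : ℝ) 1 := ⟨ht.1, by linarith [ht.2]⟩
    have e1 : velocity (concat α β) t = (2 : ℝ) • velocity α (2 * t) := by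
      rw [velocity_eq_deriv _ ht1, velocity_eq_deriv _ ⟨by linarith [ht.1], by linarith [ht.2]⟩,
        ← deriv_comp_mul_left]
      refine Filter.EventuallyEq.deriv_eq ?_
      filter_upwards [Iio_mem_nhds ht.2] with r hr
      rw [toMat, concat, if_pos (le_of_lt hr)]; rfl
    rw [leftVelocity, e1, mul_smul_comm, pNorm_smul hn, concat, if_pos ht.2.le]
    simp [leftVelocity]
  · have e := intervalIntegral.mul_integral_comp_mul_sub (a := 1 / 2) (b := 1)
      (f := fun t => pNorm n (leftVelocity β t)) (2 : ℝ) 1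
    norm_num at e
    rw [smoothLength, ← e, ← intervalIntegral.integral_const_mul]
    refine intervalIntegral.integral_congr_Ioo_of_le (by norm_num) fun t ht => ?_
    have ht1 : t ∈ Ioo (0 : ℝ) 1 := ⟨by linarith [ht.1], ht.2⟩
    have e1 : velocity (concat α β) t = (2 : ℝ) • velocity β (2 * t - 1) := by
      rw [velocity_eq_deriv _ ht1, velocity_eq_deriv _ ⟨by linarith [ht.1], by linarith [ht.2]⟩]
      have := deriv_comp_mul_left (2 : ℝ) (fun r => toMat β (r - 1)) t
      rw [deriv_comp_sub_const] at this
      rw [← this]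
      refine Filter.EventuallyEq.deriv_eq ?_
      filter_upwards [Ioi_mem_nhds ht.1] with r hr
      rw [toMat, concat, if_neg (not_le.2 hr)]; rfl
    rw [leftVelocity, e1, mul_smul_comm, pNorm_smul hn, concat, if_neg (not_le.2 ht.1)]
    simp [leftVelocity]

theorem pDist_triangle {n : ℕ} (hn : 1 ≤ n) (h k l : GLN N) :
    pDist n h l ≤ pDist n h k + pDist n k l := by
  nth_rewrite 2 [pDist]
  rw [ENNReal.iInf_add]
  refine le_iInf fun α => ?_
  rw [ENNReal.iInf_add]
  refine le_iInf fun hα => ?_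
  rw [pDist, pDist, ENNReal.add_iInf]
  refine le_iInf fun β => ?_
  rw [ENNReal.add_iInf]
  refine le_iInf fun hβ => ?_
  have hC := hα.1.concat hβ.1 (hα.2.2.trans hβ.2.1.symm)
  refine iInf₂_le_of_le (concat α β) ⟨hC, ?_, ?_⟩ ?_
  · simp [concat, hα.2.1]
  · norm_num [concat, hβ.2.2]
  · rw [smoothLength_concat hn hC.isLip, ENNReal.ofReal_add (smoothLength_nonneg n α)
      (smoothLength_nonneg n β)]

end

end GLp

namespace GLp

open scoped Matrix Topology NNReal
open MeasureTheory

noncomputable section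

variable {N : ℕ}

/-! ### Local comparison of the distance with the norm -/

theorem norm_one_mat (hN : 1 ≤ N) : ‖(1 : Mat N)‖ = 1 := by
  have : Nonempty (Fin N) := ⟨⟨0, hN⟩⟩
  exact CStarRing.norm_one

/-- A left factor close to 1 changes the p-norm by a factor close to 1: write ax = x + (a - 1)x and
pass twice through the equivalence of norms. -/
theorem exists_pNorm_mul_le (hN : 1 ≤ N) {n : ℕ} (hn : 1 ≤ n) :
    ∃ C : ℝ, 1 ≤ C ∧ (∀ x : Mat N, pNorm n x ≤ C * ‖x‖) ∧ (∀ x : Mat N, ‖x‖ ≤ C * pNorm n x) ∧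
      ∀ a x : Mat N, pNorm n (a * x) ≤ (1 + C * ‖a - 1‖) * pNorm n x := by
  obtain ⟨C, hC, h1, h2⟩ := exists_pNorm_equiv (N := N) hN hn
  have hCC : C ≤ C ^ 2 := by nlinarith
  refine ⟨C ^ 2, by nlinarith, fun x => (h1 x).trans (by gcongr), fun x => (h2 x).trans
    (mul_le_mul_of_nonneg_right hCC (pNorm_nonneg n x)), fun a x => ?_⟩
  have e : a * x = x + (a - 1) * x := by rw [sub_mul, one_mul]; abel
  calc pNorm n (a * x) ≤ pNorm n x + pNorm n ((a - 1) * x) := by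
        rw [e]; exact pNorm_add_le hN hn _ _
    _ ≤ pNorm n x + C * (‖a - 1‖ * (C * pNorm n x)) := by
        gcongr
        refine (h1 _).trans ?_
        gcongr
        exact (norm_mul_le _ _).trans (by gcongr; exact h2 x)
    _ = (1 + C ^ 2 * ‖a - 1‖) * pNorm n x := by ring

theorem integral_inv_mul {α : ℝ → GLN N} (h : IsLip α) (a : Mat N) {s t : ℝ}
    (hs : s ∈ Icc (0 : ℝ) 1) (ht : t ∈ Icc (0 : ℝ) 1) :
    ∫ r in s..t, a * toMat α r * leftVelocity α r = a * toMat α t - a * toMat α s := by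
  have hI : IntervalIntegrable (fun r => toMat α r * leftVelocity α r) volume s t :=
    ((BddMeas.of_continuousOn h.continuousOn).mul h.bddMeas).intervalIntegrable hs ht
  have := (ContinuousLinearMap.mul ℝ (Mat N) a).intervalIntegral_comp_comm hI
  simp only [ContinuousLinearMap.mul_apply', h.integral_eq hs ht, mul_sub] at this
  simpa only [mul_assoc] using this

theorem bddMeas_mul_leftVelocity {α : ℝ → GLN N} (h : IsLip α) (a : Mat N) :
    BddMeas fun r => a * toMat α r * leftVelocity α r :=
  (BddMeas.of_continuousOn (continuousOn_const.mul h.continuousOn)).mul h.bddMeas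

/-- The displacement along a short path is at most its length, up to a quadratic error. -/
theorem exists_pNorm_displacement_le (hN : 1 ≤ N) {n : ℕ} (hn : 1 ≤ n) :
    ∃ C : ℝ, 1 ≤ C ∧ ∀ α : ℝ → GLN N, IsLip α → C * smoothLength n α ≤ 1 →
      pNorm n ((toMat α 0)⁻¹ * toMat α 1 - 1) ≤
        (1 + C * smoothLength n α) * smoothLength n α := by
  obtain ⟨C, hC, -, h2, h3⟩ := exists_pNorm_mul_le (N := N) hN hn
  refine ⟨2 * C ^ 2, by nlinarith, fun α hα hlen => ?_⟩
  set l := smoothLength n α with hl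
  have hl0 : 0 ≤ l := smoothLength_nonneg n α
  have hCl : 2 * (C * l) ≤ 1 := by nlinarith [mul_nonneg hl0 (zero_le_one.trans hC)]
  have m0 : (0 : ℝ) ∈ Icc (0 : ℝ) 1 := left_mem_Icc.2 zero_le_one
  have m1 : (1 : ℝ) ∈ Icc (0 : ℝ) 1 := right_mem_Icc.2 zero_le_one
  set a : ℝ → Mat N := fun t => (toMat α 0)⁻¹ * toMat α t with ha
  have ha0 : a 0 = 1 := toMat_inv_mul α 0
  have hac : ContinuousOn a (Icc 0 1) := continuousOn_const.mul hα.continuousOn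
  obtain ⟨t₀, ht₀, hmax⟩ := isCompact_Icc.exists_isMaxOn ⟨0, m0⟩ hac.norm
  set M := ‖a t₀‖
  have hM0 : 0 ≤ M := norm_nonneg _
  have hb := bddMeas_pNorm n hα
  have hdisp : ∀ t ∈ Icc (0 : ℝ) 1, ‖a t - 1‖ ≤ M * (C * l) := fun t ht => by
    have e := integral_inv_mul hα (toMat α 0)⁻¹ m0 ht
    rw [show (toMat α 0)⁻¹ * toMat α 0 = 1 from ha0] at e
    change ‖(toMat α 0)⁻¹ * toMat α t - 1‖ ≤ _
    rw [← e]
    have hI := (hb.intervalIntegrable m0 m1).const_mul (M * C)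
    have hle : ‖∫ r in (0 : ℝ)..t, (toMat α 0)⁻¹ * toMat α r * leftVelocity α r‖ ≤
        ∫ r in (0 : ℝ)..t, M * C * pNorm n (leftVelocity α r) := by
      refine intervalIntegral.norm_integral_le_of_norm_le ht.1
        (Filter.Eventually.of_forall fun r hr => ?_)
        ((hb.intervalIntegrable m0 ht).const_mul (M * C))
      calc _ ≤ ‖a r‖ * ‖leftVelocity α r‖ := norm_mul_le _ _
        _ ≤ M * (C * pNorm n (leftVelocity α r)) := by
          gcongr
          · exact hmax ⟨hr.1.le, hr.2.trans ht.2⟩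
          · exact h2 _
        _ = _ := by ring
    refine hle.trans ((intervalIntegral.integral_mono_interval le_rfl ht.1 ht.2
      (Filter.Eventually.of_forall fun r => ?_) hI).trans ?_)
    · have := pNorm_nonneg n (leftVelocity α r)
      simp only [Pi.zero_apply]; positivity
    · rw [intervalIntegral.integral_const_mul, ← smoothLength, ← hl]
      exact le_of_eq (by ring)
  -- The maximum bounds itself: M ≤ 1 + M·Cl with Cl ≤ 1/2.
  have hM : M ≤ 2 := by
    have h4 := hdisp t₀ ht₀
    have h5 : M ≤ 1 + ‖a t₀ - 1‖ := by
      have := norm_add_le (1 : Mat N) (a t₀ - 1)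
      rwa [add_sub_cancel, norm_one_mat hN] at this
    nlinarith
  have hd2 : ∀ t ∈ Icc (0 : ℝ) 1, ‖a t - 1‖ ≤ 2 * (C * l) := fun t ht =>
    (hdisp t ht).trans (mul_le_mul_of_nonneg_right hM (by positivity))
  have e := integral_inv_mul hα (toMat α 0)⁻¹ m0 m1
  rw [show (toMat α 0)⁻¹ * toMat α 0 = 1 from ha0] at e
  rw [← e]
  have hbm := bddMeas_mul_leftVelocity hα (toMat α 0)⁻¹
  refine (pNorm_integral_le hN hn hbm m0 m1 zero_le_one).trans ?_
  rw [hl, smoothLength, ← intervalIntegral.integral_const_mul]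
  refine intervalIntegral.integral_mono_on zero_le_one
    ((hbm.comp (continuous_pNorm n)).intervalIntegrable m0 m1)
    ((hb.intervalIntegrable m0 m1).const_mul _) fun r hr => ?_
  refine (h3 (a r) _).trans (mul_le_mul_of_nonneg_right ?_ (pNorm_nonneg n _))
  rw [add_le_add_iff_left]
  calc C * ‖a r - 1‖ ≤ C * (2 * (C * l)) := by gcongr; exact hd2 r hr
    _ = 2 * C ^ 2 * l := by ring

theorem exists_pNorm_le_of_pDist_lt (hN : 1 ≤ N) {n : ℕ} (hn : 1 ≤ n) :
    ∃ C : ℝ, 1 ≤ C ∧ ∀ (h k : GLN N) (ε : ℝ), C * ε ≤ 1 → pDist n h k < ENNReal.ofReal ε →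
      pNorm n ((h : Mat N)⁻¹ * (k : Mat N) - 1) ≤ (1 + C * ε) * ε := by
  obtain ⟨C, hC, H⟩ := exists_pNorm_displacement_le (N := N) hN hn
  refine ⟨C, hC, fun h k ε hε hd => ?_⟩
  simp only [pDist, iInf_lt_iff] at hd
  obtain ⟨α, ⟨hα, rfl, rfl⟩, hlt⟩ := hd
  have hle : smoothLength n α ≤ ε := by
    by_contra hc
    exact absurd hlt (not_lt.2 (ENNReal.ofReal_le_ofReal (not_le.1 hc).le))
  have h0 := smoothLength_nonneg n α
  refine (H α hα.isLip ((by gcongr : C * smoothLength n α ≤ C * ε).trans hε)).trans ?_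
  have : 0 ≤ ε := h0.trans hle
  gcongr

theorem eq_of_pDist_eq_zero (hN : 1 ≤ N) {n : ℕ} (hn : 1 ≤ n) {h k : GLN N}
    (hd : pDist n h k = 0) : h = k := by
  obtain ⟨C, hC, H⟩ := exists_pNorm_le_of_pDist_lt (N := N) hN hn
  have h1 : ∀ ε : ℝ, 0 < ε → C * ε ≤ 1 →
      pNorm n ((h : Mat N)⁻¹ * (k : Mat N) - 1) ≤ 2 * ε := fun ε h0 hε =>
    (H h k ε hε (by rw [hd]; exact ENNReal.ofReal_pos.2 h0)).trans (by nlinarith)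
  have h2 : pNorm n ((h : Mat N)⁻¹ * (k : Mat N) - 1) = 0 := by
    by_contra hne
    have hpos := (pNorm_nonneg n ((h : Mat N)⁻¹ * (k : Mat N) - 1)).lt_of_ne' hne
    -- This choice of ε bounds the positive quantity by half of itself.
    have h3 := h1 (min C⁻¹ (pNorm n ((h : Mat N)⁻¹ * (k : Mat N) - 1) / 4))
      (lt_min (by positivity) (by positivity))
      ((mul_le_mul_of_nonneg_left (min_le_left _ _) (by linarith)).trans
        (mul_inv_cancel₀ (by positivity)).le)
    linarith [min_le_right C⁻¹ (pNorm n ((h : Mat N)⁻¹ * (k : Mat N) - 1) / 4)]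
  have h3 := sub_eq_zero.1 (eq_zero_of_pNorm hN hn h2)
  rw [← Matrix.coe_units_inv] at h3
  have h4 : h⁻¹ * k = 1 := Units.ext h3
  exact (inv_mul_eq_one.1 h4)

/-! ### Segments between nearby points -/

/-- The curve in `GL(N)` underlying a curve of matrices; singular values are replaced by `1`. -/
def ofMat (f : ℝ → Mat N) (t : ℝ) : GLN N := by
  classical exact if h : IsUnit (f t) then h.unit else 1

theorem toMat_ofMat {f : ℝ → Mat N} {t : ℝ} (h : IsUnit (f t)) : toMat (ofMat f) t = f t := by
  simp [toMat, ofMat, h]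

theorem isUnit_one_add {x : Mat N} (h : ‖x‖ < 1) : IsUnit (1 + x) := by
  have := isUnit_one_sub_of_norm_lt_one (x := -x) (by rwa [norm_neg])
  rwa [sub_neg_eq_add] at this

theorem norm_inv_one_add_sub_one_le (hN : 1 ≤ N) {x : Mat N} (h : ‖x‖ ≤ 1 / 2) :
    ‖(1 + x)⁻¹ - 1‖ ≤ 2 * ‖x‖ := by
  have hu := (Matrix.isUnit_iff_isUnit_det _).1 (isUnit_one_add (h.trans_lt (by norm_num)))
  set y := (1 + x)⁻¹
  have e : y - 1 = -(x * y) := by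
    have : (1 + x) * y = 1 := Matrix.mul_nonsing_inv _ hu
    rw [add_mul, one_mul] at this
    rw [← this]; abel
  have h1 : ‖y - 1‖ ≤ ‖x‖ * ‖y‖ := by rw [e, norm_neg]; exact norm_mul_le _ _
  have h2 : ‖y‖ ≤ 1 + ‖y - 1‖ := by
    have := norm_add_le (1 : Mat N) (y - 1)
    rwa [add_sub_cancel, norm_one_mat hN] at this
  have h3 : ‖y‖ ≤ 2 := by nlinarith [norm_nonneg y]
  nlinarith [norm_nonneg x]

/-- Close points are joined by segments. -/
theorem exists_pDist_le (hN : 1 ≤ N) {n : ℕ} (hn : 1 ≤ n) :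
    ∃ C : ℝ, 1 ≤ C ∧ ∀ h k : GLN N, ‖(h : Mat N)⁻¹ * (k : Mat N) - 1‖ ≤ 1 / 2 →
      pDist n h k ≤ ENNReal.ofReal ((1 + C * ‖(h : Mat N)⁻¹ * (k : Mat N) - 1‖) *
        pNorm n ((h : Mat N)⁻¹ * (k : Mat N) - 1)) := by
  obtain ⟨C, hC, -, -, h3⟩ := exists_pNorm_mul_le (N := N) hN hn
  refine ⟨2 * C, by linarith, fun h k hx => ?_⟩
  set x := (h : Mat N)⁻¹ * (k : Mat N) - 1 with hxdef
  have hhi : (h : Mat N) * (h : Mat N)⁻¹ = 1 := by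
    rw [← Matrix.coe_units_inv]; exact h.mul_inv
  have hih : (h : Mat N)⁻¹ * (h : Mat N) = 1 := by
    rw [← Matrix.coe_units_inv]; exact h.inv_mul
  have hk : (h : Mat N) * (1 + x) = k := by
    rw [hxdef, add_sub_cancel, ← mul_assoc, hhi, one_mul]
  have hsx : ∀ s ∈ Icc (0 : ℝ) 1, ‖s • x‖ ≤ ‖x‖ := fun s hs => by
    rw [norm_smul, Real.norm_eq_abs, abs_of_nonneg hs.1]
    exact mul_le_of_le_one_left (norm_nonneg x) hs.2
  have hunit : ∀ s ∈ Icc (0 : ℝ) 1, IsUnit (1 + s • x) := fun s hs =>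
    isUnit_one_add (((hsx s hs).trans hx).trans_lt (by norm_num))
  let f : ℝ → Mat N := fun s => (h : Mat N) * (1 + s • x)
  have hf : ∀ s ∈ Icc (0 : ℝ) 1, toMat (ofMat f) s = f s := fun s hs =>
    toMat_ofMat (h.isUnit.mul (hunit s hs))
  have hder : ∀ s, HasDerivAt f ((h : Mat N) * x) s := fun s => (hasDerivAt_line 1 x s).const_mul _
  have m0 : (0 : ℝ) ∈ Icc (0 : ℝ) 1 := left_mem_Icc.2 zero_le_one
  have m1 : (1 : ℝ) ∈ Icc (0 : ℝ) 1 := right_mem_Icc.2 zero_le_one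
  refine iInf₂_le_of_le (ofMat f) ⟨isPiecewiseC1_of_contDiffOn ?_, ?_, ?_⟩ ?_
  · refine ContDiffOn.congr (ContDiff.contDiffOn ?_) hf
    exact contDiff_const.mul (contDiff_const.add (contDiff_id.smul contDiff_const))
  · exact Units.ext ((hf 0 m0).trans (by simp [f]))
  · exact Units.ext ((hf 1 m1).trans (by simp [f, hk]))
  · refine ENNReal.ofReal_le_ofReal ((le_abs_self _).trans ?_)
    have key := intervalIntegral.norm_integral_le_of_norm_le_const (a := (0 : ℝ)) (b := 1)
      (f := fun t => pNorm n (leftVelocity (ofMat f) t))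
      (C := (1 + 2 * C * ‖x‖) * pNorm n x) fun s hs => ?_
    · simpa [smoothLength] using key
    rw [uIoc_of_le zero_le_one] at hs
    have hs' : s ∈ Icc (0 : ℝ) 1 := Ioc_subset_Icc_self hs
    rw [Real.norm_eq_abs, abs_of_nonneg (pNorm_nonneg n _), leftVelocity_eq, hf s hs', velocity,
      derivWithin_congr hf (hf s hs'),
      (hder s).hasDerivWithinAt.derivWithin (uniqueDiffOn_Icc zero_lt_one s hs')]
    have e : (f s)⁻¹ * ((h : Mat N) * x) = (1 + s • x)⁻¹ * x := by
      simp only [f]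
      rw [Matrix.mul_inv_rev, mul_assoc, ← mul_assoc _ (h : Mat N), hih, one_mul]
    rw [e]
    refine (h3 _ x).trans (mul_le_mul_of_nonneg_right ?_ (pNorm_nonneg n x))
    rw [add_le_add_iff_left]
    calc C * ‖(1 + s • x)⁻¹ - 1‖ ≤ C * (2 * ‖x‖) := by
          gcongr
          exact (norm_inv_one_add_sub_one_le hN ((hsx s hs').trans hx)).trans
            (by gcongr; exact hsx s hs')
      _ = 2 * C * ‖x‖ := by ring

end

end GLp

namespace GLp

open scoped Matrix Topology NNReal
open MeasureTheory

noncomputable section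

variable {N : ℕ}

/-! ### The length of Lipschitz curves -/

theorem IsLip.pDist_le_local (hN : 1 ≤ N) {n : ℕ} (hn : 1 ≤ n) {α : ℝ → GLN N} (hα : IsLip α)
    {η : ℝ} (hη : 0 < η) :
    ∃ δ : ℝ, 0 < δ ∧ ∀ s ∈ Icc (0 : ℝ) 1, ∀ t ∈ Icc (0 : ℝ) 1, s ≤ t → t - s ≤ δ →
      pDist n (α s) (α t) ≤
        ENNReal.ofReal ((1 + η) * ∫ r in s..t, pNorm n (leftVelocity α r)) := by
  obtain ⟨C₁, hC₁, H₁⟩ := exists_pDist_le (N := N) hN hn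
  obtain ⟨C₂, hC₂, -, -, H₂⟩ := exists_pNorm_mul_le (N := N) hN hn
  obtain ⟨K, hK⟩ := id hα
  obtain ⟨A, hA⟩ := isCompact_Icc.exists_bound_of_continuousOn
    (continuousOn_toMat_inv hα.continuousOn)
  have hA0 : 0 ≤ A := (norm_nonneg _).trans (hA 0 (left_mem_Icc.2 zero_le_one))
  have hK0 : (0 : ℝ) ≤ K := K.2
  set D := C₁ + C₂
  have hD : 2 ≤ D := by linarith
  -- On such a step b = AK(t - s) bounds the relative displacement, and Db is at most 1/2 and η/6.
  -- Hence segments are available and (1 + C₁b)(1 + C₂b) ≤ 1 + η.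
  refine ⟨min 1 (η / 3) / (2 * (A * K * D + 1)), by positivity, fun s hs t ht hst hδ => ?_⟩
  set b := A * (K * (t - s)) with hb
  have hst0 : 0 ≤ t - s := sub_nonneg.2 hst
  have hb0 : 0 ≤ b := by positivity
  have hDb : D * b ≤ min 1 (η / 3) / 2 := by
    rw [le_div_iff₀ (by positivity)] at hδ
    have : D * b = A * K * D * (t - s) := by rw [hb]; ring
    nlinarith
  have hDb1 : D * b ≤ 1 / 2 := hDb.trans (by gcongr; exact min_le_left _ _)
  have hDb2 : D * b ≤ η / 6 := hDb.trans (by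
    have := min_le_right 1 (η / 3); linarith)
  have hb1 : b ≤ 1 / 2 := by nlinarith
  have hclose : ∀ r ∈ Icc s t, ‖(toMat α s)⁻¹ * toMat α r - 1‖ ≤ b := fun r hr => by
    have hr' : r ∈ Icc (0 : ℝ) 1 := ⟨hs.1.trans hr.1, hr.2.trans ht.2⟩
    have e : (toMat α s)⁻¹ * toMat α r - 1 = (toMat α s)⁻¹ * (toMat α r - toMat α s) := by
      rw [mul_sub, toMat_inv_mul]
    have h1 := hK.dist_le_mul r hr' s hs
    rw [dist_eq_norm, Real.dist_eq, abs_of_nonneg (by linarith [hr.1])] at h1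
    rw [e]
    refine (norm_mul_le _ _).trans (mul_le_mul (hA s hs) (h1.trans ?_) (norm_nonneg _) hA0)
    gcongr
    exact hr.2
  have e := integral_inv_mul hα (toMat α s)⁻¹ hs ht
  rw [toMat_inv_mul] at e
  have hbm := bddMeas_mul_leftVelocity hα (toMat α s)⁻¹
  have hI0 : 0 ≤ ∫ r in s..t, pNorm n (leftVelocity α r) :=
    intervalIntegral.integral_nonneg hst fun r _ => pNorm_nonneg n _
  have hx : pNorm n ((toMat α s)⁻¹ * toMat α t - 1) ≤
      (1 + C₂ * b) * ∫ r in s..t, pNorm n (leftVelocity α r) := by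
    rw [← e, ← intervalIntegral.integral_const_mul]
    refine (pNorm_integral_le hN hn hbm hs ht hst).trans ?_
    refine intervalIntegral.integral_mono_on hst
      ((hbm.comp (continuous_pNorm n)).intervalIntegrable hs ht)
      (((bddMeas_pNorm n hα).intervalIntegrable hs ht).const_mul _) fun r hr => ?_
    refine (H₂ _ _).trans (mul_le_mul_of_nonneg_right ?_ (pNorm_nonneg n _))
    gcongr
    exact hclose r hr
  have hxn := hclose t (right_mem_Icc.2 hst)
  refine (H₁ (α s) (α t) (hxn.trans hb1)).trans (ENNReal.ofReal_le_ofReal ?_)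
  calc _ ≤ (1 + C₁ * b) * ((1 + C₂ * b) * ∫ r in s..t, pNorm n (leftVelocity α r)) := by
        refine mul_le_mul ?_ hx (pNorm_nonneg n _) (by positivity)
        gcongr
        exact hxn
    _ = ((1 + C₁ * b) * (1 + C₂ * b)) * ∫ r in s..t, pNorm n (leftVelocity α r) := by ring
    _ ≤ _ := by
        refine mul_le_mul_of_nonneg_right ?_ hI0
        have e1 : C₁ * b ≤ D * b := by gcongr; linarith
        have e2 : C₂ * b ≤ D * b := by gcongr; linarith
        have e3 : 0 ≤ C₁ * b := by positivity
        have e4 : 0 ≤ C₂ * b := by positivity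
        nlinarith

/-- A Lipschitz curve need not be piecewise C¹, so it is not itself a competitor for d_p. The local
estimate is added up over a fine equal partition, and then η tends to 0. -/
theorem IsLip.pDist_le (hN : 1 ≤ N) {n : ℕ} (hn : 1 ≤ n) {α : ℝ → GLN N} (hα : IsLip α)
    {s t : ℝ} (hs : s ∈ Icc (0 : ℝ) 1) (ht : t ∈ Icc (0 : ℝ) 1) (hst : s ≤ t) :
    pDist n (α s) (α t) ≤ ENNReal.ofReal (∫ r in s..t, pNorm n (leftVelocity α r)) := by
  set φ : ℝ → ℝ := fun r => pNorm n (leftVelocity α r)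
  have hφ : BddMeas φ := bddMeas_pNorm n hα
  have hφ0 : ∀ r, 0 ≤ φ r := fun r => pNorm_nonneg n _
  have key : ∀ η : ℝ, 0 < η → pDist n (α s) (α t) ≤
      ENNReal.ofReal ((1 + η) * ∫ r in s..t, φ r) := by
    intro η hη
    obtain ⟨δ, hδ, H⟩ := hα.pDist_le_local hN hn hη
    obtain ⟨m, hm⟩ := exists_nat_gt ((t - s) / δ)
    have hts : 0 ≤ t - s := sub_nonneg.2 hst
    have hm0 : (0 : ℝ) < m := (by positivity : 0 ≤ (t - s) / δ).trans_lt hm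
    set p : ℕ → ℝ := fun i => s + i * ((t - s) / m)
    have hp : ∀ i ≤ m, p i ∈ Icc s t := fun i hi => by
      have h1 : (i : ℝ) ≤ m := by exact_mod_cast hi
      have h2 : 0 ≤ (t - s) / m := by positivity
      refine ⟨le_add_of_nonneg_right (by positivity), ?_⟩
      have : (i : ℝ) * ((t - s) / m) ≤ m * ((t - s) / m) := by gcongr
      rw [mul_div_cancel₀ _ hm0.ne'] at this
      simp only [p]; linarith
    have hp' : ∀ i ≤ m, p i ∈ Icc (0 : ℝ) 1 := fun i hi =>
      ⟨hs.1.trans (hp i hi).1, (hp i hi).2.trans ht.2⟩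
    have hstep : ∀ i, p (i + 1) - p i = (t - s) / m := fun i => by
      simp only [p]; push_cast; ring
    have hind : ∀ i ≤ m, pDist n (α s) (α (p i)) ≤
        ENNReal.ofReal ((1 + η) * ∫ r in s..p i, φ r) := by
      intro i
      induction i with
      | zero => intro _; simp [p, pDist_self hn]
      | succ i ih =>
        intro hi
        have h1 := ih (by omega)
        have hle : p i ≤ p (i + 1) := by
          have : 0 ≤ (t - s) / m := by positivity
          linarith [hstep i]
        have h2 := H (p i) (hp' i (by omega)) (p (i + 1)) (hp' _ hi) hle (by
          rw [hstep, div_le_iff₀ hm0]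
          rw [div_lt_iff₀ hδ] at hm
          linarith)
        refine (pDist_triangle hn _ (α (p i)) _).trans ((add_le_add h1 h2).trans ?_)
        rw [← ENNReal.ofReal_add, ← mul_add, intervalIntegral.integral_add_adjacent_intervals
          (hφ.intervalIntegrable hs (hp' i (by omega)))
          (hφ.intervalIntegrable (hp' i (by omega)) (hp' _ hi))]
        · exact mul_nonneg (by positivity)
            (intervalIntegral.integral_nonneg (hp i (by omega)).1 fun r _ => hφ0 r)
        · exact mul_nonneg (by positivity) (intervalIntegral.integral_nonneg hle fun r _ => hφ0 r)
    have hend : p m = t := by simp only [p]; rw [mul_div_cancel₀ _ hm0.ne']; ring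
    have := hind m le_rfl
    rwa [hend] at this
  have hlim : Filter.Tendsto (fun η : ℝ => ENNReal.ofReal ((1 + η) * ∫ r in s..t, φ r)) (𝓝[>] 0)
      (𝓝 (ENNReal.ofReal (∫ r in s..t, φ r))) := by
    have : Continuous fun η : ℝ => ENNReal.ofReal ((1 + η) * ∫ r in s..t, φ r) :=
      ENNReal.continuous_ofReal.comp (by fun_prop)
    have h1 := this.tendsto 0
    simp only [add_zero, one_mul] at h1
    exact h1.mono_left nhdsWithin_le_nhds
  exact ge_of_tendsto hlim (Filter.eventually_of_mem self_mem_nhdsWithin fun η hη => key η hη)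

theorem IsLip.rectLength_le (hN : 1 ≤ N) {n : ℕ} (hn : 1 ≤ n) {α : ℝ → GLN N} (hα : IsLip α) :
    rectLength n α 0 1 ≤ ENNReal.ofReal (∫ r in (0 : ℝ)..1, pNorm n (leftVelocity α r)) := by
  have hφ := bddMeas_pNorm n hα
  refine iSup_le fun ⟨k, t, hmono, ht⟩ => ?_
  calc ∑ i ∈ Finset.range k, pDist n (α (t i)) (α (t (i + 1)))
      ≤ ∑ i ∈ Finset.range k,
        ENNReal.ofReal (∫ r in t i..t (i + 1), pNorm n (leftVelocity α r)) :=
        Finset.sum_le_sum fun i _ => hα.pDist_le hN hn (ht i) (ht (i + 1)) (hmono (Nat.le_succ i))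
    _ = ENNReal.ofReal (∫ r in t 0..t k, pNorm n (leftVelocity α r)) := by
        rw [← ENNReal.ofReal_sum_of_nonneg fun i _ => intervalIntegral.integral_nonneg
          (hmono (Nat.le_succ i)) fun r _ => pNorm_nonneg n _,
          intervalIntegral.sum_integral_adjacent_intervals fun i _ =>
            hφ.intervalIntegrable (ht i) (ht (i + 1))]
    _ ≤ _ := ENNReal.ofReal_le_ofReal (intervalIntegral.integral_mono_interval (ht 0).1
        (hmono (Nat.zero_le k)) (ht k).2 (Filter.Eventually.of_forall fun r => pNorm_nonneg n _)
        (hφ.intervalIntegrable (left_mem_Icc.2 zero_le_one) (right_mem_Icc.2 zero_le_one)))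

theorem IsLip.isRectifiable (hN : 1 ≤ N) {n : ℕ} (hn : 1 ≤ n) {α : ℝ → GLN N} (hα : IsLip α) :
    IsRectifiable n α :=
  ⟨continuousOn_of_toMat hα.continuousOn, (hα.rectLength_le hN hn).trans_lt ENNReal.ofReal_lt_top⟩

/-! ### The rectifiable length as a variation -/

/-- `GL(N)` with the distance `d_p`. -/
def PMetric (N _n : ℕ) : Type := GLN N

/-- The extended pseudo-metric structure given by `d_p`. -/
@[reducible]
def pseudoEMetricSpace (N : ℕ) {n : ℕ} (hn : 1 ≤ n) : PseudoEMetricSpace (PMetric N n) where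
  edist := fun h k => pDist n (N := N) h k
  edist_self := pDist_self (N := N) hn
  edist_comm := pDist_comm (N := N) hn
  edist_triangle := pDist_triangle (N := N) hn

/-- A curve in `GL(N)` as a curve in the metric space `(GL(N), d_p)`. -/
def toPMetric (n : ℕ) (α : ℝ → GLN N) : ℝ → PMetric N n := α

/-- Additivity, monotonicity and invariance under reparametrization are inherited from the theory of
bounded variation. -/
theorem rectLength_eq_eVariationOn {n : ℕ} (hn : 1 ≤ n) (α : ℝ → GLN N) (a b : ℝ) :
    letI := pseudoEMetricSpace N hn
    rectLength n α a b = eVariationOn (toPMetric n α) (Icc a b) := by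
  let := pseudoEMetricSpace N hn
  refine iSup_congr fun p => Finset.sum_congr rfl fun i _ => ?_
  -- `eVariationOn` measures from the later point to the earlier one.
  exact pDist_comm hn _ _

theorem pDist_le_rectLength {n : ℕ} (hn : 1 ≤ n) (α : ℝ → GLN N) {a b s t : ℝ}
    (hs : s ∈ Icc a b) (ht : t ∈ Icc a b) : pDist n (α s) (α t) ≤ rectLength n α a b := by
  let := pseudoEMetricSpace N hn
  rw [rectLength_eq_eVariationOn hn]
  exact eVariationOn.edist_le (toPMetric n α) hs ht

theorem rectLength_add {n : ℕ} (hn : 1 ≤ n) (α : ℝ → GLN N) {a b c : ℝ} (hab : a ≤ b)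
    (hbc : b ≤ c) : rectLength n α a b + rectLength n α b c = rectLength n α a c := by
  let := pseudoEMetricSpace N hn
  simp only [rectLength_eq_eVariationOn hn]
  simpa using eVariationOn.Icc_add_Icc (toPMetric n α) (s := univ) hab hbc (mem_univ b)

theorem rectLength_congr {n : ℕ} {α β : ℝ → GLN N} {a b : ℝ} (h : EqOn α β (Icc a b)) :
    rectLength n α a b = rectLength n β a b := by
  refine iSup_congr fun p => Finset.sum_congr rfl fun i _ => ?_
  rw [h (p.2.2.2 i), h (p.2.2.2 (i + 1))]

theorem rectLength_comp {n : ℕ} (hn : 1 ≤ n) (α : ℝ → GLN N) {φ : ℝ → ℝ} {a b : ℝ} (hab : a ≤ b)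
    (hc : ContinuousOn φ (Icc a b)) (hm : MonotoneOn φ (Icc a b)) :
    rectLength n (fun t => α (φ t)) a b = rectLength n α (φ a) (φ b) := by
  let := pseudoEMetricSpace N hn
  have himage : φ '' Icc a b = Icc (φ a) (φ b) := by
    refine subset_antisymm ?_ (intermediate_value_Icc hab hc)
    rintro _ ⟨x, hx, rfl⟩
    exact ⟨hm (left_mem_Icc.2 hab) hx hx.1, hm hx (right_mem_Icc.2 hab) hx.2⟩
  simp only [rectLength_eq_eVariationOn hn]
  rw [← himage]
  exact eVariationOn.comp_eq_of_monotoneOn (toPMetric n α) φ hm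

theorem rectLength_mono {n : ℕ} (hn : 1 ≤ n) (α : ℝ → GLN N) {a b c d : ℝ}
    (h : Icc c d ⊆ Icc a b) : rectLength n α c d ≤ rectLength n α a b := by
  let := pseudoEMetricSpace N hn
  simp only [rectLength_eq_eVariationOn hn]
  exact eVariationOn.mono _ h

theorem tendsto_pDist (hN : 1 ≤ N) {n : ℕ} (hn : 1 ≤ n) {α : ℝ → GLN N}
    (h : ContinuousOn α (Icc 0 1)) {x : ℝ} (hx : x ∈ Icc (0 : ℝ) 1) :
    Filter.Tendsto (fun t => pDist n (α x) (α t)) (𝓝[Icc 0 1] x) (𝓝 0) := by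
  obtain ⟨C, hC, H⟩ := exists_pDist_le (N := N) hN hn
  have hcont : ContinuousWithinAt (fun t => (toMat α x)⁻¹ * toMat α t - 1) (Icc 0 1) x :=
    (continuousWithinAt_const.mul (continuousOn_toMat h x hx)).sub continuousWithinAt_const
  have h0 : (toMat α x)⁻¹ * toMat α x - 1 = 0 := by rw [toMat_inv_mul, sub_self]
  have hsmall : ∀ᶠ t in 𝓝[Icc 0 1] x, ‖(toMat α x)⁻¹ * toMat α t - 1‖ ≤ 1 / 2 := by
    have := hcont.norm.tendsto
    rw [h0, norm_zero] at this
    exact (this.eventually (Iio_mem_nhds (by norm_num : (0 : ℝ) < 1 / 2))).mono fun _ h => le_of_lt h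
  have hlim : Filter.Tendsto (fun t => ENNReal.ofReal
      ((1 + C * ‖(toMat α x)⁻¹ * toMat α t - 1‖) * pNorm n ((toMat α x)⁻¹ * toMat α t - 1)))
      (𝓝[Icc 0 1] x) (𝓝 0) := by
    have h1 : ContinuousWithinAt (fun t => ENNReal.ofReal
      ((1 + C * ‖(toMat α x)⁻¹ * toMat α t - 1‖) * pNorm n ((toMat α x)⁻¹ * toMat α t - 1)))
      (Icc 0 1) x :=
      ENNReal.continuous_ofReal.continuousAt.comp_continuousWithinAt
        ((continuousWithinAt_const.add (continuousWithinAt_const.mul hcont.norm)).mul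
          ((continuous_pNorm n).continuousAt.comp_continuousWithinAt hcont))
    have h2 := h1.tendsto
    rw [h0, pNorm_zero hn, mul_zero, ENNReal.ofReal_zero] at h2
    exact h2
  refine tendsto_of_tendsto_of_tendsto_of_le_of_le' tendsto_const_nhds hlim
    (Filter.Eventually.of_forall fun _ => zero_le) ?_
  filter_upwards [hsmall] with t ht
  exact H (α x) (α t) ht

theorem continuousWithinAt_toPMetric (hN : 1 ≤ N) {n : ℕ} (hn : 1 ≤ n) {α : ℝ → GLN N}
    (h : ContinuousOn α (Icc 0 1)) {x : ℝ} (hx : x ∈ Icc (0 : ℝ) 1) :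
    letI := pseudoEMetricSpace N hn
    ContinuousWithinAt (toPMetric n α) (Icc 0 1) x := by
  let := pseudoEMetricSpace N hn
  rw [ContinuousWithinAt, tendsto_iff_edist_tendsto_0]
  refine (tendsto_pDist hN hn h hx).congr fun t => ?_
  exact pDist_comm hn _ _

/-- For a d_p-continuous path of bounded variation, the variation over an interval shrinking to x
from either side tends to 0. -/
theorem continuousOn_rectLength (hN : 1 ≤ N) {n : ℕ} (hn : 1 ≤ n) {α : ℝ → GLN N}
    (h : IsRectifiable n α) :
    ContinuousOn (fun t => (rectLength n α 0 t).toReal) (Icc 0 1) := by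
  let := pseudoEMetricSpace N hn
  have hbv : BoundedVariationOn (toPMetric n α) (Icc 0 1) := by
    rw [BoundedVariationOn, ← rectLength_eq_eVariationOn hn]; exact h.2.ne
  have hfin : ∀ s ∈ Icc (0 : ℝ) 1, ∀ t ∈ Icc (0 : ℝ) 1, rectLength n α s t ≠ ⊤ := fun s hs t ht =>
    ((rectLength_mono hn α (Icc_subset_Icc hs.1 ht.2)).trans_lt h.2).ne
  intro x hx
  have hc := continuousWithinAt_toPMetric hN hn h.1 hx
  have h1 := hbv.tendsto_eVariationOn_Icc_zero_left (x := x) (hc.mono inter_subset_left)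
  have h2 := hbv.tendsto_eVariationOn_Icc_zero_right x (hc.mono inter_subset_left)
  have h3 := (ENNReal.tendsto_toReal ENNReal.zero_ne_top).comp h1
  have h4 := (ENNReal.tendsto_toReal ENNReal.zero_ne_top).comp h2
  have h5 := h3.add h4
  simp only [ENNReal.toReal_zero, add_zero] at h5
  rw [ContinuousWithinAt, tendsto_iff_dist_tendsto_zero]
  refine squeeze_zero' (Filter.Eventually.of_forall fun _ => dist_nonneg) ?_ h5
  filter_upwards [self_mem_nhdsWithin] with t ht
  have key : ∀ s ∈ Icc (0 : ℝ) 1, ∀ t ∈ Icc (0 : ℝ) 1, s ≤ t →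
      (rectLength n α 0 t).toReal - (rectLength n α 0 s).toReal =
        (eVariationOn (toPMetric n α) (Icc 0 1 ∩ Icc s t)).toReal := fun s hs t ht hst => by
    rw [← rectLength_add hn α hs.1 hst, ENNReal.toReal_add (hfin 0 (left_mem_Icc.2 zero_le_one) s hs)
      (hfin s hs t ht), add_sub_cancel_left, rectLength_eq_eVariationOn hn,
      inter_eq_right.2 (Icc_subset_Icc hs.1 ht.2)]
  rcases le_total t x with htx | htx
  · rw [dist_comm, Real.dist_eq, key t ht x hx htx, abs_of_nonneg ENNReal.toReal_nonneg]
    exact le_add_of_nonneg_right ENNReal.toReal_nonneg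
  · rw [Real.dist_eq, key x hx t ht htx, abs_of_nonneg ENNReal.toReal_nonneg]
    exact le_add_of_nonneg_left ENNReal.toReal_nonneg

end

end GLp

namespace GLp

open scoped Matrix Topology NNReal
open MeasureTheory

noncomputable section

variable {N : ℕ}

/-! ### Constant speed parametrizations -/

theorem rectLength_self {n : ℕ} (hn : 1 ≤ n) (α : ℝ → GLN N) (a : ℝ) : rectLength n α a a = 0 := by
  let := pseudoEMetricSpace N hn
  rw [rectLength_eq_eVariationOn hn]
  exact eVariationOn.subsingleton _ (by simp)

/-- Normalized arc length φ is continuous, monotone and onto, and γ factors through it. -/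
theorem exists_constantSpeedParam (hN : 1 ≤ N) {n : ℕ} (hn : 1 ≤ n) {γ : ℝ → GLN N}
    (h : IsRectifiable n γ) : ∃ β : ℝ → GLN N, IsConstantSpeedParam n γ β := by
  have hfin : ∀ s ∈ Icc (0 : ℝ) 1, ∀ t ∈ Icc (0 : ℝ) 1, rectLength n γ s t ≠ ⊤ := fun s hs t ht =>
    ((rectLength_mono hn γ (Icc_subset_Icc hs.1 ht.2)).trans_lt h.2).ne
  have m0 : (0 : ℝ) ∈ Icc (0 : ℝ) 1 := left_mem_Icc.2 zero_le_one
  have m1 : (1 : ℝ) ∈ Icc (0 : ℝ) 1 := right_mem_Icc.2 zero_le_one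
  rcases eq_or_ne (rectLength n γ 0 1) 0 with hL | hL
  -- Length zero leaves nothing to normalize by, but γ is then a parametrization of itself.
  · refine ⟨γ, fun s t hs hst ht => ?_, id, continuousOn_id, monotoneOn_id, rfl, rfl, fun t _ => rfl⟩
    rw [hL, mul_zero]
    exact le_antisymm ((rectLength_mono hn γ (Icc_subset_Icc hs ht)).trans hL.le) zero_le
  set L := (rectLength n γ 0 1).toReal with hLdef
  have hLpos : 0 < L := ENNReal.toReal_pos hL h.2.ne
  have hadd : ∀ s ∈ Icc (0 : ℝ) 1, ∀ t ∈ Icc (0 : ℝ) 1, s ≤ t →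
      (rectLength n γ 0 t).toReal = (rectLength n γ 0 s).toReal + (rectLength n γ s t).toReal :=
    fun s hs t ht hst => by
      rw [← rectLength_add hn γ hs.1 hst, ENNReal.toReal_add (hfin 0 m0 s hs) (hfin s hs t ht)]
  let φ : ℝ → ℝ := fun t => (rectLength n γ 0 t).toReal / L
  have hφc : ContinuousOn φ (Icc 0 1) := (continuousOn_rectLength hN hn h).div_const L
  have hφm : MonotoneOn φ (Icc 0 1) := fun s hs t ht hst => by
    simp only [φ]
    rw [hadd s hs t ht hst]
    gcongr
    exact le_add_of_nonneg_right ENNReal.toReal_nonneg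
  have hφ0 : φ 0 = 0 := by simp [φ, rectLength_self hn]
  have hφ1 : φ 1 = 1 := div_self hLpos.ne'
  have hsurj : ∀ s ∈ Icc (0 : ℝ) 1, ∃ t ∈ Icc (0 : ℝ) 1, φ t = s := fun s hs => by
    have := intermediate_value_Icc zero_le_one hφc
    rw [hφ0, hφ1] at this
    exact this hs
  -- Any right inverse of φ will do: γ is constant on the fibres of φ, because a piece of zero
  -- length joins points at d_p-distance zero.
  choose! σ hσ hφσ using hsurj
  have hφmem : ∀ t ∈ Icc (0 : ℝ) 1, φ t ∈ Icc (0 : ℝ) 1 := fun t ht =>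
    ⟨hφ0.symm.le.trans (hφm m0 ht ht.1), (hφm ht m1 ht.2).trans hφ1.le⟩
  have hinj : ∀ s ∈ Icc (0 : ℝ) 1, ∀ t ∈ Icc (0 : ℝ) 1, s ≤ t → φ s = φ t → γ s = γ t :=
    fun s hs t ht hst he => by
      refine eq_of_pDist_eq_zero hN hn (le_antisymm ?_ zero_le)
      refine (pDist_le_rectLength hn γ (left_mem_Icc.2 hst) (right_mem_Icc.2 hst)).trans ?_
      have h1 : (rectLength n γ s t).toReal = 0 := by
        have h2 := (div_left_inj' hLpos.ne').1 he
        have h3 := hadd s hs t ht hst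
        linarith
      exact ((ENNReal.toReal_eq_zero_iff _).1 h1).resolve_right (hfin s hs t ht) |>.le
  have hβ : ∀ t ∈ Icc (0 : ℝ) 1, γ t = γ (σ (φ t)) := fun t ht => by
    have h1 := hσ _ (hφmem t ht)
    have h2 := hφσ _ (hφmem t ht)
    rcases le_total t (σ (φ t)) with hle | hle
    · exact hinj _ ht _ h1 hle h2.symm
    · exact (hinj _ h1 _ ht hle h2).symm
  have hlen : ∀ a ∈ Icc (0 : ℝ) 1, ∀ b ∈ Icc (0 : ℝ) 1, a ≤ b →
      rectLength n (fun s => γ (σ s)) (φ a) (φ b) = rectLength n γ a b := fun a ha b hb hab => by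
    have hsub : Icc a b ⊆ Icc (0 : ℝ) 1 := Icc_subset_Icc ha.1 hb.2
    rw [← rectLength_comp hn (fun s => γ (σ s)) hab (hφc.mono hsub) (hφm.mono hsub)]
    exact rectLength_congr fun t ht => (hβ t (hsub ht)).symm
  refine ⟨fun s => γ (σ s), fun s t hs hst ht => ?_, φ, hφc, hφm, hφ0, hφ1, hβ⟩
  have hs' : s ∈ Icc (0 : ℝ) 1 := ⟨hs, hst.trans ht⟩
  have ht' : t ∈ Icc (0 : ℝ) 1 := ⟨hs.trans hst, ht⟩
  have h01 := hlen 0 m0 1 m1 zero_le_one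
  rw [hφ0, hφ1] at h01
  rw [h01]
  rcases hst.eq_or_lt with rfl | hlt
  · rw [rectLength_self hn, sub_self, ENNReal.ofReal_zero, zero_mul]
  have hab : σ s ≤ σ t := by
    by_contra hc
    have := hφm (hσ t ht') (hσ s hs') (not_le.1 hc).le
    rw [hφσ t ht', hφσ s hs'] at this
    linarith
  have h2 := hlen _ (hσ s hs') _ (hσ t ht') hab
  rw [hφσ t ht', hφσ s hs'] at h2
  rw [h2, ← ENNReal.ofReal_toReal (hfin _ (hσ s hs') _ (hσ t ht')),
    ← ENNReal.ofReal_toReal h.2.ne, ← ENNReal.ofReal_mul (sub_nonneg.2 hst), ← hLdef]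
  congr 1
  have h3 := hadd _ (hσ s hs') _ (hσ t ht') hab
  have h4 : (rectLength n γ 0 (σ s)).toReal = s * L := (div_eq_iff hLpos.ne').1 (hφσ s hs')
  have h5 : (rectLength n γ 0 (σ t)).toReal = t * L := (div_eq_iff hLpos.ne').1 (hφσ t ht')
  linarith

/-! ### Lipschitz and speed bounds for constant speed curves -/

theorem IsConstantSpeedParam.endpoints {n : ℕ} {γ β : ℝ → GLN N}
    (h : IsConstantSpeedParam n γ β) : γ 0 = β 0 ∧ γ 1 = β 1 := by
  obtain ⟨-, φ, -, -, h0, h1, hγ⟩ := h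
  have e0 := hγ 0 (left_mem_Icc.2 zero_le_one)
  have e1 := hγ 1 (right_mem_Icc.2 zero_le_one)
  rw [h0] at e0
  rw [h1] at e1
  exact ⟨e0, e1⟩

theorem IsConstantSpeedParam.rectLength_eq {n : ℕ} (hn : 1 ≤ n) {γ β : ℝ → GLN N}
    (h : IsConstantSpeedParam n γ β) : rectLength n γ 0 1 = rectLength n β 0 1 := by
  obtain ⟨-, φ, hc, hm, h0, h1, hγ⟩ := h
  rw [rectLength_congr (β := fun t => β (φ t)) hγ, rectLength_comp hn β zero_le_one hc hm, h0, h1]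

theorem HasConstantSpeed.pDist_le {n : ℕ} (hn : 1 ≤ n) {β : ℝ → GLN N}
    (h : HasConstantSpeed n β) (hfin : rectLength n β 0 1 ≠ ⊤) {s t : ℝ}
    (hs : s ∈ Icc (0 : ℝ) 1) (ht : t ∈ Icc (0 : ℝ) 1) :
    pDist n (β s) (β t) ≤ ENNReal.ofReal ((rectLength n β 0 1).toReal * |t - s|) := by
  wlog hst : s ≤ t generalizing s t
  · rw [pDist_comm hn, abs_sub_comm]
    exact this ht hs (le_of_not_ge hst)
  refine (pDist_le_rectLength hn β (left_mem_Icc.2 hst) (right_mem_Icc.2 hst)).trans ?_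
  rw [h s t hs.1 hst ht.2, abs_of_nonneg (sub_nonneg.2 hst), mul_comm _ (t - s),
    ENNReal.ofReal_mul (sub_nonneg.2 hst), ENNReal.ofReal_toReal hfin]

theorem HasConstantSpeed.isLip (hN : 1 ≤ N) {n : ℕ} (hn : 1 ≤ n) {β : ℝ → GLN N}
    (h : HasConstantSpeed n β) (hfin : rectLength n β 0 1 ≠ ⊤) : IsLip β := by
  obtain ⟨C, hC, H⟩ := exists_pNorm_le_of_pDist_lt (N := N) hN hn
  obtain ⟨D, hD, -, HD⟩ := exists_pNorm_equiv (N := N) hN hn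
  -- The added 1 makes L positive and gives the strict inequality that `exists_pNorm_le_of_pDist_lt`
  -- requires.
  set L := (rectLength n β 0 1).toReal + 1 with hL
  have hL0 : 0 < L := by have := ENNReal.toReal_nonneg (a := rectLength n β 0 1); linarith
  have hloc : ∀ s ∈ Icc (0 : ℝ) 1, ∀ t ∈ Icc (0 : ℝ) 1, |t - s| ≤ (C * L)⁻¹ →
      ‖toMat β t - toMat β s‖ ≤ ‖toMat β s‖ * (D * (2 * L)) * |t - s| := by
    intro s hs t ht hst
    rcases eq_or_ne t s with rfl | hne
    · simp
    have hpos : 0 < |t - s| := abs_pos.2 (sub_ne_zero.2 hne)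
    have h1 : C * (L * |t - s|) ≤ 1 := by
      rw [← mul_assoc]
      calc C * L * |t - s| ≤ C * L * (C * L)⁻¹ := by gcongr
        _ = 1 := mul_inv_cancel₀ (by positivity)
    have h2 := H (β s) (β t) (L * |t - s|) h1 ((h.pDist_le hn hfin hs ht).trans_lt
      (ENNReal.ofReal_lt_ofReal_iff (by positivity) |>.2 (by gcongr; linarith)))
    have h3 : ‖(toMat β s)⁻¹ * toMat β t - 1‖ ≤ D * (2 * (L * |t - s|)) :=
      (HD _).trans (by gcongr; exact h2.trans (by gcongr; linarith))
    have e : toMat β t - toMat β s = toMat β s * ((toMat β s)⁻¹ * toMat β t - 1) := by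
      rw [mul_sub, ← mul_assoc, toMat_mul_inv, one_mul, mul_one]
    rw [e]
    refine (norm_mul_le _ _).trans ((mul_le_mul_of_nonneg_left h3 (norm_nonneg _)).trans
      (le_of_eq (by ring)))
  have hδ : 0 < (C * L)⁻¹ := by positivity
  have hcont : ContinuousOn (toMat β) (Icc 0 1) := fun s hs => by
    rw [ContinuousWithinAt, tendsto_iff_norm_sub_tendsto_zero]
    have hlim : Filter.Tendsto (fun t => ‖toMat β s‖ * (D * (2 * L)) * |t - s|) (𝓝[Icc 0 1] s)
        (𝓝 0) := by
      have : Continuous fun t => ‖toMat β s‖ * (D * (2 * L)) * |t - s| := by fun_prop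
      have h1 := this.tendsto s
      simp only [sub_self, abs_zero, mul_zero] at h1
      exact h1.mono_left nhdsWithin_le_nhds
    refine squeeze_zero' (Filter.Eventually.of_forall fun _ => norm_nonneg _) ?_ hlim
    have hball : ∀ᶠ t in 𝓝[Icc 0 1] s, t ∈ Metric.closedBall s (C * L)⁻¹ :=
      nhdsWithin_le_nhds (Metric.closedBall_mem_nhds s hδ)
    filter_upwards [hball, self_mem_nhdsWithin] with t h1 ht
    exact hloc s hs t ht (by rwa [Metric.mem_closedBall, Real.dist_eq] at h1)
  obtain ⟨B, hB⟩ := isCompact_Icc.exists_bound_of_continuousOn hcont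
  have hB0 : 0 ≤ B := (norm_nonneg _).trans (hB 0 (left_mem_Icc.2 zero_le_one))
  -- The first summand serves points within 1/(CL) of each other, the second distant points, whose
  -- images differ by at most 2B.
  refine ⟨Real.toNNReal (B * (D * (2 * L)) + 2 * B * (C * L)),
    LipschitzOnWith.of_dist_le_mul fun t ht s hs => ?_⟩
  rw [Real.coe_toNNReal _ (by positivity), dist_eq_norm, Real.dist_eq, add_mul]
  rcases le_total |t - s| (C * L)⁻¹ with hle | hle
  · refine (hloc s hs t ht hle).trans (le_add_of_le_of_nonneg ?_ (by positivity))
    gcongr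
    exact hB s hs
  · refine le_add_of_nonneg_of_le (by positivity) ?_
    have h1 : ‖toMat β t - toMat β s‖ ≤ 2 * B :=
      (norm_sub_le _ _).trans (by linarith [hB t ht, hB s hs])
    refine h1.trans ?_
    rw [mul_assoc]
    refine le_mul_of_one_le_right (by positivity) ?_
    calc 1 = C * L * (C * L)⁻¹ := (mul_inv_cancel₀ (by positivity)).symm
      _ ≤ _ := by gcongr

/-- The local comparison bounds the left-translated difference quotients by any number above the
length, up to an error vanishing in the limit. -/
theorem HasConstantSpeed.pNorm_le (hN : 1 ≤ N) {n : ℕ} (hn : 1 ≤ n) {β : ℝ → GLN N}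
    (h : HasConstantSpeed n β) (hfin : rectLength n β 0 1 ≠ ⊤) {t : ℝ} (ht : t ∈ Ioo (0 : ℝ) 1)
    (hd : HasDerivAt (toMat β) (velocity β t) t) :
    pNorm n (leftVelocity β t) ≤ (rectLength n β 0 1).toReal := by
  obtain ⟨C, hC, H⟩ := exists_pNorm_le_of_pDist_lt (N := N) hN hn
  refine le_of_forall_gt_imp_ge_of_dense fun L hL => ?_
  have hL0 : 0 < L := ENNReal.toReal_nonneg.trans_lt hL
  have hslope := (hasDerivAt_iff_tendsto_slope.1 hd).mono_left
    (nhdsWithin_mono t (fun r hr => (ne_of_gt hr : r ≠ t) : Ioi t ⊆ {t}ᶜ))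
  have hlim1 : Filter.Tendsto (fun r => pNorm n ((toMat β t)⁻¹ * slope (toMat β) t r)) (𝓝[>] t)
      (𝓝 (pNorm n (leftVelocity β t))) := by
    rw [leftVelocity_eq]
    exact ((continuous_pNorm n).tendsto _).comp (hslope.const_mul _)
  have hlim2 : Filter.Tendsto (fun r => (1 + C * (L * (r - t))) * L) (𝓝[>] t) (𝓝 L) := by
    have : Continuous fun r => (1 + C * (L * (r - t))) * L := by fun_prop
    have h1 := this.tendsto t
    simp only [sub_self, mul_zero, add_zero, one_mul] at h1
    exact h1.mono_left nhdsWithin_le_nhds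
  refine le_of_tendsto_of_tendsto hlim1 hlim2 ?_
  have hsmall : t < min 1 (t + (C * L)⁻¹) :=
    lt_min ht.2 (lt_add_of_pos_right t (by positivity))
  filter_upwards [Ioo_mem_nhdsGT hsmall] with r hr
  have hr1 : r < 1 := hr.2.trans_le (min_le_left _ _)
  have hr2 : r - t < (C * L)⁻¹ := by linarith [hr.2.trans_le (min_le_right 1 (t + (C * L)⁻¹))]
  have hpos : 0 < r - t := sub_pos.2 hr.1
  have h1 : C * (L * (r - t)) ≤ 1 := by
    rw [← mul_assoc]
    calc C * L * (r - t) ≤ C * L * (C * L)⁻¹ := by gcongr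
      _ = 1 := mul_inv_cancel₀ (by positivity)
  have h2 := H (β t) (β r) (L * (r - t)) h1
    ((h.pDist_le hn hfin (Ioo_subset_Icc_self ht) ⟨ht.1.le.trans hr.1.le, hr1.le⟩).trans_lt
      (ENNReal.ofReal_lt_ofReal_iff (by positivity) |>.2 (by
        rw [abs_of_pos hpos]; gcongr)))
  have e : (toMat β t)⁻¹ * slope (toMat β) t r =
      (r - t)⁻¹ • ((toMat β t)⁻¹ * toMat β r - 1) := by
    rw [slope_def_module, mul_smul_comm, mul_sub, toMat_inv_mul]
  rw [e, pNorm_smul hn, abs_of_pos (by positivity), inv_mul_le_iff₀ hpos]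
  exact h2.trans (le_of_eq (by ring))

end

end GLp

namespace GLp

open scoped Matrix Topology NNReal
open MeasureTheory

noncomputable section

variable {N : ℕ}

/-! ### The first variation -/

/-- Lebesgue measure on the unit interval. -/
abbrev unitVol : Measure ℝ := volume.restrict (Icc (0 : ℝ) 1)

theorem isProbabilityMeasure_unitVol : IsProbabilityMeasure unitVol := ⟨by simp⟩

theorem intervalIntegral_eq_unitVol {E : Type*} [NormedAddCommGroup E] [NormedSpace ℝ E]
    (f : ℝ → E) : ∫ t in (0 : ℝ)..1, f t = ∫ t, f t ∂unitVol := by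
  rw [intervalIntegral.integral_of_le zero_le_one, integral_Icc_eq_integral_Ioc]

theorem lipschitzOnWith_mul {f g : ℝ → Mat N} {s : Set ℝ} {K L A B : ℝ≥0}
    (hf : LipschitzOnWith K f s) (hg : LipschitzOnWith L g s) (hA : ∀ t ∈ s, ‖f t‖ ≤ A)
    (hB : ∀ t ∈ s, ‖g t‖ ≤ B) : LipschitzOnWith (K * B + A * L) (fun t => f t * g t) s := by
  refine LipschitzOnWith.of_dist_le_mul fun x hx y hy => ?_
  have h1 := hf.dist_le_mul x hx y hy
  have h2 := hg.dist_le_mul x hx y hy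
  rw [dist_eq_norm] at h1 h2 ⊢
  have e : f x * g x - f y * g y = (f x - f y) * g x + f y * (g x - g y) := by noncomm_ring
  rw [e]
  refine (norm_add_le _ _).trans ((add_le_add (norm_mul_le _ _) (norm_mul_le _ _)).trans ?_)
  push_cast
  rw [add_mul]
  refine add_le_add ?_ ?_
  · calc ‖f x - f y‖ * ‖g x‖ ≤ (K * dist x y) * B := by gcongr; exact hB x hx
      _ = K * B * dist x y := by ring
  · calc ‖f y‖ * ‖g x - g y‖ ≤ A * (L * dist x y) := by gcongr; exact hA y hy
      _ = A * L * dist x y := by ring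

theorem exists_primitive {k : ℝ → Mat N} (hk : BddMeas k) (hk0 : ∫ t in (0 : ℝ)..1, k t = 0) :
    ∃ (u : ℝ → Mat N) (B : ℝ≥0), u 0 = 0 ∧ u 1 = 0 ∧ LipschitzOnWith B u (Icc 0 1) ∧
      (∀ t ∈ Icc (0 : ℝ) 1, ‖u t‖ ≤ B) ∧ ∀ᵐ t ∂unitVol, HasDerivAt u (k t) t := by
  obtain ⟨B, hB⟩ := hk.2
  have m0 : (0 : ℝ) ∈ Icc (0 : ℝ) 1 := left_mem_Icc.2 zero_le_one
  have m1 : (1 : ℝ) ∈ Icc (0 : ℝ) 1 := right_mem_Icc.2 zero_le_one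
  have hlip : LipschitzOnWith B.toNNReal (fun t => ∫ r in (0 : ℝ)..t, k r) (Icc 0 1) := by
    refine LipschitzOnWith.of_dist_le_mul fun x hx y hy => ?_
    rw [dist_eq_norm, intervalIntegral.integral_interval_sub_left (hk.intervalIntegrable m0 hx)
      (hk.intervalIntegrable m0 hy), Real.dist_eq]
    refine intervalIntegral.norm_integral_le_of_norm_le_const_ae ?_
    filter_upwards [(ae_restrict_iff' measurableSet_Icc).1 hB] with r hr hrs
    exact (hr (uIcc_subset_Icc hy hx (uIoc_subset_uIcc hrs))).trans (Real.le_coe_toNNReal B)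
  refine ⟨fun t => ∫ r in (0 : ℝ)..t, k r, B.toNNReal, by simp, hk0, hlip, fun t ht => ?_, ?_⟩
  · have := hlip.dist_le_mul t ht 0 m0
    simp only [intervalIntegral.integral_same, dist_zero_right, Real.norm_eq_abs,
      abs_of_nonneg ht.1] at this
    exact this.trans (mul_le_of_le_one_right (NNReal.coe_nonneg _) ht.2)
  · rw [ae_restrict_iff' measurableSet_Icc]
    filter_upwards [(hk.intervalIntegrable m0 m1).ae_hasDerivAt_integral] with t h ht
    rw [uIcc_of_le zero_le_one] at h
    exact h ht 0 m0

/-- The curve `(1 + u) β` obtained from `β` by a small perturbation vanishing at the endpoints. -/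
theorem exists_perturbed_curve {β : ℝ → GLN N} (hβ : IsLip β) {u k : ℝ → Mat N} {B : ℝ≥0}
    (hu0 : u 0 = 0) (hu1 : u 1 = 0) (hu : LipschitzOnWith B u (Icc 0 1))
    (hsmall : ∀ t ∈ Icc (0 : ℝ) 1, ‖u t‖ ≤ 1 / 2) (hk : ∀ᵐ t ∂unitVol, HasDerivAt u (k t) t) :
    ∃ α : ℝ → GLN N, IsLip α ∧ α 0 = β 0 ∧ α 1 = β 1 ∧ ∀ᵐ t ∂unitVol, leftVelocity α t =
      leftVelocity β t + (toMat β t)⁻¹ * (1 + u t)⁻¹ * k t * toMat β t := by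
  have hunit : ∀ t ∈ Icc (0 : ℝ) 1, IsUnit (1 + u t) := fun t ht =>
    isUnit_one_add ((hsmall t ht).trans_lt (by norm_num))
  let f : ℝ → Mat N := fun t => (1 + u t) * toMat β t
  have hf : ∀ t ∈ Icc (0 : ℝ) 1, toMat (ofMat f) t = f t := fun t ht =>
    toMat_ofMat ((hunit t ht).mul (isUnit_toMat β t))
  have m0 : (0 : ℝ) ∈ Icc (0 : ℝ) 1 := left_mem_Icc.2 zero_le_one
  have m1 : (1 : ℝ) ∈ Icc (0 : ℝ) 1 := right_mem_Icc.2 zero_le_one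
  obtain ⟨K, hK⟩ := id hβ
  have hlip : ∃ C, LipschitzOnWith C f (Icc 0 1) := by
    obtain ⟨A, hA⟩ := isCompact_Icc.exists_bound_of_continuousOn hK.continuousOn
    have h1 : LipschitzOnWith B (fun t => 1 + u t) (Icc 0 1) :=
      LipschitzOnWith.of_dist_le_mul fun x hx y hy => by
        simpa using hu.dist_le_mul x hx y hy
    obtain ⟨A', hA'⟩ := isCompact_Icc.exists_bound_of_continuousOn h1.continuousOn
    exact ⟨_, lipschitzOnWith_mul h1 hK (fun t ht => (hA' t ht).trans (Real.le_coe_toNNReal A'))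
      (fun t ht => (hA t ht).trans (Real.le_coe_toNNReal A))⟩
  obtain ⟨C, hC⟩ := hlip
  refine ⟨ofMat f, ⟨C, fun x hx y hy => ?_⟩, ?_, ?_, ?_⟩
  · rw [hf x hx, hf y hy]; exact hC hx hy
  · exact Units.ext ((hf 0 m0).trans (by simp [f, hu0, toMat]))
  · exact Units.ext ((hf 1 m1).trans (by simp [f, hu1, toMat]))
  · filter_upwards [ae_mem_Ioo, hk, ae_hasDerivAt_of_lipschitzOnWith hK] with t ht h1 h2
    have ht' := Ioo_subset_Icc_self ht
    have hd : HasDerivAt f (k t * toMat β t + (1 + u t) * velocity β t) t :=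
      (h1.const_add 1).mul h2
    have hv : velocity (ofMat f) t = k t * toMat β t + (1 + u t) * velocity β t := by
      rw [velocity, derivWithin_eq_deriv_of_eqOn hf ht]
      exact hd.deriv
    have hinv : (1 + u t)⁻¹ * (1 + u t) = 1 :=
      Matrix.nonsing_inv_mul _ ((Matrix.isUnit_iff_isUnit_det _).1 (hunit t ht'))
    rw [leftVelocity_eq, hv, hf t ht', leftVelocity_eq]
    simp only [f]
    rw [Matrix.mul_inv_rev, mul_add, add_comm]
    congr 1
    · rw [mul_assoc, ← mul_assoc (1 + u t)⁻¹, hinv, one_mul]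
    · simp only [mul_assoc]

/-! ### Energy minimality and its first variation -/

/-- `β` is not longer than any Lipschitz curve with the same endpoints, and its speed is at most
its length. -/
structure IsSpeedMinimizer (n : ℕ) (β : ℝ → GLN N) : Prop where
  isLip : IsLip β
  exists_length : ∃ L : ℝ, 0 ≤ L ∧ (∀ᵐ t ∂unitVol, pNorm n (leftVelocity β t) ≤ L) ∧
    ∀ α : ℝ → GLN N, IsLip α → α 0 = β 0 → α 1 = β 1 →
      L ≤ ∫ t in (0 : ℝ)..1, pNorm n (leftVelocity α t)

/-- The energy of β is at most L^(2n), L is at most the length integral of α, and Jensen's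
inequality bounds the 2n-th power of that integral by the energy of α. -/
theorem IsSpeedMinimizer.pEnergy_le {n : ℕ} (hn : 1 ≤ n) {β α : ℝ → GLN N}
    (hβ : IsSpeedMinimizer n β) (hα : IsLip α) (h0 : α 0 = β 0) (h1 : α 1 = β 1) :
    ∫ t, pEnergy n (leftVelocity β t) ∂unitVol ≤ ∫ t, pEnergy n (leftVelocity α t) ∂unitVol := by
  have := isProbabilityMeasure_unitVol
  obtain ⟨hL, L, hL0, hle, hmin⟩ := hβ
  have e1 : ∫ t, pEnergy n (leftVelocity β t) ∂unitVol ≤ L ^ (2 * n) := by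
    have : ∫ t, pEnergy n (leftVelocity β t) ∂unitVol ≤ ∫ _, L ^ (2 * n) ∂unitVol := by
      refine integral_mono_ae (hL.bddMeas.comp (continuous_pEnergy n)).integrableOn
        (integrable_const _) ?_
      filter_upwards [hle] with t ht
      rw [← pNorm_pow hn]
      exact pow_le_pow_left₀ (pNorm_nonneg n _) ht _
    simpa using this
  have e2 := hmin α hα h0 h1
  rw [intervalIntegral_eq_unitVol] at e2
  have hb := bddMeas_pNorm n hα
  have e3 := (Even.convexOn_pow (𝕜 := ℝ) (even_two_mul n)).map_integral_le (μ := unitVol)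
    (f := fun t => pNorm n (leftVelocity α t)) (continuous_pow (2 * n)).continuousOn isClosed_univ
    (by simp) hb.integrableOn (hb.comp (continuous_pow (2 * n))).integrableOn
  simp only [pNorm_pow hn] at e3
  exact e1.trans ((pow_le_pow_left₀ hL0 e2 _).trans e3)

open Filter in
-- β is compared with (1 + εu)β, where u is the primitive of k. Convexity replaces differentiation
-- under the integral sign: the gradient inequality at the perturbed velocity bounds the energy
-- increase, and dominated convergence finishes.
theorem IsSpeedMinimizer.first_variation (hN : 1 ≤ N) {n : ℕ} (hn : 1 ≤ n) {β : ℝ → GLN N}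
    (hβ : IsSpeedMinimizer n β) {k : ℝ → Mat N} (hk : BddMeas k)
    (hk0 : ∫ t in (0 : ℝ)..1, k t = 0) :
    0 ≤ ∫ t, tau ((gradMap n (leftVelocity β t))ᴴ * ((toMat β t)⁻¹ * k t * toMat β t))
      ∂unitVol := by
  have hlip := hβ.isLip
  obtain ⟨u, B, hu0, hu1, hu, huB, huk⟩ := exists_primitive hk hk0
  -- Since u is bounded by B, this keeps εu within 1/2 in norm, so 1 + εu stays invertible.
  set ε : ℕ → ℝ := fun j => 1 / ((2 * B + 1) * (j + 1)) with hε
  have hεpos : ∀ j, 0 < ε j := fun j => by simp only [hε]; positivity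
  have hεle : ∀ j, ε j ≤ 1 := fun j => by
    simp only [hε]
    rw [div_le_one (by positivity)]
    nlinarith [B.2, (Nat.cast_nonneg j : (0 : ℝ) ≤ j), mul_nonneg B.2 (Nat.cast_nonneg (α := ℝ) j)]
  have hεlim : Tendsto ε atTop (𝓝 0) := by
    have h1 := (tendsto_one_div_add_atTop_nhds_zero_nat (𝕜 := ℝ)).const_mul (1 / (2 * B + 1 : ℝ))
    rw [mul_zero] at h1
    refine h1.congr fun j => ?_
    simp only [hε]; rw [one_div_mul_one_div]
  have hsmall : ∀ j, ∀ t ∈ Icc (0 : ℝ) 1, ‖ε j • u t‖ ≤ 1 / 2 := fun j t ht => by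
    rw [norm_smul, Real.norm_eq_abs, abs_of_pos (hεpos j)]
    have h1 : ε j * ‖u t‖ ≤ ε j * B := mul_le_mul_of_nonneg_left (huB t ht) (hεpos j).le
    refine h1.trans ?_
    simp only [hε]
    rw [one_div_mul_eq_div, div_le_iff₀ (by positivity)]
    nlinarith [B.2, (Nat.cast_nonneg j : (0 : ℝ) ≤ j), mul_nonneg B.2 (Nat.cast_nonneg (α := ℝ) j)]
  let y : ℕ → ℝ → Mat N := fun j t =>
    (toMat β t)⁻¹ * (1 + ε j • u t)⁻¹ * k t * toMat β t
  have hIcont : ∀ j, ContinuousOn (fun t => (1 + ε j • u t)⁻¹) (Icc 0 1) := fun j t ht =>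
    (contDiffAt_inv (isUnit_one_add ((hsmall j t ht).trans_lt (by norm_num)))).continuousAt
      |>.comp_continuousWithinAt (f := fun t => 1 + ε j • u t)
        (continuousWithinAt_const.add ((hu.continuousOn t ht).const_smul (ε j)))
  have hci := continuousOn_toMat_inv hlip.continuousOn
  have hy : ∀ j, BddMeas (y j) := fun j =>
    (((BddMeas.of_continuousOn hci).mul (BddMeas.of_continuousOn (hIcont j))).mul hk).mul
      (BddMeas.of_continuousOn hlip.continuousOn)
  have hv := hlip.bddMeas
  have hpert : ∀ j, BddMeas fun t => leftVelocity β t + ε j • y j t := fun j =>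
    hv.add ((hy j).comp (continuous_const_smul (ε j)))
  have hgrad : ∀ j, BddMeas fun t =>
      tau ((gradMap n (leftVelocity β t + ε j • y j t))ᴴ * y j t) := fun j =>
    (BddMeas.mul ((hpert j).comp (contDiff_conjTranspose.continuous.comp (continuous_gradMap n)))
      (hy j)).comp continuous_tau
  have hnonneg : ∀ j, 0 ≤ ∫ t, tau ((gradMap n (leftVelocity β t + ε j • y j t))ᴴ * y j t)
      ∂unitVol := by
    intro j
    obtain ⟨α, hα, hα0, hα1, hαv⟩ := exists_perturbed_curve hlip (u := fun t => ε j • u t)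
      (k := fun t => ε j • k t) (B := ‖ε j‖₊ * B) (by simp [hu0]) (by simp [hu1])
      (LipschitzOnWith.of_dist_le_mul fun a ha b hb => by
        rw [dist_smul₀, NNReal.coe_mul, mul_assoc]
        exact mul_le_mul_of_nonneg_left (hu.dist_le_mul a ha b hb) (norm_nonneg _))
      (hsmall j) (huk.mono fun t ht => ht.const_smul (ε j))
    have hle := hβ.pEnergy_le hn hα hα0 hα1
    have hαv' : ∀ᵐ t ∂unitVol, leftVelocity α t = leftVelocity β t + ε j • y j t := by
      filter_upwards [hαv] with t ht
      rw [ht]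
      simp only [y, mul_smul_comm, smul_mul_assoc]
    have hmono : ∫ t, pEnergy n (leftVelocity α t) ∂unitVol ≤
        ∫ t, (pEnergy n (leftVelocity β t) +
          2 * n * ε j * tau ((gradMap n (leftVelocity β t + ε j • y j t))ᴴ * y j t)) ∂unitVol := by
      refine integral_mono_ae (hα.bddMeas.comp (continuous_pEnergy n)).integrableOn
        ((hv.comp (continuous_pEnergy n)).integrableOn.add ((hgrad j).integrableOn.const_mul _)) ?_
      filter_upwards [hαv'] with t ht
      rw [ht]
      -- The tangent is taken at the perturbed point, so that convexity bounds the perturbed energy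
      -- from above.
      have h1 := pEnergy_gradient_le hn (leftVelocity β t + ε j • y j t) (leftVelocity β t)
      rw [sub_add_cancel_left, ← smul_neg, mul_smul_comm, tau_smul, mul_neg,
        show tau (-((gradMap n (leftVelocity β t + ε j • y j t))ᴴ * y j t)) =
          -tau ((gradMap n (leftVelocity β t + ε j • y j t))ᴴ * y j t) from map_neg (tauL N) _] at h1
      linarith
    rw [integral_add (hv.comp (continuous_pEnergy n)).integrableOn
      ((hgrad j).integrableOn.const_mul _), integral_const_mul] at hmono
    have hpos : (0 : ℝ) < 2 * n * ε j := by
      have : (0 : ℝ) < n := by exact_mod_cast hn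
      have := hεpos j
      positivity
    have h2 := hle.trans hmono
    exact nonneg_of_mul_nonneg_right (by linarith) hpos
  obtain ⟨V, hV⟩ := hv.2
  obtain ⟨Kk, hKk⟩ := hk.2
  obtain ⟨A, hA⟩ := isCompact_Icc.exists_bound_of_continuousOn hlip.continuousOn
  obtain ⟨A', hA'⟩ := isCompact_Icc.exists_bound_of_continuousOn hci
  have hI2 : ∀ j, ∀ t ∈ Icc (0 : ℝ) 1, ‖(1 + ε j • u t)⁻¹‖ ≤ 2 := fun j t ht => by
    have h1 := norm_inv_one_add_sub_one_le hN (hsmall j t ht)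
    have h2 := norm_add_le (1 : Mat N) ((1 + ε j • u t)⁻¹ - 1)
    rw [add_sub_cancel, norm_one_mat hN] at h2
    linarith [hsmall j t ht]
  set Y := A' * 2 * Kk * A
  have hyY : ∀ j, ∀ᵐ t ∂unitVol, ‖y j t‖ ≤ Y := fun j => by
    filter_upwards [ae_restrict_mem measurableSet_Icc, hKk] with t ht hkt
    have a0 : 0 ≤ A' := (norm_nonneg _).trans (hA' t ht)
    have k0 : 0 ≤ Kk := (norm_nonneg _).trans hkt
    refine (norm_mul_le _ _).trans (mul_le_mul ((norm_mul_le _ _).trans (mul_le_mul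
      ((norm_mul_le _ _).trans (mul_le_mul (hA' t ht) (hI2 j t ht) (norm_nonneg _) a0)) hkt
      (norm_nonneg _) (by positivity))) (hA t ht) (norm_nonneg _) (by positivity))
  obtain ⟨Q, hQ⟩ := (isCompact_closedBall (0 : Mat N) (V + Y)).exists_bound_of_continuousOn
    (continuous_gradMap (N := N) n).continuousOn
  have hlimint : Tendsto (fun j => ∫ t, tau ((gradMap n (leftVelocity β t + ε j • y j t))ᴴ * y j t)
      ∂unitVol) atTop (𝓝 (∫ t, tau ((gradMap n (leftVelocity β t))ᴴ *
        ((toMat β t)⁻¹ * k t * toMat β t)) ∂unitVol)) := by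
    refine tendsto_integral_of_dominated_convergence (fun _ => ‖tauL N‖ * (Q * Y))
      (fun j => (hgrad j).1) (integrable_const _) (fun j => ?_) ?_
    · filter_upwards [hyY j, hV] with t h1 h2
      have h3 : ‖leftVelocity β t + ε j • y j t‖ ≤ V + Y := by
        refine (norm_add_le _ _).trans (add_le_add h2 ?_)
        rw [norm_smul, Real.norm_eq_abs, abs_of_pos (hεpos j)]
        exact (mul_le_of_le_one_left (norm_nonneg _) (hεle j)).trans h1
      have h4 := hQ _ (by simpa using h3)
      refine ((tauL N).le_opNorm _).trans (mul_le_mul_of_nonneg_left ?_ (norm_nonneg _))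
      refine (norm_mul_le _ _).trans ?_
      rw [norm_conjTranspose_mat]
      exact mul_le_mul h4 h1 (norm_nonneg _) ((norm_nonneg _).trans h4)
    · refine Eventually.of_forall fun t => ?_
      have hlu : Tendsto (fun j => 1 + ε j • u t) atTop (𝓝 (1 : Mat N)) := by
        have := (hεlim.smul_const (u t)).const_add (1 : Mat N)
        rwa [zero_smul, add_zero] at this
      have hli : Tendsto (fun j => (1 + ε j • u t)⁻¹) atTop (𝓝 (1 : Mat N)) := by
        have := (contDiffAt_inv (isUnit_one (M := Mat N))).continuousAt.tendsto.comp hlu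
        rwa [inv_one] at this
      have hly : Tendsto (fun j => y j t) atTop (𝓝 ((toMat β t)⁻¹ * k t * toMat β t)) := by
        have := ((hli.const_mul (toMat β t)⁻¹).mul_const (k t)).mul_const (toMat β t)
        rwa [mul_one] at this
      have hlp : Tendsto (fun j => leftVelocity β t + ε j • y j t) atTop (𝓝 (leftVelocity β t)) := by
        have := (hεlim.smul hly).const_add (leftVelocity β t)
        rwa [zero_smul, add_zero] at this
      have hlg := (contDiff_conjTranspose.continuous.comp (continuous_gradMap (N := N) n)).tendsto
        (leftVelocity β t) |>.comp hlp
      exact (continuous_tau.tendsto _).comp (hlg.mul hly)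
  exact ge_of_tendsto' hlimint hnonneg

/-- Conservation of momentum along a minimizer. -/
theorem IsSpeedMinimizer.exists_momentum (hN : 1 ≤ N) {n : ℕ} (hn : 1 ≤ n) {β : ℝ → GLN N}
    (hβ : IsSpeedMinimizer n β) :
    ∃ c : Mat N, ∀ᵐ t ∂unitVol,
      gradMap n (leftVelocity β t) = (toMat β t)ᴴ * c * ((toMat β t)⁻¹)ᴴ := by
  have := isProbabilityMeasure_unitVol
  have hlip := hβ.isLip
  -- Z is the adjoint of the momentum; by cyclicity the first variation is the integral of τ(Zk).
  let Z : ℝ → Mat N := fun t => toMat β t * (gradMap n (leftVelocity β t))ᴴ * (toMat β t)⁻¹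
  have hZ : BddMeas Z := ((BddMeas.of_continuousOn hlip.continuousOn).mul
    (hlip.bddMeas.comp (contDiff_conjTranspose.continuous.comp (continuous_gradMap n)))).mul
      (BddMeas.of_continuousOn (continuousOn_toMat_inv hlip.continuousOn))
  set z : Mat N := ∫ t, Z t ∂unitVol with hz
  have hW : BddMeas fun t => Z t - z := hZ.comp (φ := fun x => x - z) (by fun_prop)
  have hW0 : ∫ t, (Z t - z) ∂unitVol = 0 := by
    rw [integral_sub hZ.integrableOn (integrable_const _)]
    simp [hz]
  have hconj : Continuous fun x : Mat N => xᴴ := contDiff_conjTranspose.continuous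
  -- Testing with this k, which has mean zero, turns the first variation into minus the variance of
  -- Z, which must then vanish.
  have hWH : BddMeas fun t => -(Z t - z)ᴴ := hW.comp (φ := fun x => -xᴴ) hconj.neg
  let J : Mat N →L[ℝ] Mat N := LinearMap.toContinuousLinearMap
    (Matrix.conjTransposeLinearEquiv (Fin N) (Fin N) ℝ ℂ).toLinearMap
  have hk0 : ∫ t in (0 : ℝ)..1, -(Z t - z)ᴴ = 0 := by
    rw [intervalIntegral_eq_unitVol, integral_neg]
    have h1 := J.integral_comp_comm (μ := unitVol) hW.integrableOn
    rw [hW0, map_zero] at h1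
    rw [show ∫ t, (Z t - z)ᴴ ∂unitVol = 0 from h1, neg_zero]
  have hfv := hβ.first_variation hN hn hWH hk0
  have e1 : ∀ t, tau ((gradMap n (leftVelocity β t))ᴴ *
      ((toMat β t)⁻¹ * -(Z t - z)ᴴ * toMat β t)) =
      -tau ((Z t - z) * (Z t - z)ᴴ) - tau (z * (Z t - z)ᴴ) := fun t => by
    have h1 : tau ((gradMap n (leftVelocity β t))ᴴ * ((toMat β t)⁻¹ * -(Z t - z)ᴴ * toMat β t)) =
        tau (Z t * -(Z t - z)ᴴ) := by
      rw [← mul_assoc, tau_mul_comm]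
      simp only [Z, mul_assoc]
    rw [h1, mul_neg, show tau (-(Z t * (Z t - z)ᴴ)) = -tau (Z t * (Z t - z)ᴴ) from
      map_neg (tauL N) _, sub_mul, tau_sub]
    ring
  have hi1 : BddMeas fun t => tau ((Z t - z) * (Z t - z)ᴴ) :=
    hW.comp (φ := fun x => tau (x * xᴴ)) (continuous_tau.comp (continuous_id.mul hconj))
  have hi2 : BddMeas fun t => tau (z * (Z t - z)ᴴ) :=
    hW.comp (φ := fun x => tau (z * xᴴ)) (continuous_tau.comp (continuous_const.mul hconj))
  have e2 : ∫ t, tau (z * (Z t - z)ᴴ) ∂unitVol = 0 := by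
    have h1 := ((tauL N).comp ((ContinuousLinearMap.mul ℝ (Mat N) z).comp J)).integral_comp_comm
      (μ := unitVol) hW.integrableOn
    rw [hW0, map_zero] at h1
    exact h1
  simp only [e1] at hfv
  have e3 : ∫ t, (-tau ((Z t - z) * (Z t - z)ᴴ) - tau (z * (Z t - z)ᴴ)) ∂unitVol =
      -∫ t, tau ((Z t - z) * (Z t - z)ᴴ) ∂unitVol := by
    refine (integral_sub (f := fun t => -tau ((Z t - z) * (Z t - z)ᴴ)) hi1.integrableOn.neg
      hi2.integrableOn).trans ?_
    refine (congrArg₂ (· - ·) (integral_neg _) e2).trans (sub_zero _)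
  rw [e3] at hfv
  have hnn : ∀ t, 0 ≤ tau ((Z t - z) * (Z t - z)ᴴ) := fun t => by
    rw [tau_mul_comm]; exact tau_conjTranspose_mul_self_nonneg _
  have hzero : ∫ t, tau ((Z t - z) * (Z t - z)ᴴ) ∂unitVol = 0 :=
    le_antisymm (by linarith) (integral_nonneg hnn)
  rw [integral_eq_zero_iff_of_nonneg hnn hi1.integrableOn] at hzero
  refine ⟨zᴴ, ?_⟩
  filter_upwards [hzero] with t ht
  have hZt : Z t = z := by
    have h1 : tau ((Z t - z)ᴴ * (Z t - z)) = 0 := by rw [tau_mul_comm]; exact ht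
    exact sub_eq_zero.1 (eq_zero_of_tau_conjTranspose_mul_self hN h1)
  have h2 : (toMat β t)⁻¹ * Z t * toMat β t = (gradMap n (leftVelocity β t))ᴴ := by
    simp only [Z]
    rw [mul_assoc, mul_assoc, toMat_inv_mul, mul_one, ← mul_assoc, toMat_inv_mul, one_mul]
  rw [hZt] at h2
  have h3 := congrArg Matrix.conjTranspose h2
  simp only [Matrix.conjTranspose_mul, Matrix.conjTranspose_conjTranspose] at h3
  rw [← h3, mul_assoc]

/-! ### From almost everywhere to everywhere -/

theorem hasDerivWithinAt_integral_of_continuousOn {E : Type*} [NormedAddCommGroup E]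
    [NormedSpace ℝ E] [CompleteSpace E] {f : ℝ → E} (hf : ContinuousOn f (Icc 0 1)) {t : ℝ}
    (ht : t ∈ Icc (0 : ℝ) 1) :
    HasDerivWithinAt (fun s => ∫ r in (0 : ℝ)..s, f r) (f t) (Icc 0 1) t := by
  -- Extending f by its endpoint values makes the two-sided fundamental theorem available at 0 and
  -- 1.
  have hg : Continuous (IccExtend (zero_le_one (α := ℝ)) ((Icc (0 : ℝ) 1).domRestrict f)) :=
    (continuousOn_iff_continuous_domRestrict.1 hf).Icc_extend'
  have hfg : ∀ r ∈ Icc (0 : ℝ) 1,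
      IccExtend (zero_le_one (α := ℝ)) ((Icc (0 : ℝ) 1).domRestrict f) r = f r := fun r hr =>
    IccExtend_of_mem _ _ hr
  have h1 := (hg.integral_hasStrictDerivAt 0 t).hasDerivAt.hasDerivWithinAt (s := Icc 0 1)
  rw [hfg t ht] at h1
  have h2 : ∀ s ∈ Icc (0 : ℝ) 1, ∫ r in (0 : ℝ)..s, f r = ∫ r in (0 : ℝ)..s,
      IccExtend (zero_le_one (α := ℝ)) ((Icc (0 : ℝ) 1).domRestrict f) r := fun s hs =>
    intervalIntegral.integral_congr fun r hr =>
      (hfg r (uIcc_subset_Icc (left_mem_Icc.2 zero_le_one) hs hr)).symm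
  exact h1.congr h2 (h2 t ht)

/-- The almost everywhere identity for the momentum becomes an integral equation whose integrand is
continuous along β, so it can be differentiated at every point of [0,1]. -/
theorem IsSpeedMinimizer.isEulerLagrange (hN : 1 ≤ N) {n : ℕ} (hn : 1 ≤ n) {β : ℝ → GLN N}
    (hβ : IsSpeedMinimizer n β) : IsEulerLagrange n β := by
  obtain ⟨c, hc⟩ := hβ.exists_momentum hN hn
  have hlip := hβ.isLip
  refine isEulerLagrange_of_ode hN hn c fun t ht => ?_
  have m0 : (0 : ℝ) ∈ Icc (0 : ℝ) 1 := left_mem_Icc.2 zero_le_one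
  have hcont : ContinuousOn (fun r => odeField hN hn c (toMat β r)) (Icc 0 1) := fun r hr =>
    (contDiffAt_odeField hN hn c (isUnit_toMat β r)).continuousAt.comp_continuousWithinAt
      (hlip.continuousOn r hr)
  have hprim : ∀ s ∈ Icc (0 : ℝ) 1,
      toMat β s = toMat β 0 + ∫ r in (0 : ℝ)..s, odeField hN hn c (toMat β r) := fun s hs => by
    have h1 := hlip.integral_eq m0 hs
    rw [← sub_eq_iff_eq_add', ← h1]
    refine intervalIntegral.integral_congr_ae ?_
    filter_upwards [(ae_restrict_iff' measurableSet_Icc).1 hc] with r hr hrs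
    rw [odeField, ← hr (uIcc_subset_Icc m0 hs (uIoc_subset_uIcc hrs)), symm_gradMap]
  exact ((hasDerivWithinAt_integral_of_continuousOn hcont ht).const_add (toMat β 0)).congr hprim
    (hprim t ht)

/-- Two inequalities suffice: the speed of β is at most its length, and the length of a Lipschitz
competitor is at most the integral of its speed. -/
theorem isSpeedMinimizer_of_param (hN : 1 ≤ N) {n : ℕ} (hn : 1 ≤ n) {γ β : ℝ → GLN N}
    (hrect : IsRectifiable n γ) (hmin : IsMinimizing n γ) (hβ : IsConstantSpeedParam n γ β) :
    IsSpeedMinimizer n β := by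
  have hlen := hβ.rectLength_eq hn
  obtain ⟨h0, h1⟩ := hβ.endpoints
  have hfin : rectLength n β 0 1 ≠ ⊤ := hlen ▸ hrect.2.ne
  have hlip := hβ.1.isLip hN hn hfin
  refine ⟨hlip, (rectLength n β 0 1).toReal, ENNReal.toReal_nonneg, ?_, fun α hα hα0 hα1 => ?_⟩
  · filter_upwards [ae_mem_Ioo, ae_hasDerivAt_of_lipschitzOnWith hlip.choose_spec] with t ht hd
    exact hβ.1.pNorm_le hN hn hfin ht hd
  · refine ENNReal.toReal_le_of_le_ofReal
      (intervalIntegral.integral_nonneg zero_le_one fun _ _ => pNorm_nonneg n _) ?_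
    refine le_trans ?_ (hα.rectLength_le hN hn)
    rw [← hlen, show rectLength n γ 0 1 = rectDist n (γ 0) (γ 1) from hmin]
    exact iInf₂_le α ⟨hα.isRectifiable hN hn, hα0.trans h0.symm, hα1.trans h1.symm⟩

end

end GLp

theorem mainTheorem7 (N n : ℕ) (hN : 1 ≤ N) (hn : 1 ≤ n) (γ : ℝ → GLp.GLN N)
    (hrect : GLp.IsRectifiable n γ) (hmin : GLp.IsMinimizing n γ) :
    (∃ β : ℝ → GLp.GLN N, GLp.IsConstantSpeedParam n γ β) ∧
    ∀ β : ℝ → GLp.GLN N, GLp.IsConstantSpeedParam n γ β →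
      ContDiffOn ℝ ∞ (GLp.toMat β) (Set.Icc 0 1) ∧
      GLp.IsEulerLagrange n β ∧
      ∀ g : ℝ → GLp.GLN N, GLp.IsEulerLagrange n g → g 0 = β 0 →
        GLp.velocity g 0 = GLp.velocity β 0 → Set.EqOn g β (Set.Icc 0 1) := by
  refine ⟨GLp.exists_constantSpeedParam hN hn hrect, fun β hβ => ?_⟩
  have hEL := (GLp.isSpeedMinimizer_of_param hN hn hrect hmin hβ).isEulerLagrange hN hn
  exact ⟨GLp.contDiffOn_of_isEulerLagrange hN hn hEL, hEL,
    fun g hg h0 h1 => GLp.eqOn_of_isEulerLagrange hN hn hEL hg h0 h1⟩
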